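/- Let $(M,\omega)$ be a smooth symplectic manifold (Hausdorff, second countable) of dimension $2n$. All connections are smooth linear connections on $TM$. A connection $\nabla$ is *almost symplectic* if $\nabla\omega=0$, and *symplectic* if moreover its torsion vanishes. For a symplectic connection let $R(X,Y)Z=\nabla_X\nabla_YZ-\nabla_Y\nabla_XZ-\nabla_{[X,Y]}Z$ be the curvature and $r(X,Y)=\operatorname{Tr}(Z\mapsto R(X,Z)Y)$ the Ricci tensor; a connection is *of Ricci-type* if it is symplectic and $$\omega(R(X,Y)Z,T)=-\tfrac{1}{2(n+1)}\bigl[2\omega(X,Y)r(Z,T)+\omega(X,Z)r(Y,T)+\omega(X,T)r(Y,Z)-\omega(Y,Z)r(X,T)-\omega(Y,T)r(X,Z)\bigr]$$ for all tangent vectors $X,Y,Z,T$ at all points of $M$. Let $\pi:J(M,\omega)\to M$ be the bundle, a submanifold of the total space of $\operatorname{End}(TM)$, whose fibre at $x$ is the set of all $j\in\operatorname{End}(T_xM)$ with $j^2=-1$, $\omega_x(ju,v)+\omega_x(u,jv)=0$ for all $u,v$, and $\omega_x(u,ju)>0$ for all $u\neq0$. Let $\mathcal J$ be the tautological section of $\operatorname{End}(\pi^{-1}TM)$,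 whose value at $j$ is $j$. For an almost symplectic connection $\nabla$ let $J^\nabla$ be the unique almost complex structure on the manifold $J(M,\omega)$ such that, for all $j\in J(M,\omega)$ and $X\in T_jJ(M,\omega)$, $$d\pi(J^\nabla X)=j\,(d\pi X),\qquad (\pi^{-1}\nabla)_{J^\nabla X}\mathcal J=j\circ(\pi^{-1}\nabla)_X\mathcal J .$$ It is *integrable* if its Nijenhuis tensor $[J^\nabla X,J^\nabla Y]-J^\nabla[J^\nabla X,Y]-J^\nabla[X,J^\nabla Y]-[X,Y]$ vanishes for all vector fields $X,Y$ on open subsets of $J(M,\omega)$. Then: (i) If $\nabla$ is almost symplectic and $J^\nabla$ is integrable, then there is a symplectic connection $\nabla'$ with $J^{\nabla'}=J^\nabla$. (ii) If $\nabla,\nabla'$ are symplectic connections with $J^{\nabla'}=J^\nabla$, then $\nabla=\nabla'$. (iii) If $\nabla$ is a symplectic connection, then $J^\nabla$ is integrable if and only if $\nabla$ is of Ricci-type. -/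

import Mathlib

open Bundle Topology Filter VectorField
open scoped Manifold ContDiff

noncomputable section

/-! ### Almost complex structures on embedded submanifolds -/

section Submanifold

variable {E' : Type*} [NormedAddCommGroup E'] [NormedSpace ℝ E']
  {H' : Type*} [TopologicalSpace H'] (I' : ModelWithCorners ℝ E' H')
  {N : Type*} [TopologicalSpace N] [ChartedSpace H' N]

/-- The vectors tangent at `p` to an embedded submanifold `S` of a manifold `N`: the velocities at
time `0` of the curves in `S` through `p`. -/
def tangentTo (S : Set N) (p : N) : Set (TangentSpace I' p) :=
  {X | ∃ γ : ℝ → N, (∀ᶠ t in 𝓝 (0 : ℝ), γ t ∈ S) ∧ MDifferentiableAt 𝓘(ℝ, ℝ) I' γ 0 ∧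
    tangentMap 𝓘(ℝ, ℝ) I' γ ⟨0, (1 : ℝ)⟩ = ⟨p, X⟩}

/-- `X` is a vector field on `N`, smooth near `p`, whose restriction to the embedded submanifold `S`
is a vector field on `S` near `p`. Near `p`, every smooth vector field on `S` is the restriction of
such an `X`, and the Lie bracket of two fields on `S` is the restriction to `S` of the bracket of
any two such extensions. -/
def IsTangentFieldAt [IsManifold I' ∞ N] (S : Set N) (p : N) (X : Π q : N, TangentSpace I' q) :
    Prop :=
  ContMDiffAt I' I'.tangent ∞ (fun q ↦ (⟨q, X q⟩ : TangentBundle I' N)) p ∧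
    ∀ᶠ q in 𝓝 p, q ∈ S → X q ∈ tangentTo I' S q

/-- Integrability of an almost complex structure `J` on an embedded submanifold `S` of `N`: its
Nijenhuis tensor `[JX, JY] - J[JX, Y] - J[X, JY] - [X, Y]` vanishes for all vector fields `X`, `Y`
on open subsets of `S`. The fields `X'` and `Y'` are extensions of `JX` and `JY`. Only the values of
`J` on vectors tangent to `S` matter. -/
def IsIntegrableAlmostComplex [IsManifold I' ∞ N] (S : Set N)
    (J : Π p : N, TangentSpace I' p → TangentSpace I' p) : Prop :=
  ∀ p ∈ S, ∀ X Y X' Y' : Π q : N, TangentSpace I' q,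
    IsTangentFieldAt I' S p X → IsTangentFieldAt I' S p Y →
    IsTangentFieldAt I' S p X' → IsTangentFieldAt I' S p Y' →
    (∀ᶠ q in 𝓝 p, q ∈ S → X' q = J q (X q)) → (∀ᶠ q in 𝓝 p, q ∈ S → Y' q = J q (Y q)) →
    mlieBracket I' X' Y' p - J p (mlieBracket I' X' Y p) - J p (mlieBracket I' X Y' p)
      - mlieBracket I' X Y p = 0

end Submanifold

/-! ### Symplectic manifolds and their connections -/

section Symplectic

variable {E : Type*} [NormedAddCommGroup E] [NormedSpace ℝ E]
  {M : Type*} [TopologicalSpace M] [ChartedSpace E M] [IsManifold 𝓘(ℝ, E) ∞ M]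

variable (E M) in
/-- A symplectic form on the manifold `M`: a smooth, non-degenerate, closed 2-form. -/
structure SymplecticForm where
  toFun (x : M) : TangentSpace 𝓘(ℝ, E) x →L[ℝ] TangentSpace 𝓘(ℝ, E) x →L[ℝ] ℝ
  alt (x : M) (u : TangentSpace 𝓘(ℝ, E) x) : toFun x u u = 0
  nondegenerate (x : M) (u : TangentSpace 𝓘(ℝ, E) x) (hu : ∀ v, toFun x u v = 0) : u = 0
  smooth : ContMDiff 𝓘(ℝ, E) (𝓘(ℝ, E).prod 𝓘(ℝ, E →L[ℝ] E →L[ℝ] ℝ)) ∞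
    (fun x ↦ TotalSpace.mk' (E →L[ℝ] E →L[ℝ] ℝ)
      (E := fun x : M ↦ TangentSpace 𝓘(ℝ, E) x →L[ℝ] TangentSpace 𝓘(ℝ, E) x →L[ℝ] ℝ) x (toFun x))
  /-- `dΩ (X, Y, Z) = 0` for all vector fields `X`, `Y`, `Z`. -/
  closed (x : M) (X Y Z : Π x : M, TangentSpace 𝓘(ℝ, E) x)
    (hX : CMDiffAt ∞ (T% X) x) (hY : CMDiffAt ∞ (T% Y) x) (hZ : CMDiffAt ∞ (T% Z) x) :
    mvfderiv 𝓘(ℝ, E) (fun y ↦ toFun y (Y y) (Z y)) x (X x)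
      + mvfderiv 𝓘(ℝ, E) (fun y ↦ toFun y (Z y) (X y)) x (Y x)
      + mvfderiv 𝓘(ℝ, E) (fun y ↦ toFun y (X y) (Y y)) x (Z x)
      - toFun x (mlieBracket 𝓘(ℝ, E) X Y x) (Z x)
      - toFun x (mlieBracket 𝓘(ℝ, E) Y Z x) (X x)
      - toFun x (mlieBracket 𝓘(ℝ, E) Z X x) (Y x) = 0

variable (E M) in
/-- Linear connections on `M`. The covariant derivative `∇_v Y` of the vector field `Y` along
`v : T_x M` is written `D Y x v`; it is meaningful when `Y` is differentiable at `x`. -/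
abbrev LinearConnection :=
  CovariantDerivative 𝓘(ℝ, E) E (TangentSpace 𝓘(ℝ, E) : M → Type _)

/-- An almost symplectic connection: a smooth linear connection with `∇Ω = 0`. -/
structure IsAlmostSymplectic (Ω : SymplecticForm E M) (D : LinearConnection E M) : Prop where
  smooth : D.ContMDiffCovariantDerivative ∞
  parallel (x : M) (v : TangentSpace 𝓘(ℝ, E) x) (Y Z : Π x : M, TangentSpace 𝓘(ℝ, E) x)
    (hY : MDiffAt (T% Y) x) (hZ : MDiffAt (T% Z) x) :
    mvfderiv 𝓘(ℝ, E) (fun y ↦ Ω.toFun y (Y y) (Z y)) x v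
      = Ω.toFun x (D Y x v) (Z x) + Ω.toFun x (Y x) (D Z x v)

/-- Two connections are equal as differential operators: they agree on all vector fields at all
points of differentiability. -/
def SameConnection (D D' : LinearConnection E M) : Prop :=
  ∀ (x : M) (Y : Π x : M, TangentSpace 𝓘(ℝ, E) x), MDiffAt (T% Y) x → D Y x = D' Y x

/-- The curvature `R(X, Y)Z = ∇_X ∇_Y Z - ∇_Y ∇_X Z - ∇_[X, Y] Z`. -/
def curvatureField (D : LinearConnection E M) (X Y Z : Π x : M, TangentSpace 𝓘(ℝ, E) x) (x : M) :
    TangentSpace 𝓘(ℝ, E) x :=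
  D (fun y ↦ D Z y (Y y)) x (X x) - D (fun y ↦ D Z y (X y)) x (Y x)
    - D Z x (mlieBracket 𝓘(ℝ, E) X Y x)

/-- The curvature tensor at `x`, evaluated through extensions of the arguments to vector fields
which are smooth near `x`. -/
def curvatureTensor (D : LinearConnection E M) (x : M) (u v w : TangentSpace 𝓘(ℝ, E) x) :
    TangentSpace 𝓘(ℝ, E) x :=
  curvatureField D (FiberBundle.extend E u) (FiberBundle.extend E v) (FiberBundle.extend E w) x

variable [FiniteDimensional ℝ E]

/-- A symplectic connection: almost symplectic with vanishing torsion. -/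
structure IsSymplecticConnection (Ω : SymplecticForm E M) (D : LinearConnection E M) : Prop
    extends IsAlmostSymplectic Ω D where
  torsion_eq_zero : D.torsion = 0

/-- The Ricci tensor `r(u, v) = Tr (w ↦ R(u, w) v)`; the trace is computed in a basis of
`T_x M = E`. -/
def ricciTensor (D : LinearConnection E M) (x : M) (u v : TangentSpace 𝓘(ℝ, E) x) : ℝ :=
  ∑ i, (Module.finBasis ℝ E).coord i (curvatureTensor D x u (Module.finBasis ℝ E i) v)

/-- The Ricci component of the symplectic curvature tensor `Ω(R(X, Y)Z, T)`; if `dim M = 2n`, then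
the factor is `-1 / (2(n + 1))`. -/
def ricciPart (Ω : SymplecticForm E M) (D : LinearConnection E M) (x : M)
    (X Y Z T : TangentSpace 𝓘(ℝ, E) x) : ℝ :=
  -(1 / ((Module.finrank ℝ E : ℝ) + 2)) *
    (2 * Ω.toFun x X Y * ricciTensor D x Z T + Ω.toFun x X Z * ricciTensor D x Y T
      + Ω.toFun x X T * ricciTensor D x Y Z - Ω.toFun x Y Z * ricciTensor D x X T
      - Ω.toFun x Y T * ricciTensor D x X Z)

/-- The other component `W` of the symplectic curvature tensor. -/
def weylPart (Ω : SymplecticForm E M) (D : LinearConnection E M) (x : M)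
    (X Y Z T : TangentSpace 𝓘(ℝ, E) x) : ℝ :=
  Ω.toFun x (curvatureTensor D x X Y Z) T - ricciPart Ω D x X Y Z T

/-- A connection of Ricci-type: a symplectic connection with `W = 0`. -/
structure IsRicciType (Ω : SymplecticForm E M) (D : LinearConnection E M) : Prop
    extends IsSymplecticConnection Ω D where
  weylPart_eq_zero (x : M) (X Y Z T : TangentSpace 𝓘(ℝ, E) x) : weylPart Ω D x X Y Z T = 0

end Symplectic

/-! ### The twistor bundle and its almost complex structure -/

section Twistor

variable {E : Type*} [NormedAddCommGroup E] [NormedSpace ℝ E]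
  {M : Type*} [TopologicalSpace M] [ChartedSpace E M] [IsManifold 𝓘(ℝ, E) ∞ M]

variable (E M) in
/-- The total space of the vector bundle `End(TM)`; its points are pairs `(x, j)` with
`j : T_x M → T_x M` linear. -/
abbrev EndTM :=
  TotalSpace (E →L[ℝ] E) (fun x : M ↦ TangentSpace 𝓘(ℝ, E) x →L[ℝ] TangentSpace 𝓘(ℝ, E) x)

variable (E) in
/-- The model with corners of the manifold `End(TM)`. -/
abbrev endModel := 𝓘(ℝ, E).prod 𝓘(ℝ, E →L[ℝ] E)

/-- The bundle `J(M, Ω)` of compatible complex structures, as a submanifold of `End(TM)`. Its fibre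
at `x` consists of the `j` in the Lie algebra `sp(T_x M, Ω_x)` with `j ^ 2 = -1` for which the
symmetric form `Ω_x(u, j v)` is positive definite. -/
def twistorBundle (Ω : SymplecticForm E M) : Set (EndTM E M) :=
  {p | (∀ u, p.2 (p.2 u) = -u) ∧
    (∀ u v, Ω.toFun p.1 (p.2 u) v + Ω.toFun p.1 u (p.2 v) = 0) ∧
    ∀ u, u ≠ 0 → 0 < Ω.toFun p.1 u (p.2 u)}

instance (x : M) : T2Space (TangentSpace 𝓘(ℝ, E) x) := inferInstanceAs (T2Space E)

/-- The extension of tangent vectors with constant coordinates is additive near the base point. -/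
theorem extend_add_eventually (x : M) (w w' : TangentSpace 𝓘(ℝ, E) x) :
    ∀ᶠ y in 𝓝 x, FiberBundle.extend E (w + w') y
      = (FiberBundle.extend E w + FiberBundle.extend E w') y := by
  have hx := FiberBundle.mem_baseSet_trivializationAt' (F := E) (E := TangentSpace 𝓘(ℝ, E)) x
  have h := ((trivializationAt E (TangentSpace 𝓘(ℝ, E)) x).linear ℝ hx).map_add w w'
  filter_upwards [(trivializationAt E (TangentSpace 𝓘(ℝ, E)) x).open_baseSet.mem_nhds hx] with y hy
  simp only [FiberBundle.extend, Pi.add_apply, h]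
  rw [← Trivialization.symmₗ_apply (R := ℝ) _ hy, ← Trivialization.symmₗ_apply (R := ℝ) _ hy,
    ← Trivialization.symmₗ_apply (R := ℝ) _ hy, map_add]

/-- The extension of tangent vectors with constant coordinates is homogeneous near the base
point. -/
theorem extend_smul_eventually (x : M) (c : ℝ) (w : TangentSpace 𝓘(ℝ, E) x) :
    ∀ᶠ y in 𝓝 x, FiberBundle.extend E (c • w) y = (c • FiberBundle.extend E w) y := by
  have hx := FiberBundle.mem_baseSet_trivializationAt' (F := E) (E := TangentSpace 𝓘(ℝ, E)) x
  have h := ((trivializationAt E (TangentSpace 𝓘(ℝ, E)) x).linear ℝ hx).map_smul c w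
  filter_upwards [(trivializationAt E (TangentSpace 𝓘(ℝ, E)) x).open_baseSet.mem_nhds hx] with y hy
  simp only [FiberBundle.extend, Pi.smul_apply, h]
  rw [← Trivialization.symmₗ_apply (R := ℝ) _ hy, ← Trivialization.symmₗ_apply (R := ℝ) _ hy,
    map_smul]

variable [FiniteDimensional ℝ E]

instance (x : M) : FiniteDimensional ℝ (TangentSpace 𝓘(ℝ, E) x) :=
  inferInstanceAs (FiniteDimensional ℝ E)

/-- The Christoffel operator of the connection at `x`: it sends `w` to `∇_v W`, where the vector
field `W` extends `w` near `x` with constant coordinates in the preferred chart at `x`. -/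
def christoffel (D : LinearConnection E M) (x : M) (v : TangentSpace 𝓘(ℝ, E) x) :
    TangentSpace 𝓘(ℝ, E) x →L[ℝ] TangentSpace 𝓘(ℝ, E) x :=
  LinearMap.toContinuousLinearMap
    { toFun := fun w ↦ D (FiberBundle.extend E w) x v
      map_add' := fun w w' ↦ by
        have hw := FiberBundle.mdifferentiableAt_extend 𝓘(ℝ, E) E w
        have hw' := FiberBundle.mdifferentiableAt_extend 𝓘(ℝ, E) E w'
        rw [D.isCovariantDerivativeOnUniv.congr_of_eventuallyEq
          (FiberBundle.mdifferentiableAt_extend 𝓘(ℝ, E) E (w + w'))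
          (mdifferentiableAt_add_section hw hw') univ_mem (extend_add_eventually x w w'),
          D.isCovariantDerivativeOnUniv.add hw hw']
        rfl
      map_smul' := fun c w ↦ by
        have hw := FiberBundle.mdifferentiableAt_extend 𝓘(ℝ, E) E w
        rw [D.isCovariantDerivativeOnUniv.congr_of_eventuallyEq
          (FiberBundle.mdifferentiableAt_extend 𝓘(ℝ, E) E (c • w))
          (mdifferentiableAt_const.smul_section hw) univ_mem (extend_smul_eventually x c w)]
        exact congrArg (fun f ↦ f v) (D.isCovariantDerivativeOnUniv.smul_const c hw) }

/-- The value along `X`, a tangent vector at `p = (x, j)` of the manifold `End(TM)`, of the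
covariant derivative of the tautological section `(x, j) ↦ j`, with respect to the connection
induced by `D`. The tangent vector `X` is a pair `(v, A)` with `v = dπ X` and with `A` the
derivative of the endomorphism in the preferred chart at `x`, so that the value is `A + [Γ(v), j]`.
It vanishes exactly on the horizontal vectors, and it is `A` on a vertical vector `A`. -/
def covTautological (D : LinearConnection E M) (p : EndTM E M)
    (X : TangentSpace (endModel E) p) : TangentSpace 𝓘(ℝ, E) p.1 →L[ℝ] TangentSpace 𝓘(ℝ, E) p.1 :=
  let A : TangentSpace 𝓘(ℝ, E) p.1 →L[ℝ] TangentSpace 𝓘(ℝ, E) p.1 := X.2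
  A + ((christoffel D p.1 X.1).comp p.2 - p.2.comp (christoffel D p.1 X.1))

/-- The almost complex structure `J^∇` of the twistor bundle: `J^∇ X` is the tangent vector with
`dπ (J^∇ X) = j (dπ X)` and `∇_{J^∇ X} 𝒥 = j ∘ ∇_X 𝒥` for the tautological section `𝒥`. -/
def twistorStructure (D : LinearConnection E M) (p : EndTM E M)
    (X : TangentSpace (endModel E) p) : TangentSpace (endModel E) p :=
  (p.2 X.1, p.2.comp (covTautological D p X) -
    ((christoffel D p.1 (p.2 X.1)).comp p.2 - p.2.comp (christoffel D p.1 (p.2 X.1))))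

/-- `J^∇ = J^∇'`, as endomorphisms of the tangent bundle of the twistor bundle. -/
def SameTwistorStructure (Ω : SymplecticForm E M) (D D' : LinearConnection E M) : Prop :=
  ∀ p ∈ twistorBundle Ω, ∀ X ∈ tangentTo (endModel E) (twistorBundle Ω) p,
    twistorStructure D p X = twistorStructure D' p X

end Twistor

end

/-!
In the chart of `End(TM)` over a chart of `M`, a tangent vector at `(z, j)` is a pair `(v, A)`, the
covariant derivative of the tautological section along it is `A + [Γ v, j]`, and the twistor
structure becomes the explicit `modelStructure` (`twistorStructure_coord`). Since `∇Ω = 0`, parallel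
transport preserves compatible complex structures, so the horizontal vectors `(v, -[Γ v, j])` are
tangent to the twistor bundle (`exists_horizontal_curve`, `mem_tangentTo_of_horizontal`).

The Nijenhuis tensor `N` is computed in coordinates (`nijenhuis_coord`). With `T` the torsion, `R`
the curvature and `a`, `b` the projections of the two vectors, its horizontal part is
`-(T(ja, jb) - j T(ja, b) - j T(a, jb) - T(a, b))`, and its vertical part, the covariant derivative
of the tautological section along `N`, is the same expression in `[R(·, ·), j]`. Fields on the
twistor bundle are given by ambient extensions, and only derivatives along curves in the bundle
enter, so the choice of the extensions does not matter. Horizontal fields realise all pairs `a`,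
`b`; hence the structure is integrable if and only if both expressions vanish for all compatible `j`
at all points (`isIntegrable_twistorStructure_iff`).

What remains is linear algebra on a symplectic vector space. If `x` and `y` are independent with
`σ(x, y) = 0`, then there are compatible `j` with `j x = t z` and `j y = t w` for all `t > 0`
(`exists_isCompatible_smul`), and comparison of the coefficients of the resulting polynomials in `t`
isolates single components of a tensor.

* A curvature tensor annihilated by the second expression satisfies `σ(R(x, y)x, x) = 0` whenever
  `σ(x, y) = 0`. Hence `σ(R(x, y)x, x) = σ(x, y) b(x, x)` for a symmetric form `b`, and the Bianchi
  identity shows that `R` is determined by `b`, which is a multiple of the Ricci tensor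
  (`curvature_eq_of_nijenhuis`). The converse is a direct computation.
* A torsion tensor annihilated by the first expression is, by the cyclic identity which follows from
  `dΩ = 0`, of the form `T(u, v) = σ(s, v) u - σ(s, u) v + 2 σ(u, v) s` (`exists_torsion_eq`).
  Subtracting `σ(s, W) u + σ(u, W) s` from `∇_u W` removes the torsion, keeps `Ω` parallel, and does
  not change the twistor structure. The vector field `s` is smooth because the trace of the torsion
  recovers it.
* Two symplectic connections differ by a tensor `B` for which `σ(B(u) v, w)` is totally symmetric.
  If they have the same twistor structure, then `j [B(a), j] = [B(ja), j]` for all compatible `j`,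
  which forces the cubic form `σ(B(v) v, v)` to vanish (`eq_zero_of_commutator_eq`).
-/

noncomputable section

/-! ### Coordinate frames of the tangent bundle -/

section Frames

variable {E : Type*} [NormedAddCommGroup E] [NormedSpace ℝ E]
  {M : Type*} [TopologicalSpace M] [ChartedSpace E M] [IsManifold 𝓘(ℝ, E) ∞ M]

/-- The coordinates of a tangent vector at `y` in the preferred chart at `x₀`. -/
def toCoord (x₀ y : M) : TangentSpace 𝓘(ℝ, E) y →L[ℝ] E :=
  (trivializationAt E (TangentSpace 𝓘(ℝ, E)) x₀).continuousLinearMapAt ℝ y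

/-- The tangent vector at `y` with given coordinates in the preferred chart at `x₀`. -/
def ofCoord (x₀ y : M) : E →L[ℝ] TangentSpace 𝓘(ℝ, E) y :=
  (trivializationAt E (TangentSpace 𝓘(ℝ, E)) x₀).symmL ℝ y

theorem toCoord_ofCoord {x₀ y : M} (hy : y ∈ (chartAt E x₀).source) (w : E) :
    toCoord x₀ y (ofCoord x₀ y w) = w :=
  (trivializationAt E (TangentSpace 𝓘(ℝ, E)) x₀).continuousLinearMapAt_symmL hy w

theorem ofCoord_toCoord {x₀ y : M} (hy : y ∈ (chartAt E x₀).source)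
    (w : TangentSpace 𝓘(ℝ, E) y) : ofCoord x₀ y (toCoord x₀ y w) = w :=
  (trivializationAt E (TangentSpace 𝓘(ℝ, E)) x₀).symmL_continuousLinearMapAt hy w

theorem toCoord_self (x : M) (w : TangentSpace 𝓘(ℝ, E) x) : toCoord x x w = w := by
  have h := TangentBundle.continuousLinearMapAt_trivializationAt_eq_core (𝕜 := ℝ)
    (I := 𝓘(ℝ, E)) (mem_chart_source E x)
  unfold toCoord
  rw [h]
  exact (tangentBundleCore 𝓘(ℝ, E) M).coordChange_self _ _ (mem_chart_source E x) w

theorem ofCoord_self (x : M) (w : E) :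
    ofCoord x x w = (show TangentSpace 𝓘(ℝ, E) x from w) := by
  have h := toCoord_ofCoord (mem_chart_source E x) w
  rwa [toCoord_self] at h

theorem extend_eq_ofCoord {x y : M} (hy : y ∈ (chartAt E x).source)
    (w : TangentSpace 𝓘(ℝ, E) x) :
    FiberBundle.extend E w y = ofCoord x y (toCoord x x w) := by
  simp only [FiberBundle.extend]
  unfold toCoord
  rw [Trivialization.continuousLinearMapAt_apply,
    Trivialization.coe_linearMapAt_of_mem _ (mem_chart_source E x)]
  exact ((trivializationAt E (TangentSpace 𝓘(ℝ, E)) x).symmL_apply hy _).symm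

theorem extend_eventuallyEq_ofCoord {x : M} (w : TangentSpace 𝓘(ℝ, E) x) :
    ∀ᶠ y in 𝓝 x, FiberBundle.extend E w y = ofCoord x y (toCoord x x w) := by
  filter_upwards [(chartAt E x).open_source.mem_nhds (mem_chart_source E x)] with y hy
  exact extend_eq_ofCoord hy w

theorem toCoord_eq_mfderiv {x₀ y : M} (hy : y ∈ (chartAt E x₀).source) :
    toCoord x₀ y = mfderiv 𝓘(ℝ, E) 𝓘(ℝ, E) (extChartAt 𝓘(ℝ, E) x₀) y :=
  TangentBundle.continuousLinearMapAt_trivializationAt hy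

theorem trivializationAt_snd {x₀ y : M} (hy : y ∈ (chartAt E x₀).source)
    (w : TangentSpace 𝓘(ℝ, E) y) :
    (trivializationAt E (TangentSpace 𝓘(ℝ, E)) x₀ ⟨y, w⟩).2 = toCoord x₀ y w := by
  unfold toCoord
  rw [Trivialization.continuousLinearMapAt_apply, Trivialization.coe_linearMapAt_of_mem _ hy]

theorem contMDiffAt_section_iff_toCoord {n : ℕ∞ω}
    [ContMDiffVectorBundle n E (TangentSpace 𝓘(ℝ, E) : M → Type _) 𝓘(ℝ, E)]
    {x₀ y : M} (hy : y ∈ (chartAt E x₀).source)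
    {s : Π x : M, TangentSpace 𝓘(ℝ, E) x} :
    CMDiffAt n (T% s) y ↔ CMDiffAt n (fun y' ↦ toCoord x₀ y' (s y')) y := by
  rw [(trivializationAt E (TangentSpace 𝓘(ℝ, E)) x₀).contMDiffAt_section_iff hy]
  refine Filter.EventuallyEq.contMDiffAt_iff ?_
  filter_upwards [(chartAt E x₀).open_source.mem_nhds hy] with y' hy'
  exact trivializationAt_snd hy' _

theorem mdiffAt_section_iff_toCoord
    {x₀ y : M} (hy : y ∈ (chartAt E x₀).source)
    {s : Π x : M, TangentSpace 𝓘(ℝ, E) x} :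
    MDiffAt (T% s) y ↔ MDiffAt (fun y' ↦ toCoord x₀ y' (s y')) y := by
  rw [(trivializationAt E (TangentSpace 𝓘(ℝ, E)) x₀).mdifferentiableAt_section_iff _ _ hy]
  refine Filter.EventuallyEq.mdifferentiableAt_iff ?_
  filter_upwards [(chartAt E x₀).open_source.mem_nhds hy] with y' hy'
  exact trivializationAt_snd hy' _

theorem contMDiffAt_ofCoord {n : ℕ∞ω}
    [ContMDiffVectorBundle n E (TangentSpace 𝓘(ℝ, E) : M → Type _) 𝓘(ℝ, E)] {x₀ y : M}
    (hy : y ∈ (chartAt E x₀).source) {f : M → E} (hf : CMDiffAt n f y) :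
    CMDiffAt n (T% (fun y' ↦ ofCoord x₀ y' (f y'))) y := by
  rw [contMDiffAt_section_iff_toCoord hy]
  refine hf.congr_of_eventuallyEq ?_
  filter_upwards [(chartAt E x₀).open_source.mem_nhds hy] with y' hy'
  exact toCoord_ofCoord hy' _

theorem mdiffAt_ofCoord {x₀ y : M}
    (hy : y ∈ (chartAt E x₀).source) {f : M → E} (hf : MDiffAt f y) :
    MDiffAt (T% (fun y' ↦ ofCoord x₀ y' (f y'))) y := by
  rw [mdiffAt_section_iff_toCoord hy]
  refine hf.congr_of_eventuallyEq ?_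
  filter_upwards [(chartAt E x₀).open_source.mem_nhds hy] with y' hy'
  exact toCoord_ofCoord hy' _

theorem mdiffAt_ofCoord_const {x₀ y : M} (hy : y ∈ (chartAt E x₀).source) (w : E) :
    MDiffAt (T% (fun y' ↦ ofCoord x₀ y' w)) y :=
  mdiffAt_ofCoord hy mdifferentiableAt_const

/-! ### Connection coefficients -/

theorem LinearConnection.map_sum (D : LinearConnection E M) {ι : Type*} (t : Finset ι)
    (s : ι → Π x : M, TangentSpace 𝓘(ℝ, E) x) {y : M} (hs : ∀ i ∈ t, MDiffAt (T% (s i)) y) :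
    D (∑ i ∈ t, s i) y = ∑ i ∈ t, D (s i) y := by
  classical
  induction t using Finset.induction_on with
  | empty => simp
  | insert i t hi ih =>
    have h1 : MDiffAt (T% (∑ i ∈ t, s i)) y := by
      have := MDifferentiableAt.sum_section (s := t) (t := s) (x₀ := y)
        (fun i hi ↦ hs i (Finset.mem_insert_of_mem hi))
      convert this using 2 with y'
      simp
    rw [Finset.sum_insert hi, Finset.sum_insert hi,
      D.isCovariantDerivativeOnUniv.add (hs i (Finset.mem_insert_self _ _)) h1,
      ih fun j hj ↦ hs j (Finset.mem_insert_of_mem hj)]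

variable [FiniteDimensional ℝ E]

/-- A vector field with constant coordinates near `y` in the preferred chart at `x₀`, but smooth on
all of `M`, obtained by means of a bump function. -/
theorem exists_global_ofCoord [T2Space M] {x₀ y : M} (hy : y ∈ (chartAt E x₀).source) (w : E) :
    ∃ s : Π x : M, TangentSpace 𝓘(ℝ, E) x, CMDiff ∞ (T% s) ∧
      ∀ᶠ y' in 𝓝 y, s y' = ofCoord x₀ y' w := by
  obtain ⟨f, -, hf⟩ := (SmoothBumpFunction.nhds_basis_tsupport (I := 𝓘(ℝ, E)) y).mem_iff.1
    ((chartAt E x₀).open_source.mem_nhds hy)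
  refine ⟨fun y' ↦ f y' • ofCoord x₀ y' w, ?_, ?_⟩
  · exact ContMDiffOn.smul_section_of_tsupport f.contMDiff.contMDiffOn (chartAt E x₀).open_source hf
      fun y' hy' ↦ (contMDiffAt_ofCoord hy' contMDiffAt_const).contMDiffWithinAt
  · filter_upwards [f.eventuallyEq_one] with y' hy'
    simp [hy']

/-- The connection coefficients of `D` in the coordinate frame of the preferred chart at `x₀`:
`connCoeff D x₀ y a w` consists of the coordinates of `∇_a W`, where the vector field `W` has
constant coordinates `w`. The definition through a basis is linear in `w` also at those `y` which
lie outside of the domain of the chart. -/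
def connCoeff (D : LinearConnection E M) (x₀ y : M) : E →L[ℝ] E →L[ℝ] E :=
  ∑ i, (ContinuousLinearMap.smulRightL ℝ E E
      (LinearMap.toContinuousLinearMap ((Module.finBasis ℝ E).coord i))).comp
    ((toCoord x₀ y).comp
      ((D (fun y' ↦ ofCoord x₀ y' (Module.finBasis ℝ E i)) y).comp (ofCoord x₀ y)))

theorem connCoeff_apply (D : LinearConnection E M) (x₀ y : M) (a w : E) :
    connCoeff D x₀ y a w = ∑ i, (Module.finBasis ℝ E).coord i w •
      toCoord x₀ y (D (fun y' ↦ ofCoord x₀ y' (Module.finBasis ℝ E i)) y (ofCoord x₀ y a)) := by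
  simp [connCoeff]

/-- The covariant derivative in terms of the connection coefficients. -/
theorem LinearConnection.apply_ofCoord (D : LinearConnection E M) {x₀ y : M}
    (hy : y ∈ (chartAt E x₀).source) {f : M → E} (hf : MDiffAt f y) (v : TangentSpace 𝓘(ℝ, E) y) :
    D (fun y' ↦ ofCoord x₀ y' (f y')) y v =
      ofCoord x₀ y (mvfderiv 𝓘(ℝ, E) f y v + connCoeff D x₀ y (toCoord x₀ y v) (f y)) := by
  set b := Module.finBasis ℝ E
  let bc (i) : E →L[ℝ] ℝ := LinearMap.toContinuousLinearMap (b.coord i)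
  have hbc (i) : MDiffAt (fun y' ↦ bc i (f y')) y :=
    (bc i).mdifferentiableAt.comp y hf
  have h1 : (fun y' ↦ ofCoord x₀ y' (f y')) =
      ∑ i, (fun y' ↦ bc i (f y')) • (fun y' ↦ ofCoord x₀ y' (b i)) := by
    funext y'
    conv_lhs => rw [← b.sum_repr (f y'), _root_.map_sum]
    simp [bc]
  rw [h1, LinearConnection.map_sum]
  · have h2 : mvfderiv 𝓘(ℝ, E) f y v = ∑ i, mvfderiv 𝓘(ℝ, E) (fun y' ↦ bc i (f y')) y v • b i := by
      conv_lhs => rw [← b.sum_repr (mvfderiv 𝓘(ℝ, E) f y v)]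
      refine Finset.sum_congr rfl fun i _ ↦ ?_
      have h3 : mvfderiv 𝓘(ℝ, E) (fun y' ↦ bc i (f y')) y =
          (mvfderiv 𝓘(ℝ, E) (bc i) (f y)).comp (mfderiv 𝓘(ℝ, E) 𝓘(ℝ, E) f y) :=
        mvfderiv_comp y (bc i).mdifferentiableAt hf
      rw [h3]
      congr 1
      simp only [mvfderiv, mfderiv_eq_fderiv, ContinuousLinearMap.fderiv]
      rfl
    rw [h2, connCoeff_apply, _root_.sum_apply, map_add, _root_.map_sum,
      _root_.map_sum, ← Finset.sum_add_distrib]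
    refine Finset.sum_congr rfl fun i _ ↦ ?_
    rw [D.isCovariantDerivativeOnUniv.leibniz (mdiffAt_ofCoord_const hy _) (hbc i)]
    simp only [ofCoord_toCoord hy, map_smul]
    simp [bc, add_comm]
    rfl
  · intro i _
    exact (hbc i).smul_section (mdiffAt_ofCoord_const hy _)

/-- The covariant derivative of a field with constant coordinates. -/
theorem LinearConnection.apply_ofCoord_const (D : LinearConnection E M) {x₀ y : M}
    (hy : y ∈ (chartAt E x₀).source) (w : E) (v : TangentSpace 𝓘(ℝ, E) y) :
    D (fun y' ↦ ofCoord x₀ y' w) y v = ofCoord x₀ y (connCoeff D x₀ y (toCoord x₀ y v) w) := by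
  rw [D.apply_ofCoord hy mdifferentiableAt_const, mvfderiv_const]
  simp

/-- The covariant derivative of an arbitrary field in terms of the connection coefficients. -/
theorem LinearConnection.apply_eq (D : LinearConnection E M) {x₀ y : M}
    (hy : y ∈ (chartAt E x₀).source) {s : Π x : M, TangentSpace 𝓘(ℝ, E) x} (hs : MDiffAt (T% s) y)
    (v : TangentSpace 𝓘(ℝ, E) y) :
    D s y v = ofCoord x₀ y (mvfderiv 𝓘(ℝ, E) (fun y' ↦ toCoord x₀ y' (s y')) y v +
      connCoeff D x₀ y (toCoord x₀ y v) (toCoord x₀ y (s y))) := by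
  have h := (mdiffAt_section_iff_toCoord hy).1 hs
  rw [← D.apply_ofCoord hy h]
  refine congrArg (fun f ↦ f v) (D.isCovariantDerivativeOnUniv.congr_of_eventuallyEq hs
    (mdiffAt_ofCoord hy h) univ_mem ?_)
  filter_upwards [(chartAt E x₀).open_source.mem_nhds hy] with y' hy'
  exact (ofCoord_toCoord hy' _).symm

theorem christoffel_apply (D : LinearConnection E M) (x : M) (v w : TangentSpace 𝓘(ℝ, E) x) :
    christoffel D x v w = connCoeff D x x v w := by
  change D (FiberBundle.extend E w) x v = _
  rw [D.isCovariantDerivativeOnUniv.congr_of_eventuallyEq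
    (FiberBundle.mdifferentiableAt_extend 𝓘(ℝ, E) E w)
    (mdiffAt_ofCoord_const (mem_chart_source E x) _) univ_mem (extend_eventuallyEq_ofCoord w),
    D.apply_ofCoord_const (mem_chart_source E x), ofCoord_self, toCoord_self,
    toCoord_self]

/-- The connection coefficients of a smooth connection are smooth. -/
theorem contMDiffAt_connCoeff [T2Space M] {D : LinearConnection E M}
    (hD : D.ContMDiffCovariantDerivative ∞) {x₀ y : M} (hy : y ∈ (chartAt E x₀).source) :
    ContMDiffAt 𝓘(ℝ, E) 𝓘(ℝ, E →L[ℝ] E →L[ℝ] E) ∞ (connCoeff D x₀) y := by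
  unfold connCoeff
  refine ContMDiffAt.sum fun i _ ↦ ?_
  refine contMDiffAt_const.clm_comp ?_
  obtain ⟨s, hs, hsy⟩ := exists_global_ofCoord hy (Module.finBasis ℝ E i)
  have h1 := (contMDiffOn_univ.1 (hD.contMDiff.contMDiff (σ := s) hs.contMDiffOn)).contMDiffAt
    (x := y)
  rw [(trivializationAt (E →L[ℝ] E) (fun x : M ↦ TangentSpace 𝓘(ℝ, E) x →L[ℝ]
    TangentSpace 𝓘(ℝ, E) x) x₀).contMDiffAt_section_iff ⟨hy, hy⟩] at h1
  refine h1.congr_of_eventuallyEq ?_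
  filter_upwards [hsy.eventually_nhds, (chartAt E x₀).open_source.mem_nhds hy] with y' hy' hy2
  have h2 : D (fun y ↦ ofCoord x₀ y (Module.finBasis ℝ E i)) y' = D s y' :=
    D.isCovariantDerivativeOnUniv.congr_of_eventuallyEq (mdiffAt_ofCoord_const hy2 _)
      ((hs y').mdifferentiableAt (by simp)) univ_mem (hy'.mono fun _ h ↦ h.symm)
  rw [h2]
  rfl

end Frames

/-! ### Coordinates on the endomorphism bundle -/

section EndCoordinates

theorem mvfderiv_mul_apply {V H N A : Type*} [NormedAddCommGroup V] [NormedSpace ℝ V]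
    [TopologicalSpace H] {I : ModelWithCorners ℝ V H} [TopologicalSpace N] [ChartedSpace H N]
    [NormedRing A] [NormedAlgebra ℝ A] {f g : N → A} {x : N} (hf : MDifferentiableAt I 𝓘(ℝ, A) f x)
    (hg : MDifferentiableAt I 𝓘(ℝ, A) g x) (v : TangentSpace I x) :
    mvfderiv I (f * g) x v = f x * mvfderiv I g x v + mvfderiv I f x v * g x :=
  congrArg (fun l ↦ l v) (HasMFDerivAt.mul' hf.hasMFDerivAt hg.hasMFDerivAt).mfderiv

theorem mvfderiv_comp_mfderiv_apply {V H N V' H' N' A : Type*}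
    [NormedAddCommGroup V] [NormedSpace ℝ V]
    [TopologicalSpace H] {I : ModelWithCorners ℝ V H} [TopologicalSpace N] [ChartedSpace H N]
    [NormedAddCommGroup V'] [NormedSpace ℝ V'] [TopologicalSpace H'] {I' : ModelWithCorners ℝ V' H'}
    [TopologicalSpace N'] [ChartedSpace H' N'] [NormedAddCommGroup A] [NormedSpace ℝ A]
    {g : N' → A} {f : N → N'} {x : N} (hg : MDifferentiableAt I' 𝓘(ℝ, A) g (f x))
    (hf : MDifferentiableAt I I' f x) (v : TangentSpace I x) :
    mvfderiv I (g ∘ f) x v = mvfderiv I' g (f x) (mfderiv I I' f x v) :=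
  congrArg (fun l ↦ l v) (mfderiv_comp x hg hf)

theorem mvfderiv_congr {V H N A : Type*} [NormedAddCommGroup V] [NormedSpace ℝ V]
    [TopologicalSpace H] {I : ModelWithCorners ℝ V H} [TopologicalSpace N] [ChartedSpace H N]
    [NormedAddCommGroup A] [NormedSpace ℝ A] {f g : N → A} {x : N} (h : f =ᶠ[𝓝 x] g)
    (v : TangentSpace I x) : mvfderiv I f x v = mvfderiv I g x v := by
  have h1 : mfderiv I 𝓘(ℝ, A) f x = mfderiv I 𝓘(ℝ, A) g x := h.mfderiv_eq
  simp only [mvfderiv, ContinuousLinearMap.comp_apply]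
  rw [h1]
  rfl

variable {E : Type*} [NormedAddCommGroup E] [NormedSpace ℝ E]
  {M : Type*} [TopologicalSpace M] [ChartedSpace E M] [IsManifold 𝓘(ℝ, E) ∞ M]

/-- The coordinate expression of an endomorphism of a tangent space, in the preferred chart at
`x₀`. -/
def endCoord (x₀ : M) (q : EndTM E M) : E →L[ℝ] E :=
  (toCoord x₀ q.1).comp (q.2.comp (ofCoord x₀ q.1))

theorem endCoord_apply (x₀ : M) (q : EndTM E M) (w : E) :
    endCoord x₀ q w = toCoord x₀ q.1 (q.2 (ofCoord x₀ q.1 w)) := rfl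

theorem endCoord_toCoord {x₀ : M} {q : EndTM E M} (hq : q.1 ∈ (chartAt E x₀).source)
    (v : TangentSpace 𝓘(ℝ, E) q.1) : endCoord x₀ q (toCoord x₀ q.1 v) = toCoord x₀ q.1 (q.2 v) := by
  rw [endCoord_apply, ofCoord_toCoord hq]

theorem extChartAt_endTM (p q : EndTM E M) :
    extChartAt (endModel E) p q = (extChartAt 𝓘(ℝ, E) p.1 q.1, endCoord p.1 q) := rfl

theorem mem_chartAt_endTM_source {p q : EndTM E M} :
    q ∈ (chartAt (ModelProd E (E →L[ℝ] E)) p).source ↔ q.1 ∈ (chartAt E p.1).source := by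
  simp [FiberBundle.chartedSpace_chartAt, hom_trivializationAt_source]
  exact fun h ↦ h

theorem contMDiffAt_endCoord {x₀ : M} {q : EndTM E M} (hq : q.1 ∈ (chartAt E x₀).source) :
    ContMDiffAt (endModel E) 𝓘(ℝ, E →L[ℝ] E) ∞ (endCoord x₀) q := by
  have h : ContMDiffAt (endModel E) (endModel E) ∞ (id : EndTM E M → EndTM E M) q := contMDiffAt_id
  rw [(trivializationAt (E →L[ℝ] E) (fun x : M ↦ TangentSpace 𝓘(ℝ, E) x →L[ℝ]
    TangentSpace 𝓘(ℝ, E) x) x₀).contMDiffAt_iff] at h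
  · exact h.2
  · exact ⟨hq, hq⟩

theorem mdiffAt_endCoord {x₀ : M} {q : EndTM E M} (hq : q.1 ∈ (chartAt E x₀).source) :
    MDifferentiableAt (endModel E) 𝓘(ℝ, E →L[ℝ] E) (endCoord x₀) q :=
  (contMDiffAt_endCoord hq).mdifferentiableAt (by simp)

theorem mdiffAt_endTM_proj (q : EndTM E M) :
    MDifferentiableAt (endModel E) 𝓘(ℝ, E) (TotalSpace.proj : EndTM E M → M) q :=
  (contMDiffAt_proj (n := ∞) _).mdifferentiableAt (by simp)

theorem mfderiv_extChartAt_endTM_self (q : EndTM E M) (X : TangentSpace (endModel E) q) :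
    mfderiv (endModel E) 𝓘(ℝ, E × (E →L[ℝ] E)) (extChartAt (endModel E) q) q X = X := by
  have h1 := TangentBundle.continuousLinearMapAt_trivializationAt_eq_core (𝕜 := ℝ)
    (I := endModel E) (mem_chart_source (ModelProd E (E →L[ℝ] E)) q)
  have h2 := TangentBundle.continuousLinearMapAt_trivializationAt (𝕜 := ℝ)
    (I := endModel E) (mem_chart_source (ModelProd E (E →L[ℝ] E)) q)
  rw [← h2, h1]
  exact (tangentBundleCore (endModel E) (EndTM E M)).coordChange_self _ _ (mem_chart_source _ q) X

theorem mdiffAt_extChartAt_endTM {p q : EndTM E M} (hq : q.1 ∈ (chartAt E p.1).source) :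
    MDifferentiableAt (endModel E) 𝓘(ℝ, E × (E →L[ℝ] E)) (extChartAt (endModel E) p) q :=
  mdifferentiableAt_extChartAt (mem_chartAt_endTM_source.2 hq)

/-- The derivative of the chart at `p`, in terms of the coordinates of the base point and of the
endomorphism. -/
theorem mfderiv_extChartAt_endTM {p q : EndTM E M} (hq : q.1 ∈ (chartAt E p.1).source)
    (X : TangentSpace (endModel E) q) :
    mfderiv (endModel E) 𝓘(ℝ, E × (E →L[ℝ] E)) (extChartAt (endModel E) p) q X =
      (toCoord p.1 q.1 (mfderiv (endModel E) 𝓘(ℝ, E) (TotalSpace.proj : EndTM E M → M) q X),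
        mvfderiv (endModel E) (endCoord p.1) q X) := by
  have h1 : HasMFDerivAt (endModel E) 𝓘(ℝ, E) (fun q : EndTM E M ↦ extChartAt 𝓘(ℝ, E) p.1 q.1) q
      ((mfderiv 𝓘(ℝ, E) 𝓘(ℝ, E) (extChartAt 𝓘(ℝ, E) p.1) q.1).comp
        (mfderiv (endModel E) 𝓘(ℝ, E) (TotalSpace.proj : EndTM E M → M) q)) :=
    HasMFDerivAt.comp q (mdifferentiableAt_extChartAt hq).hasMFDerivAt
      (mdiffAt_endTM_proj q).hasMFDerivAt
  have hT := (mdiffAt_extChartAt_endTM hq).hasMFDerivAt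
  have h2 := (mdiffAt_endCoord hq).hasMFDerivAt
  have h3 := HasMFDerivAt.comp q
    (ContinuousLinearMap.fst ℝ E (E →L[ℝ] E)).hasMFDerivAt hT
  have h4 := HasMFDerivAt.comp q
    (ContinuousLinearMap.snd ℝ E (E →L[ℝ] E)).hasMFDerivAt hT
  refine Prod.ext ?_ ?_
  · rw [toCoord_eq_mfderiv hq]
    exact congrArg (fun f ↦ f X) (hasMFDerivAt_unique h3 h1)
  · exact congrArg (fun f ↦ f X) (hasMFDerivAt_unique h4 h2)

/-- The projection `dπ X` of a tangent vector `X` of the manifold `End(TM)`. -/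
def baseVec {q : EndTM E M} (X : TangentSpace (endModel E) q) : TangentSpace 𝓘(ℝ, E) q.1 := X.1

theorem mfderiv_endTM_proj (q : EndTM E M) (X : TangentSpace (endModel E) q) :
    mfderiv (endModel E) 𝓘(ℝ, E) (TotalSpace.proj : EndTM E M → M) q X = baseVec X := by
  have h := mfderiv_extChartAt_endTM (mem_chart_source E q.1) X
  rw [mfderiv_extChartAt_endTM_self, toCoord_self] at h
  exact (congrArg Prod.fst h).symm

theorem mvfderiv_endCoord_self (q : EndTM E M) (X : TangentSpace (endModel E) q) :
    mvfderiv (endModel E) (endCoord q.1) q X = X.2 := by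
  have h := mfderiv_extChartAt_endTM (mem_chart_source E q.1) X
  rw [mfderiv_extChartAt_endTM_self] at h
  exact (congrArg Prod.snd h).symm

/-- The change of coordinates of tangent vectors from the preferred chart at `x₁` to the preferred
chart at `x₀`. -/
def coordTransition (x₁ x₀ y : M) : E →L[ℝ] E :=
  (toCoord x₀ y).comp (ofCoord x₁ y)

theorem mdiffAt_coordTransition {x₁ x₀ y : M} (h₁ : y ∈ (chartAt E x₁).source)
    (h₀ : y ∈ (chartAt E x₀).source) :
    MDifferentiableAt 𝓘(ℝ, E) 𝓘(ℝ, E →L[ℝ] E) (coordTransition x₁ x₀ : M → E →L[ℝ] E) y := by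
  have h := contMDiffAt_coordChangeL (n := ∞) (IB := 𝓘(ℝ, E))
    (e := trivializationAt E (TangentSpace 𝓘(ℝ, E)) x₁)
    (e' := trivializationAt E (TangentSpace 𝓘(ℝ, E)) x₀) h₁ h₀
  refine (h.mdifferentiableAt (by simp)).congr_of_eventuallyEq ?_
  filter_upwards [(chartAt E x₁).open_source.mem_nhds h₁,
    (chartAt E x₀).open_source.mem_nhds h₀] with y' h₁' h₀'
  ext w
  rw [ContinuousLinearEquiv.coe_coe, Trivialization.coordChangeL_apply _ _ ⟨h₁', h₀'⟩,
    trivializationAt_snd h₀', ← Trivialization.symmL_apply (R := ℝ) _ h₁']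
  rfl

theorem coordTransition_apply (x₁ x₀ y : M) (w : E) :
    coordTransition x₁ x₀ y w = toCoord x₀ y (ofCoord x₁ y w) := rfl

theorem ofCoord_coordTransition {x₁ x₀ y : M} (h₀ : y ∈ (chartAt E x₀).source) (w : E) :
    ofCoord x₀ y (coordTransition x₁ x₀ y w) = ofCoord x₁ y w := by
  rw [coordTransition_apply, ofCoord_toCoord h₀]

/-- The two coordinate expressions of an endomorphism are conjugate. -/
theorem endCoord_comp_coordTransition {x₁ x₀ : M} {q : EndTM E M}
    (h₁ : q.1 ∈ (chartAt E x₁).source) (h₀ : q.1 ∈ (chartAt E x₀).source) :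
    (endCoord x₀ q).comp (coordTransition x₁ x₀ q.1) =
      (coordTransition x₁ x₀ q.1).comp (endCoord x₁ q) := by
  ext w
  simp only [ContinuousLinearMap.comp_apply, endCoord_apply, coordTransition_apply,
    ofCoord_toCoord h₀, ofCoord_toCoord h₁]

/-- The derivatives of the two coordinate expressions of an endomorphism. -/
theorem mvfderiv_endCoord_comp {x₀ : M} {q : EndTM E M} (h₀ : q.1 ∈ (chartAt E x₀).source)
    (X : TangentSpace (endModel E) q) :
    (mvfderiv (endModel E) (endCoord x₀) q X).comp (coordTransition q.1 x₀ q.1) +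
        (endCoord x₀ q).comp (mvfderiv 𝓘(ℝ, E) (coordTransition q.1 x₀) q.1 (baseVec X)) =
      (coordTransition q.1 x₀ q.1).comp (show E →L[ℝ] E from X.2) +
        (mvfderiv 𝓘(ℝ, E) (coordTransition q.1 x₀) q.1 (baseVec X)).comp (endCoord q.1 q) := by
  have hq := mem_chart_source E q.1
  have hC := mdiffAt_coordTransition hq h₀
  let C : EndTM E M → E →L[ℝ] E :=
    (coordTransition q.1 x₀ : M → E →L[ℝ] E) ∘ (TotalSpace.proj : EndTM E M → M)
  have hC' : MDifferentiableAt (endModel E) 𝓘(ℝ, E →L[ℝ] E)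
      C q :=
    hC.comp q (mdiffAt_endTM_proj q)
  have hC2 : mvfderiv (endModel E) C q X
      = mvfderiv 𝓘(ℝ, E) (coordTransition q.1 x₀) q.1 (baseVec X) := by
    rw [← mfderiv_endTM_proj]
    exact mvfderiv_comp_mfderiv_apply hC (mdiffAt_endTM_proj q) X
  have hLR : (endCoord x₀ : EndTM E M → E →L[ℝ] E) * C =ᶠ[𝓝 q]
      C * endCoord q.1 := by
    have : Continuous (TotalSpace.proj : EndTM E M → M) := FiberBundle.continuous_proj _ _
    filter_upwards [this.continuousAt.preimage_mem_nhds ((chartAt E q.1).open_source.mem_nhds hq),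
      this.continuousAt.preimage_mem_nhds ((chartAt E x₀).open_source.mem_nhds h₀)] with q' h₁ h₂
    exact endCoord_comp_coordTransition h₁ h₂
  have h := mvfderiv_congr hLR X
  rw [mvfderiv_mul_apply (mdiffAt_endCoord h₀) hC', mvfderiv_mul_apply hC' (mdiffAt_endCoord hq),
    mvfderiv_endCoord_self, hC2] at h
  rw [add_comm]
  exact h

/-! ### The twistor structure in coordinates -/

variable [FiniteDimensional ℝ E]

/-- The change of the connection coefficients under a change of coordinates. -/
theorem coordTransition_comp_connCoeff (D : LinearConnection E M) {x₁ x₀ y : M}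
    (h₁ : y ∈ (chartAt E x₁).source) (h₀ : y ∈ (chartAt E x₀).source)
    (v : TangentSpace 𝓘(ℝ, E) y) :
    (coordTransition x₁ x₀ y).comp (connCoeff D x₁ y (toCoord x₁ y v)) =
      mvfderiv 𝓘(ℝ, E) (coordTransition x₁ x₀) y v +
        (connCoeff D x₀ y (toCoord x₀ y v)).comp (coordTransition x₁ x₀ y) := by
  ext w
  have hC := mdiffAt_coordTransition h₁ h₀
  have hCw : MDiffAt (fun y' ↦ coordTransition x₁ x₀ y' w) y := hC.clm_apply mdifferentiableAt_const
  have h2 : D (fun y' ↦ ofCoord x₁ y' w) y =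
      D (fun y' ↦ ofCoord x₀ y' (coordTransition x₁ x₀ y' w)) y := by
    refine D.isCovariantDerivativeOnUniv.congr_of_eventuallyEq (mdiffAt_ofCoord_const h₁ w)
      (mdiffAt_ofCoord h₀ hCw) univ_mem ?_
    filter_upwards [(chartAt E x₀).open_source.mem_nhds h₀] with y' hy'
    exact (ofCoord_coordTransition hy' w).symm
  have h3 : mvfderiv 𝓘(ℝ, E) (fun y' ↦ coordTransition x₁ x₀ y' w) y v =
      mvfderiv 𝓘(ℝ, E) (coordTransition x₁ x₀) y v w := by
    have h4 := mvfderiv_comp_mfderiv_apply (x := y)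
      (ContinuousLinearMap.apply ℝ E w : (E →L[ℝ] E) →L[ℝ] E).mdifferentiableAt hC v
    refine h4.trans ?_
    simp only [mvfderiv, mfderiv_eq_fderiv, ContinuousLinearMap.fderiv]
    rfl
  have h5 := congrArg (fun f ↦ toCoord x₀ y (f v)) h2
  simp only [D.apply_ofCoord_const h₁, D.apply_ofCoord h₀ hCw, toCoord_ofCoord h₀, h3] at h5
  exact h5

/-- The covariant derivative of the tautological section in coordinates. -/
theorem toCoord_covTautological (D : LinearConnection E M) {x₀ : M} {q : EndTM E M}
    (h₀ : q.1 ∈ (chartAt E x₀).source) (X : TangentSpace (endModel E) q)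
    (w : TangentSpace 𝓘(ℝ, E) q.1) :
    toCoord x₀ q.1 (covTautological D q X w) =
      (mvfderiv (endModel E) (endCoord x₀) q X
        + ((connCoeff D x₀ q.1 (toCoord x₀ q.1 (baseVec X))).comp (endCoord x₀ q) -
          (endCoord x₀ q).comp (connCoeff D x₀ q.1 (toCoord x₀ q.1 (baseVec X)))))
        (toCoord x₀ q.1 w) := by
  have hq := mem_chart_source E q.1
  have h1 := coordTransition_comp_connCoeff D hq h₀ (baseVec X)
  have h2 := mvfderiv_endCoord_comp h₀ X
  have h3 := endCoord_comp_coordTransition hq h₀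
  have hw (u : E) : toCoord x₀ q.1 (show TangentSpace 𝓘(ℝ, E) q.1 from u) =
      coordTransition q.1 x₀ q.1 u := by
    rw [coordTransition_apply, ofCoord_self]
  have hE : endCoord q.1 q = (show E →L[ℝ] E from q.2) := by
    ext u
    rw [endCoord_apply, toCoord_self, ofCoord_self]
    rfl
  have hΓ : christoffel D q.1 (baseVec X) =
      (show E →L[ℝ] E from connCoeff D q.1 q.1 (toCoord q.1 q.1 (baseVec X))) := by
    ext u
    rw [toCoord_self]
    exact christoffel_apply D q.1 _ u
  set C : E →L[ℝ] E := coordTransition q.1 x₀ q.1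
  set K := endCoord x₀ q
  set Γ₀ := connCoeff D x₀ q.1 (toCoord x₀ q.1 (baseVec X))
  set Γ₁ := connCoeff D q.1 q.1 (toCoord q.1 q.1 (baseVec X))
  set K₁ := endCoord q.1 q
  have h : C * ((show E →L[ℝ] E from X.2) + (Γ₁ * K₁ - K₁ * Γ₁)) =
      (mvfderiv (endModel E) (endCoord x₀) q X + (Γ₀ * K - K * Γ₀)) * C := by
    have h1' : C * Γ₁ = _ + Γ₀ * C := h1
    have h2' : _ * C + K * _ = C * (show E →L[ℝ] E from X.2) + _ * K₁ := h2
    have h3' : K * C = C * K₁ := h3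
    rw [mul_add, ← sub_eq_iff_eq_add.2 h2', mul_sub, ← mul_assoc, ← mul_assoc, h1', ← h3',
      mul_assoc, h1', add_mul, mul_assoc, ← h3']
    noncomm_ring
  have h4 : covTautological D q X = (show E →L[ℝ] E from X.2) + (Γ₁ * K₁ - K₁ * Γ₁) := by
    unfold covTautological
    change _ + ((christoffel D q.1 (baseVec X)).comp q.2 -
      q.2.comp (christoffel D q.1 (baseVec X))) = _
    rw [hΓ, hE]
    rfl
  have h5 := congrArg (fun f ↦ f w) h
  rw [h4]
  refine (hw _).trans (h5.trans ?_)
  exact congrArg (mvfderiv (endModel E) (endCoord x₀) q X + (Γ₀ * K - K * Γ₀)) (hw w).symm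

/-- The twistor structure in coordinates. -/
theorem twistorStructure_coord (D : LinearConnection E M) {x₀ : M} {q : EndTM E M}
    (h₀ : q.1 ∈ (chartAt E x₀).source) (X : TangentSpace (endModel E) q) :
    mvfderiv (endModel E) (endCoord x₀) q (twistorStructure D q X)
        + ((connCoeff D x₀ q.1 (endCoord x₀ q (toCoord x₀ q.1 (baseVec X)))).comp (endCoord x₀ q) -
          (endCoord x₀ q).comp (connCoeff D x₀ q.1 (endCoord x₀ q (toCoord x₀ q.1 (baseVec X))))) =
      (endCoord x₀ q).comp (mvfderiv (endModel E) (endCoord x₀) q X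
        + ((connCoeff D x₀ q.1 (toCoord x₀ q.1 (baseVec X))).comp (endCoord x₀ q) -
          (endCoord x₀ q).comp (connCoeff D x₀ q.1 (toCoord x₀ q.1 (baseVec X))))) := by
  have h1 : covTautological D q (twistorStructure D q X) = q.2.comp (covTautological D q X) := by
    unfold twistorStructure
    conv_lhs => unfold covTautological
    exact sub_add_cancel _ _
  ext w
  obtain ⟨w, rfl⟩ : ∃ w', w = toCoord x₀ q.1 w' := ⟨_, (toCoord_ofCoord h₀ w).symm⟩
  have h2 := toCoord_covTautological D h₀ (twistorStructure D q X) w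
  rw [h1] at h2
  have h3 : baseVec (twistorStructure D q X) = q.2 (baseVec X) := rfl
  rw [h3, ← endCoord_toCoord h₀] at h2
  have h4 : (q.2.comp (covTautological D q X)) w = q.2 (covTautological D q X w) := rfl
  rw [← h2, h4, ContinuousLinearMap.comp_apply, ← endCoord_toCoord h₀,
    toCoord_covTautological D h₀]

end EndCoordinates

/-! ### The Nijenhuis tensor in coordinates -/

section Nijenhuis

variable {E : Type*} [NormedAddCommGroup E] [NormedSpace ℝ E]

/-- The twistor structure at a point with coordinates `(z, j)`, in terms of the connection
coefficients `G` at `z`. A tangent vector is a pair `(v, A)`, and the covariant derivative of the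
tautological section along it is `A + [G v, j]`. -/
def modelStructure (G : E →L[ℝ] E →L[ℝ] E) (j : E →L[ℝ] E) (Z : E × (E →L[ℝ] E)) :
    E × (E →L[ℝ] E) :=
  (j Z.1, j * (Z.2 + (G Z.1 * j - j * G Z.1)) - (G (j Z.1) * j - j * G (j Z.1)))

set_option synthInstance.maxHeartbeats 200000 in
/-- The covariant derivative of the tautological section along the field `X'` which is related to
`X` by the twistor structure along a curve, after differentiation along the curve. -/
theorem hasDerivAt_modelStructure {Γ : E → E →L[ℝ] E →L[ℝ] E} {Γ' : E →L[ℝ] E →L[ℝ] E →L[ℝ] E}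
    {p : E × (E →L[ℝ] E)} (hΓ : HasFDerivAt Γ Γ' p.1)
    {X X' : E × (E →L[ℝ] E) → E × (E →L[ℝ] E)} (hX : DifferentiableAt ℝ X p)
    (hX' : DifferentiableAt ℝ X' p) {c : ℝ → E × (E →L[ℝ] E)} {u : E × (E →L[ℝ] E)}
    (hc : HasDerivAt c u 0) (hc0 : c 0 = p)
    (h : ∀ᶠ t in 𝓝 (0 : ℝ), X' (c t) = modelStructure (Γ (c t).1) (c t).2 (X (c t))) :
    (fderiv ℝ X' p u).1 = u.2 (X p).1 + p.2 (fderiv ℝ X p u).1 ∧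
    (fderiv ℝ X' p u).2 + (Γ p.1 (fderiv ℝ X' p u).1 * p.2 - p.2 * Γ p.1 (fderiv ℝ X' p u).1) =
      p.2 * ((fderiv ℝ X p u).2 +
        (Γ p.1 (fderiv ℝ X p u).1 * p.2 - p.2 * Γ p.1 (fderiv ℝ X p u).1)) +
      (u.2 * ((X p).2 + (Γ p.1 (X p).1 * p.2 - p.2 * Γ p.1 (X p).1)) +
        p.2 * ((Γ' u.1 (X p).1 * p.2 - p.2 * Γ' u.1 (X p).1) +
          (Γ p.1 (X p).1 * u.2 - u.2 * Γ p.1 (X p).1)) -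
        (Γ' u.1 (p.2 (X p).1) * p.2 - p.2 * Γ' u.1 (p.2 (X p).1)) -
        (Γ p.1 (p.2 (X p).1) * u.2 - u.2 * Γ p.1 (p.2 (X p).1))) := by
  subst hc0
  have hXc : HasDerivAt (fun t ↦ X (c t)) (fderiv ℝ X (c 0) u) 0 :=
    hX.hasFDerivAt.comp_hasDerivAt 0 hc
  have hXc' : HasDerivAt (fun t ↦ X' (c t)) (fderiv ℝ X' (c 0) u) 0 :=
    hX'.hasFDerivAt.comp_hasDerivAt 0 hc
  have hc1 : HasDerivAt (fun t ↦ (c t).1) u.1 0 := by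
    have : HasDerivAt (fun t ↦ (c t).1) _ 0 := hasFDerivAt_fst.comp_hasDerivAt 0 hc
    exact this
  have hc2 : HasDerivAt (fun t ↦ (c t).2) u.2 0 := by
    have : HasDerivAt (fun t ↦ (c t).2) _ 0 := hasFDerivAt_snd.comp_hasDerivAt 0 hc
    exact this
  have ha : HasDerivAt (fun t ↦ (X (c t)).1) _ 0 := hasFDerivAt_fst.comp_hasDerivAt 0 hXc
  have hA : HasDerivAt (fun t ↦ (X (c t)).2) _ 0 := hasFDerivAt_snd.comp_hasDerivAt 0 hXc
  have ha' : HasDerivAt (fun t ↦ (X' (c t)).1) _ 0 := hasFDerivAt_fst.comp_hasDerivAt 0 hXc'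
  have hA' : HasDerivAt (fun t ↦ (X' (c t)).2) _ 0 := hasFDerivAt_snd.comp_hasDerivAt 0 hXc'
  have hG : HasDerivAt (fun t ↦ Γ (c t).1) (Γ' u.1) 0 := by
    have h1 : HasFDerivAt (fun t ↦ Γ (c t).1) _ 0 :=
      HasFDerivAt.comp (f := fun t ↦ (c t).1) (g := Γ) (g' := Γ') (0 : ℝ) hΓ hc1.hasFDerivAt
    simpa using h1.hasDerivAt
  have e1 := ha'.unique ((hc2.clm_apply ha).congr_of_eventuallyEq
    (h.mono fun t ht ↦ congrArg Prod.fst ht))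
  have hGa := hG.clm_apply ha
  have hGa' := hG.clm_apply ha'
  have h2 : (fun t ↦ (X' (c t)).2 + (Γ (c t).1 (X' (c t)).1 * (c t).2 -
      (c t).2 * Γ (c t).1 (X' (c t)).1)) =ᶠ[𝓝 0]
      (fun t ↦ (c t).2 * ((X (c t)).2 + (Γ (c t).1 (X (c t)).1 * (c t).2 -
      (c t).2 * Γ (c t).1 (X (c t)).1))) := by
    filter_upwards [h] with t ht
    simp only [ht, modelStructure]
    exact sub_add_cancel _ _
  have e2 := (hA'.add ((hGa'.mul hc2).sub (hc2.mul hGa'))).unique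
    ((hc2.mul (hA.add ((hGa.mul hc2).sub (hc2.mul hGa)))).congr_of_eventuallyEq h2)
  have h0 : (X' (c 0)).1 = (c 0).2 (X (c 0)).1 := congrArg Prod.fst h.self_of_nhds
  simp only [ContinuousLinearMap.coe_fst', ContinuousLinearMap.coe_snd', h0,
    Pi.add_apply, Pi.sub_apply, Pi.mul_apply] at e1 e2 ⊢
  refine ⟨e1, ?_⟩
  generalize Γ (c 0).1 (fderiv ℝ X' (c 0) u).1 = g at *
  generalize Γ (c 0).1 (fderiv ℝ X (c 0) u).1 = g' at *
  generalize (fderiv ℝ X' (c 0) u).2 = g'' at *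
  rw [← sub_eq_zero] at e2 ⊢
  rw [← e2]
  noncomm_ring

/-- The curvature of the connection with coefficients `G` whose derivative is `G'`. -/
def coordCurvature (G : E →L[ℝ] E →L[ℝ] E) (G' : E →L[ℝ] E →L[ℝ] E →L[ℝ] E) (a b : E) :
    E →L[ℝ] E :=
  G' a b - G' b a + (G a * G b - G b * G a)

/-- The torsion of the connection with coefficients `G`. -/
def coordTorsion (G : E →L[ℝ] E →L[ℝ] E) (a b : E) : E := G a b - G b a

/-- The algebraic identity which expresses the vertical part of the Nijenhuis tensor through the
curvature. Here `θ` and `η` are the values of the covariant derivative of the tautological section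
along the two vectors, the elements `a`, `b`, `a'`, `b'` are the connection coefficients along the
base vectors and their images by `j`, and the other elements are derivatives of the connection
coefficients. -/
theorem nijenhuis_ring_identity {A : Type*} [Ring A] {j : A} (hj : j * j = -1)
    (θ η a b a' b' dab dba da'b dba' dab' db'a da'b' db'a' : A) :
    ((j * θ - (a' * j - j * a')) * η + j * ((da'b * j - j * da'b) +
        (b * (j * θ - (a' * j - j * a')) - (j * θ - (a' * j - j * a')) * b)) -
        (da'b' * j - j * da'b') -
        (b' * (j * θ - (a' * j - j * a')) - (j * θ - (a' * j - j * a')) * b')) -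
    ((j * η - (b' * j - j * b')) * θ + j * ((db'a * j - j * db'a) +
        (a * (j * η - (b' * j - j * b')) - (j * η - (b' * j - j * b')) * a)) -
        (db'a' * j - j * db'a') -
        (a' * (j * η - (b' * j - j * b')) - (j * η - (b' * j - j * b')) * a')) +
    j * ((η - (b * j - j * b)) * θ + j * ((dba * j - j * dba) +
        (a * (η - (b * j - j * b)) - (η - (b * j - j * b)) * a)) -
        (dba' * j - j * dba') -
        (a' * (η - (b * j - j * b)) - (η - (b * j - j * b)) * a')) -
    j * ((θ - (a * j - j * a)) * η + j * ((dab * j - j * dab) +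
        (b * (θ - (a * j - j * a)) - (θ - (a * j - j * a)) * b)) -
        (dab' * j - j * dab') -
        (b' * (θ - (a * j - j * a)) - (θ - (a * j - j * a)) * b')) =
    -(((da'b' - db'a' + (a' * b' - b' * a')) * j - j * (da'b' - db'a' + (a' * b' - b' * a'))) -
      j * ((da'b - dba' + (a' * b - b * a')) * j - j * (da'b - dba' + (a' * b - b * a'))) -
      j * ((dab' - db'a + (a * b' - b' * a)) * j - j * (dab' - db'a + (a * b' - b' * a))) -
      ((dab - dba + (a * b - b * a)) * j - j * (dab - dba + (a * b - b * a)))) := by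
  have hj' (x : A) : j * (j * x) = -x := by rw [← mul_assoc, hj, neg_one_mul]
  simp only [mul_add, add_mul, mul_sub, sub_mul, mul_assoc, hj', mul_neg]
  abel

/-- The Nijenhuis tensor of the twistor structure in coordinates: its horizontal part is given by
the torsion, and its vertical part by the curvature. The extension of the structure from the
twistor bundle enters only through the derivatives along curves in the bundle. -/
theorem nijenhuis_coord {Γ : E → E →L[ℝ] E →L[ℝ] E} {Γ' : E →L[ℝ] E →L[ℝ] E →L[ℝ] E}
    {p : E × (E →L[ℝ] E)} (hΓ : HasFDerivAt Γ Γ' p.1) (hj : p.2 * p.2 = -1)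
    {X Y X' Y' : E × (E →L[ℝ] E) → E × (E →L[ℝ] E)} (hX : DifferentiableAt ℝ X p)
    (hY : DifferentiableAt ℝ Y p) (hX' : DifferentiableAt ℝ X' p) (hY' : DifferentiableAt ℝ Y' p)
    (S : Set (E × (E →L[ℝ] E)))
    (hS : ∀ W ∈ ({X, Y, X', Y'} : Set (E × (E →L[ℝ] E) → E × (E →L[ℝ] E))),
      ∃ c : ℝ → E × (E →L[ℝ] E), HasDerivAt c (W p) 0 ∧ c 0 = p ∧ ∀ᶠ t in 𝓝 0, c t ∈ S)
    (hXX' : ∀ᶠ q in 𝓝 p, q ∈ S → X' q = modelStructure (Γ q.1) q.2 (X q))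
    (hYY' : ∀ᶠ q in 𝓝 p, q ∈ S → Y' q = modelStructure (Γ q.1) q.2 (Y q))
    {N : E × (E →L[ℝ] E)}
    (hN : N = lieBracket ℝ X' Y' p - modelStructure (Γ p.1) p.2 (lieBracket ℝ X' Y p)
      - modelStructure (Γ p.1) p.2 (lieBracket ℝ X Y' p) - lieBracket ℝ X Y p)
    {T : E → E → E} (hT : T = coordTorsion (Γ p.1))
    {R : E → E → E →L[ℝ] E} (hR : R = coordCurvature (Γ p.1) Γ')
    {a b : E} (ha : a = (X p).1) (hb : b = (Y p).1) :
    N.1 = -(T (p.2 a) (p.2 b) - p.2 (T (p.2 a) b) - p.2 (T a (p.2 b)) - T a b) ∧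
    N.2 + (Γ p.1 N.1 * p.2 - p.2 * Γ p.1 N.1) =
      -((R (p.2 a) (p.2 b) * p.2 - p.2 * R (p.2 a) (p.2 b))
        - p.2 * (R (p.2 a) b * p.2 - p.2 * R (p.2 a) b)
        - p.2 * (R a (p.2 b) * p.2 - p.2 * R a (p.2 b))
        - (R a b * p.2 - p.2 * R a b)) := by
  set θ : E × (E →L[ℝ] E) → (E →L[ℝ] E) :=
    fun Z ↦ Z.2 + (Γ p.1 Z.1 * p.2 - p.2 * Γ p.1 Z.1) with hθ
  have hθs (Z W) : θ (Z - W) = θ Z - θ W := by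
    simp only [hθ, Prod.fst_sub, Prod.snd_sub, map_sub]
    noncomm_ring
  have hθJ (Z) : θ (modelStructure (Γ p.1) p.2 Z) = p.2 * θ Z := by
    simp only [hθ, modelStructure]
    exact sub_add_cancel _ _
  have hj' (v : E) : p.2 (p.2 v) = -v := congrArg (fun f : E →L[ℝ] E ↦ f v) hj
  have key {W W' : E × (E →L[ℝ] E) → E × (E →L[ℝ] E)}
      (hW : ∀ᶠ q in 𝓝 p, q ∈ S → W' q = modelStructure (Γ q.1) q.2 (W q))
      (hd : DifferentiableAt ℝ W p) (hd' : DifferentiableAt ℝ W' p)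
      {Z} (hZ : Z ∈ ({X, Y, X', Y'} : Set (E × (E →L[ℝ] E) → E × (E →L[ℝ] E)))) :
      (fderiv ℝ W' p (Z p)).1 = (Z p).2 (W p).1 + p.2 (fderiv ℝ W p (Z p)).1 ∧
      θ (fderiv ℝ W' p (Z p)) = p.2 * θ (fderiv ℝ W p (Z p)) +
        ((Z p).2 * θ (W p) +
        p.2 * ((Γ' (Z p).1 (W p).1 * p.2 - p.2 * Γ' (Z p).1 (W p).1) +
          (Γ p.1 (W p).1 * (Z p).2 - (Z p).2 * Γ p.1 (W p).1)) -
        (Γ' (Z p).1 (p.2 (W p).1) * p.2 - p.2 * Γ' (Z p).1 (p.2 (W p).1)) -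
        (Γ p.1 (p.2 (W p).1) * (Z p).2 - (Z p).2 * Γ p.1 (p.2 (W p).1))) := by
    obtain ⟨c, hc, hc0, hcS⟩ := hS Z hZ
    have h : ∀ᶠ t in 𝓝 (0 : ℝ), c t ∈ S → W' (c t) = modelStructure (Γ (c t).1) (c t).2 (W (c t)) :=
      hc.continuousAt.eventually (by rwa [hc0])
    exact hasDerivAt_modelStructure hΓ hd hd' hc hc0 ((hcS.and h).mono fun t ht ↦ ht.2 ht.1)
  obtain ⟨a1, b1⟩ := key hYY' hY hY' (Z := X') (by simp)
  obtain ⟨a2, b2⟩ := key hXX' hX hX' (Z := Y') (by simp)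
  obtain ⟨a3, b3⟩ := key hYY' hY hY' (Z := X) (by simp)
  obtain ⟨a4, b4⟩ := key hXX' hX hX' (Z := Y) (by simp)
  have hp : p ∈ S := by
    obtain ⟨c, hc, hc0, hcS⟩ := hS X (by simp)
    exact hc0 ▸ hcS.self_of_nhds
  have hX0 := hXX'.self_of_nhds hp
  have hY0 := hYY'.self_of_nhds hp
  have ha' : (X' p).1 = p.2 a := by rw [hX0, ha]; rfl
  have hb' : (Y' p).1 = p.2 b := by rw [hY0, hb]; rfl
  have hA (Z) : Z.2 = θ Z - (Γ p.1 Z.1 * p.2 - p.2 * Γ p.1 Z.1) := (add_sub_cancel_right _ _).symm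
  have hX2 := hA (X p)
  have hY2 := hA (Y p)
  have hX2' := hA (X' p)
  have hY2' := hA (Y' p)
  rw [ha'] at hX2'
  rw [hb'] at hY2'
  rw [congrArg θ hX0, hθJ] at hX2'
  rw [congrArg θ hY0, hθJ] at hY2'
  rw [← ha] at hX2
  rw [← hb] at hY2
  simp only [lieBracket] at hN
  constructor
  · have : N.1 = (X' p).2 b - (Y' p).2 a + p.2 ((Y p).2 a) - p.2 ((X p).2 b) := by
      rw [hN]
      simp only [modelStructure, Prod.fst_sub, map_sub, a1, a2, a3, a4, hj', ← ha, ← hb, map_add]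
      abel
    rw [this, hX2, hY2, hX2', hY2', hT]
    simp only [_root_.sub_apply, mul_apply_eq_comp, coordTorsion, map_sub, hj']
    abel
  · change θ N = _
    rw [hR]
    rw [hN]
    have hj'' (x : E →L[ℝ] E) : p.2 * (p.2 * x) = -x := by rw [← mul_assoc, hj, neg_one_mul]
    have hsum (t₁ t₂ t₃ t₄ s₁ s₂ s₃ s₄ : E →L[ℝ] E) :
        (p.2 * t₁ + s₁) - (p.2 * t₂ + s₂) - p.2 * (t₁ - (p.2 * t₄ + s₄)) -
          p.2 * ((p.2 * t₃ + s₃) - t₂) - (t₃ - t₄) = s₁ - s₂ + p.2 * s₄ - p.2 * s₃ := by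
      simp only [mul_sub, mul_add, hj'']
      abel
    simp only [hθs, hθJ, b1, b2, b3, b4]
    rw [hsum]
    simp only [← ha, ← hb, ha', hb', hX2, hY2, hX2', hY2']
    exact nijenhuis_ring_identity hj (θ (X p)) (θ (Y p))
      (Γ p.1 a) (Γ p.1 b) (Γ p.1 (p.2 a))
      (Γ p.1 (p.2 b)) (Γ' a b) (Γ' b a) (Γ' (p.2 a) b) (Γ' b (p.2 a)) (Γ' a (p.2 b))
      (Γ' (p.2 b) a) (Γ' (p.2 a) (p.2 b)) (Γ' (p.2 b) (p.2 a))

end Nijenhuis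

/-! ### Compatible complex structures on a symplectic vector space -/

section LinearAlgebra

variable {E : Type*} [NormedAddCommGroup E] [NormedSpace ℝ E]

/-- The complex structure `j` on the symplectic vector space `(E, σ)` belongs to the Siegel
space. -/
structure IsCompatible (σ : E →L[ℝ] E →L[ℝ] ℝ) (j : E →L[ℝ] E) : Prop where
  sq (u : E) : j (j u) = -u
  skew (u v : E) : σ (j u) v + σ u (j v) = 0
  pos (u : E) (hu : u ≠ 0) : 0 < σ u (j u)

/-- The operator `j` restricts to a compatible complex structure of the subspace `W`. -/
structure IsCompatibleOn (σ : E →L[ℝ] E →L[ℝ] ℝ) (W : Submodule ℝ E) (j : E →ₗ[ℝ] E) : Prop where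
  mem (u : E) (hu : u ∈ W) : j u ∈ W
  sq (u : E) (hu : u ∈ W) : j (j u) = -u
  skew (u : E) (hu : u ∈ W) (v : E) (hv : v ∈ W) : σ (j u) v + σ u (j v) = 0
  pos (u : E) (hu : u ∈ W) (h0 : u ≠ 0) : 0 < σ u (j u)

/-- The restriction of `σ` to `W` is non-degenerate. -/
def NondegenerateOn (σ : E →L[ℝ] E →L[ℝ] ℝ) (W : Submodule ℝ E) : Prop :=
  ∀ u ∈ W, (∀ v ∈ W, σ u v = 0) → u = 0

/-- The vectors of `W` which are orthogonal to `v` and `w`. -/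
def orthogonalIn (σ : E →L[ℝ] E →L[ℝ] ℝ) (W : Submodule ℝ E) (v w : E) : Submodule ℝ E :=
  W ⊓ LinearMap.ker (σ v : E →ₗ[ℝ] ℝ) ⊓ LinearMap.ker (σ w : E →ₗ[ℝ] ℝ)

variable {σ : E →L[ℝ] E →L[ℝ] ℝ} {W : Submodule ℝ E} {v w : E}

theorem mem_orthogonalIn {u : E} : u ∈ orthogonalIn σ W v w ↔ u ∈ W ∧ σ v u = 0 ∧ σ w u = 0 := by
  simp [orthogonalIn, and_assoc]

theorem apply_swap (hσ : ∀ u, σ u u = 0) (u v : E) : σ u v = -σ v u := by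
  have := hσ (u + v)
  simp only [map_add, _root_.add_apply, hσ] at this
  linarith

/-- The decomposition of a vector along a hyperbolic plane and its orthogonal complement. -/
theorem sub_mem_orthogonalIn (hσ : ∀ u, σ u u = 0) (hv : v ∈ W) (hw : w ∈ W) (hvw : 0 < σ v w)
    {u : E} (hu : u ∈ W) :
    u - (σ u w / σ v w) • v - (σ v u / σ v w) • w ∈ orthogonalIn σ W v w := by
  refine mem_orthogonalIn.2 ⟨W.sub_mem (W.sub_mem hu (W.smul_mem _ hv)) (W.smul_mem _ hw), ?_, ?_⟩
  · simp only [map_sub, map_smul, hσ, smul_eq_mul]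
    field_simp
    ring
  · simp only [map_sub, map_smul, hσ, smul_eq_mul, apply_swap hσ w u, apply_swap hσ w v]
    field_simp
    ring

theorem NondegenerateOn.restrict (hσ : ∀ u, σ u u = 0) (hW : NondegenerateOn σ W)
    (hv : v ∈ W) (hw : w ∈ W) (hvw : 0 < σ v w) :
    NondegenerateOn σ (orthogonalIn σ W v w) := by
  intro u hu h
  obtain ⟨huW, huv, huw⟩ := mem_orthogonalIn.1 hu
  refine hW u huW fun t ht ↦ ?_
  have := h _ (sub_mem_orthogonalIn hσ hv hw hvw ht)
  simpa [apply_swap hσ u v, apply_swap hσ u w, huv, huw] using this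

/-- A compatible complex structure of the orthogonal complement of a hyperbolic plane extends to
the whole space, by the rotation which sends `v` to `w`. -/
theorem exists_isCompatibleOn_extension (hσ : ∀ u, σ u u = 0) (hv : v ∈ W) (hw : w ∈ W)
    (hvw : 0 < σ v w) {j' : E →ₗ[ℝ] E} (hj' : IsCompatibleOn σ (orthogonalIn σ W v w) j') :
    ∃ j : E →ₗ[ℝ] E, IsCompatibleOn σ W j ∧ j v = w ∧ ∀ u ∈ orthogonalIn σ W v w, j u = j' u := by
  set c := σ v w with hc
  have hwv : σ w v = -c := apply_swap hσ w v
  let α : E →ₗ[ℝ] ℝ := c⁻¹ • (σ.flip w : E →ₗ[ℝ] ℝ)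
  let β : E →ₗ[ℝ] ℝ := c⁻¹ • (σ v : E →ₗ[ℝ] ℝ)
  let P : E →ₗ[ℝ] E := LinearMap.id - α.smulRight v - β.smulRight w
  have hα u : α u = c⁻¹ * σ u w := rfl
  have hβ u : β u = c⁻¹ * σ v u := rfl
  have hPdef u : P u = u - α u • v - β u • w := rfl
  have hP u (hu : u ∈ W) : P u ∈ orthogonalIn σ W v w := by
    have := sub_mem_orthogonalIn hσ hv hw hvw hu
    rw [hPdef, hα, hβ]
    rwa [inv_mul_eq_div, inv_mul_eq_div]
  let j : E →ₗ[ℝ] E := α.smulRight w - β.smulRight v + j'.comp P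
  have hj u : j u = α u • w - β u • v + j' (P u) := rfl
  have hPo u (hu : u ∈ orthogonalIn σ W v w) : α u = 0 ∧ β u = 0 ∧ P u = u := by
    obtain ⟨h1, h2, h3⟩ := mem_orthogonalIn.1 hu
    have ha : α u = 0 := by rw [hα, apply_swap hσ, h3]; simp
    have hb : β u = 0 := by rw [hβ, h2]; simp
    exact ⟨ha, hb, by rw [hPdef, ha, hb]; simp⟩
  have hv1 : α v = 1 := by rw [hα, ← hc, inv_mul_cancel₀ hvw.ne']
  have hv2 : β v = 0 := by rw [hβ, hσ]; simp
  have hw1 : α w = 0 := by rw [hα, hσ]; simp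
  have hw2 : β w = 1 := by rw [hβ, ← hc, inv_mul_cancel₀ hvw.ne']
  have hdec u : u = α u • v + β u • w + P u := by rw [hPdef]; abel
  have hort u (hu : u ∈ orthogonalIn σ W v w) : σ v u = 0 ∧ σ w u = 0 ∧ σ u v = 0 ∧ σ u w = 0 := by
    obtain ⟨h1, h2, h3⟩ := mem_orthogonalIn.1 hu
    exact ⟨h2, h3, by rw [apply_swap hσ, h2, neg_zero], by rw [apply_swap hσ, h3, neg_zero]⟩
  have hform (a b a' b' : ℝ) (u u' : E) (hu : u ∈ orthogonalIn σ W v w)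
      (hu' : u' ∈ orthogonalIn σ W v w) :
      σ (a • v + b • w + u) (a' • v + b' • w + u') = c * (a * b' - b * a') + σ u u' := by
    obtain ⟨-, -, h1, h2⟩ := hort u hu
    obtain ⟨h3, h4, -, -⟩ := hort u' hu'
    simp only [map_add, map_smul, _root_.add_apply, _root_.smul_apply, smul_eq_mul, h1, h2, h3, h4,
      hσ, hwv, ← hc]
    ring
  have hj2 u : j u = (-β u) • v + α u • w + j' (P u) := by rw [hj, neg_smul]; abel
  refine ⟨j, ⟨fun u hu ↦ ?_, fun u hu ↦ ?_, fun u hu t ht ↦ ?_, fun u hu h0 ↦ ?_⟩, ?_, ?_⟩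
  · exact W.add_mem (W.sub_mem (W.smul_mem _ hw) (W.smul_mem _ hv))
      (mem_orthogonalIn.1 (hj'.mem _ (hP u hu))).1
  · obtain ⟨h1, h2, h3⟩ := hPo _ (hj'.mem _ (hP u hu))
    have hPv : P v = 0 := by rw [hPdef, hv1, hv2]; simp
    have hPw : P w = 0 := by rw [hPdef, hw1, hw2]; simp
    have jv : j v = w := by rw [hj, hv1, hv2, hPv]; simp
    have jw : j w = -v := by rw [hj, hw1, hw2, hPw]; simp
    have jP : j (j' (P u)) = -P u := by rw [hj, h1, h2, h3, hj'.sq _ (hP u hu)]; simp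
    rw [hj u, map_add, map_sub, map_smul, map_smul, jv, jw, jP]
    conv_rhs => rw [hdec u]
    module
  · rw [hj2 u, hj2 t]
    conv_lhs => rw [hdec u, hdec t]
    have h := hj'.skew _ (hP u hu) _ (hP t ht)
    simp only [← hdec]
    rw [hdec u, hdec t]
    simp only [← hdec]
    have e1 := hform (-β u) (α u) (α t) (β t) _ _ (hj'.mem _ (hP u hu)) (hP t ht)
    have e2 := hform (α u) (β u) (-β t) (α t) _ _ (hP u hu) (hj'.mem _ (hP t ht))
    rw [← hdec] at e1 e2
    rw [e1, e2]
    linear_combination h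
  · have e := hform (α u) (β u) (-β u) (α u) _ _ (hP u hu) (hj'.mem _ (hP u hu))
    rw [← hdec, ← hj2] at e
    rw [e]
    by_cases hPu : P u = 0
    · have : α u ≠ 0 ∨ β u ≠ 0 := by
        by_contra! hab
        apply h0
        rw [hdec u, hPu, hab.1, hab.2]
        simp
      rw [hPu, map_zero, map_zero, _root_.zero_apply, add_zero]
      refine mul_pos hvw ?_
      rcases this with h | h
      · nlinarith [mul_self_pos.2 h, mul_self_nonneg (β u)]
      · nlinarith [mul_self_pos.2 h, mul_self_nonneg (α u)]
    · have h1 := hj'.pos _ (hP u hu) hPu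
      have h2 : 0 ≤ c * (α u * α u - β u * -β u) :=
        mul_nonneg hvw.le (by nlinarith [mul_self_nonneg (α u), mul_self_nonneg (β u)])
      linarith
  · have hPv : P v = 0 := by rw [hPdef, hv1, hv2]; simp
    rw [hj, hv1, hv2, hPv]
    simp
  · intro u hu
    obtain ⟨h1, h2, h3⟩ := hPo u hu
    rw [hj, h1, h2, h3]
    simp

variable [FiniteDimensional ℝ E]

theorem NondegenerateOn.exists_isCompatibleOn (hσ : ∀ u, σ u u = 0) (hW : NondegenerateOn σ W) :
    ∃ j : E →ₗ[ℝ] E, IsCompatibleOn σ W j := by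
  induction h : Module.finrank ℝ W using Nat.strong_induction_on generalizing W with
  | _ n ih =>
    by_cases hbot : W = ⊥
    · subst hbot
      exact ⟨0, ⟨by simp, by simp, by simp, by simp_all⟩⟩
    · obtain ⟨v, hv, hv0⟩ := W.ne_bot_iff.1 hbot
      obtain ⟨w, hw, hvw⟩ : ∃ w ∈ W, 0 < σ v w := by
        by_contra! hle
        refine hv0 (hW v hv fun t ht ↦ le_antisymm (hle t ht) ?_)
        have := hle (-t) (W.neg_mem ht)
        rw [map_neg] at this
        linarith
      have hlt : orthogonalIn σ W v w < W := by
        refine lt_of_le_of_ne (fun u hu ↦ (mem_orthogonalIn.1 hu).1) fun he ↦ ?_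
        rw [← he] at hw
        exact hvw.ne' (mem_orthogonalIn.1 hw).2.1
      obtain ⟨j', hj'⟩ := ih _ (h ▸ Submodule.finrank_lt_finrank_of_lt hlt)
        (hW.restrict hσ hv hw hvw) rfl
      obtain ⟨j, hj, -⟩ := exists_isCompatibleOn_extension hσ hv hw hvw hj'
      exact ⟨j, hj⟩

theorem IsCompatibleOn.isCompatible {j : E →ₗ[ℝ] E} (hj : IsCompatibleOn σ ⊤ j) :
    IsCompatible σ (LinearMap.toContinuousLinearMap j) :=
  ⟨fun u ↦ hj.sq u trivial, fun u v ↦ hj.skew u trivial v trivial, fun u ↦ hj.pos u trivial⟩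

/-- A compatible complex structure can be prescribed on a vector. -/
theorem exists_isCompatible_apply (hσ : ∀ u, σ u u = 0) (hnd : ∀ u, (∀ v, σ u v = 0) → u = 0)
    (hvw : 0 < σ v w) : ∃ j, IsCompatible σ j ∧ j v = w := by
  have hW : NondegenerateOn σ ⊤ := fun u _ h ↦ hnd u fun v ↦ h v trivial
  obtain ⟨j', hj'⟩ := (hW.restrict hσ (v := v) (w := w) trivial trivial
    hvw).exists_isCompatibleOn hσ
  obtain ⟨j, hj, hjv, -⟩ := exists_isCompatibleOn_extension hσ (W := ⊤) trivial trivial hvw hj'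
  exact ⟨_, hj.isCompatible, hjv⟩

/-- Every linear form is the contraction of `σ` with a vector. -/
theorem exists_contraction_eq (hnd : ∀ u, (∀ v, σ u v = 0) → u = 0) (f : E →L[ℝ] ℝ) :
    ∃ s, σ s = f := by
  have hinj : Function.Injective ((LinearMap.toContinuousLinearMap.symm.toLinearMap :
      (E →L[ℝ] ℝ) →ₗ[ℝ] (E →ₗ[ℝ] ℝ)) ∘ₗ (σ : E →ₗ[ℝ] E →L[ℝ] ℝ)) := by
    rw [← LinearMap.ker_eq_bot, LinearMap.ker_eq_bot']
    intro m hm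
    exact hnd m fun v ↦ congrArg (fun g : E →ₗ[ℝ] ℝ ↦ g v) hm
  have hsurj := (LinearMap.injective_iff_surjective_of_finrank_eq_finrank
    (Subspace.dual_finrank_eq (K := ℝ) (V := E)).symm).1 hinj
  obtain ⟨s, hs⟩ := hsurj (f : E →ₗ[ℝ] ℝ)
  exact ⟨s, ContinuousLinearMap.ext fun v ↦ congrArg (fun g : E →ₗ[ℝ] ℝ ↦ g v) hs⟩

/-- Independent orthogonal vectors `x` and `y` belong to a symplectic family, and the compatible
complex structures can send `x` and `y` to arbitrary positive multiples of the other two vectors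
of the family. -/
theorem exists_isCompatible_smul (hσ : ∀ u, σ u u = 0) (hnd : ∀ u, (∀ v, σ u v = 0) → u = 0)
    {x y : E} (hxy : σ x y = 0) (hind : LinearIndependent ℝ ![x, y]) :
    ∃ z w : E, ∀ t : ℝ, 0 < t → ∃ j, IsCompatible σ j ∧ j x = t • z ∧ j y = t • w := by
  have hdual (a b : ℝ) : ∃ z, σ x z = a ∧ σ y z = b := by
    obtain ⟨f, hf⟩ : ∃ f : E →ₗ[ℝ] ℝ, f x = -a ∧ f y = -b := by
      obtain ⟨f, hf⟩ := LinearMap.exists_extend ((Module.Basis.span hind).constr ℝ ![-a, -b])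
      have h (i : Fin 2) : f (![x, y] i) = ![-a, -b] i := by
        rw [← (Module.Basis.span hind).constr_basis ℝ ![-a, -b] i, ← hf, LinearMap.comp_apply,
          Submodule.subtype_apply, Module.Basis.span_apply]
      exact ⟨f, h 0, h 1⟩
    obtain ⟨z, hz⟩ := exists_contraction_eq hnd (LinearMap.toContinuousLinearMap f)
    refine ⟨z, ?_, ?_⟩
    · rw [apply_swap hσ, hz]; simp [hf.1]
    · rw [apply_swap hσ, hz]; simp [hf.2]
  obtain ⟨z, hxz, hyz⟩ := hdual 1 0
  obtain ⟨w', hxw', hyw'⟩ := hdual 0 1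
  obtain ⟨w, hxw, hyw, hzw⟩ : ∃ w, σ x w = 0 ∧ σ y w = 1 ∧ σ z w = 0 := by
    refine ⟨w' + σ z w' • x, ?_, ?_, ?_⟩
    · simp [hxw', hσ]
    · simp [hyw', apply_swap hσ y x, hxy]
    · simp [apply_swap hσ z x, hxz]
  refine ⟨z, w, fun t ht ↦ ?_⟩
  have hW : NondegenerateOn σ ⊤ := fun u _ h ↦ hnd u fun v ↦ h v trivial
  have h1 : 0 < σ x (t • z) := by simpa [hxz] using ht
  have h2 : 0 < σ y (t • w) := by simpa [hyw] using ht
  have hy : y ∈ orthogonalIn σ ⊤ x (t • z) :=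
    mem_orthogonalIn.2 ⟨trivial, hxy, by simp [apply_swap hσ z y, hyz]⟩
  have hw : t • w ∈ orthogonalIn σ ⊤ x (t • z) :=
    mem_orthogonalIn.2 ⟨trivial, by simp [hxw], by simp [hzw]⟩
  have hW1 := hW.restrict hσ (v := x) (w := t • z) trivial trivial h1
  obtain ⟨j₂, hj₂⟩ := (hW1.restrict hσ hy hw h2).exists_isCompatibleOn hσ
  obtain ⟨j₁, hj₁, hj₁y, -⟩ := exists_isCompatibleOn_extension hσ hy hw h2 hj₂
  obtain ⟨j, hj, hjx, hjo⟩ := exists_isCompatibleOn_extension hσ (W := ⊤) trivial trivial h1 hj₁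
  exact ⟨_, hj.isCompatible, hjx, (hjo y hy).trans hj₁y⟩

end LinearAlgebra

/-! ### Tensors constrained by all compatible complex structures -/

section Tensors

variable {E : Type*} [NormedAddCommGroup E] [NormedSpace ℝ E]
  {σ : E →L[ℝ] E →L[ℝ] ℝ}

/-- The covariant version of the condition on a family of operators `B a` which expresses that the
corresponding vertical translation is complex linear on the Siegel space. -/
theorem apply_commutator_eq {j : E →L[ℝ] E} (hj : IsCompatible σ j) {B B' : E →L[ℝ] E}
    (h : j * (B * j - j * B) = B' * j - j * B') (z w : E) :
    -σ (B (j z)) (j w) + σ (B z) w = σ (B' (j z)) w + σ (B' z) (j w) := by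
  have h1 := congrArg (fun f : E →L[ℝ] E ↦ σ (f z) w) h
  simp only [mul_apply_eq_comp, _root_.sub_apply, map_sub, hj.sq, map_add,
    _root_.add_apply, sub_neg_eq_add] at h1
  have h2 := hj.skew (B (j z)) w
  have h3 := hj.skew (B' z) w
  linarith

theorem eq_zero_or_eq_smul_of_not_linearIndependent {x y : E}
    (h : ¬LinearIndependent ℝ ![x, y]) : x = 0 ∨ ∃ c : ℝ, y = c • x := by
  rw [LinearIndependent.pair_iff] at h
  push Not at h
  obtain ⟨a, b, hab, hne⟩ := h
  by_cases hb : b = 0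
  · have ha : a ≠ 0 := fun ha ↦ hne ha hb
    exact Or.inl (by simpa [hb, ha] using hab)
  · have hb' : b • y = (-a) • x := by rw [neg_smul]; exact eq_neg_of_add_eq_zero_right hab
    exact Or.inr ⟨b⁻¹ * -a, by rw [← smul_smul, ← hb', inv_smul_smul₀ hb]⟩

theorem exists_apply_eq_one (hnd : ∀ u, (∀ v, σ u v = 0) → u = 0) (hE : ∃ u : E, u ≠ 0) :
    ∃ z y, σ z y = 1 := by
  obtain ⟨z, hz⟩ := hE
  obtain ⟨y, hy⟩ : ∃ y, σ z y ≠ 0 := by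
    by_contra! hle
    exact hz (hnd _ hle)
  exact ⟨z, (σ z y)⁻¹ • y, by simp [hy]⟩

/-- A tensor with the symmetries of a symplectic curvature tensor vanishes if its components
`D x y x x` do. -/
theorem curvatureLike_eq_zero {V : Type*} [AddCommGroup V] {D : V → V → V → V → ℝ}
    (h₁ : ∀ a a' b c d, D (a + a') b c d = D a b c d + D a' b c d)
    (h₃ : ∀ a b c c' d, D a b (c + c') d = D a b c d + D a b c' d)
    (halt : ∀ a b c d, D a b c d = -D b a c d) (hsymm : ∀ a b c d, D a b c d = D a b d c)
    (hB : ∀ a b c d, D a b c d + D b c a d + D c a b d = 0)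
    (h0 : ∀ x y, D x y x x = 0) (a b c d : V) : D a b c d = 0 := by
  have h₄ a b c d d' : D a b c (d + d') = D a b c d + D a b c d' := by
    rw [hsymm, h₃, hsymm a b d, hsymm a b d']
  have pol (x y u v : V) : D x y u v + D u y x v + D v y x u = 0 := by
    have e := h0 (x + u + v) y
    have e1 := h0 (x + u) y
    have e2 := h0 (x + v) y
    have e3 := h0 (u + v) y
    simp only [h₁, h₃, h₄, h0] at e e1 e2 e3
    rw [hsymm x y v u, hsymm u y v x, hsymm v y u x] at e
    linarith
  linarith [hB a b c d, hB a b d c, pol b a c d, pol a b c d, hsymm a b d c, halt b a c d,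
    halt c b a d, halt d b a c]

/-- The covariant version of the vertical part of the Nijenhuis tensor. -/
theorem apply_nijenhuis_commutator {j : E →L[ℝ] E} (hj : IsCompatible σ j)
    (R₁ R₂ R₃ R₄ : E →L[ℝ] E) (z w : E) :
    σ (((R₁ * j - j * R₁) - j * (R₂ * j - j * R₂) - j * (R₃ * j - j * R₃)
        - (R₄ * j - j * R₄)) z) w =
      σ (R₁ (j z)) w + σ (R₁ z) (j w) + σ (R₂ (j z)) (j w) - σ (R₂ z) w
        + σ (R₃ (j z)) (j w) - σ (R₃ z) w - σ (R₄ (j z)) w - σ (R₄ z) (j w) := by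
  simp only [mul_apply_eq_comp, _root_.sub_apply, map_sub, hj.sq, map_neg,
    _root_.neg_apply]
  linarith [hj.skew (R₁ z) w, hj.skew (R₂ (j z)) w, hj.skew (R₃ (j z)) w, hj.skew (R₄ z) w]

/-- A tensor of Ricci-type satisfies the Nijenhuis condition for all compatible complex
structures. -/
theorem nijenhuis_commutator_eq_zero (hnd : ∀ u, (∀ v, σ u v = 0) → u = 0)
    {j : E →L[ℝ] E} (hj : IsCompatible σ j) {R : E → E → E →L[ℝ] E} {r : E → E → ℝ} {k : ℝ}
    (hR : ∀ x y z t, σ (R x y z) t = k *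
      (2 * σ x y * r z t + σ x z * r y t + σ x t * r y z - σ y z * r x t - σ y t * r x z))
    (a b : E) : (R (j a) (j b) * j - j * R (j a) (j b))
      - j * (R (j a) b * j - j * R (j a) b) - j * (R a (j b) * j - j * R a (j b))
      - (R a b * j - j * R a b) = 0 := by
  refine ContinuousLinearMap.ext fun z ↦ hnd _ fun w ↦ ?_
  have h1 (u v) : σ (j u) v = -σ u (j v) := eq_neg_of_add_eq_zero_left (hj.skew u v)
  rw [apply_nijenhuis_commutator hj]
  simp only [hR, h1, hj.sq, map_neg]
  ring

variable [FiniteDimensional ℝ E]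

/-- A difference tensor of two torsion-free symplectic connections which does not change the complex
structure of the twistor bundle vanishes. -/
theorem eq_zero_of_commutator_eq (hσ : ∀ u, σ u u = 0) (hnd : ∀ u, (∀ v, σ u v = 0) → u = 0)
    {B : E →L[ℝ] E →L[ℝ] E} (hsymm : ∀ u v, B u v = B v u)
    (hsp : ∀ a u v, σ (B a u) v + σ u (B a v) = 0)
    (h : ∀ j, IsCompatible σ j → ∀ a, j * (B a * j - j * B a) = B (j a) * j - j * B (j a)) :
    B = 0 := by
  have hs (a u v) : σ (B a u) v = σ (B a v) u := by
    linarith [hsp a u v, apply_swap hσ u (B a v)]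
  have h0 (v : E) : σ (B v v) v = 0 := by
    by_cases hv : v = 0
    · simp [hv]
    obtain ⟨w, hw⟩ : ∃ w, 0 < σ v w := by
      by_contra! hle
      refine hv (hnd v fun w ↦ le_antisymm (hle w) ?_)
      have := hle (-w)
      rw [map_neg] at this
      linarith
    -- the condition on a structure with `j v = t w`; both sides are polynomials in `t`
    have key (t : ℝ) (ht : 0 < t) : σ (B v v) v = 3 * t ^ 2 * σ (B v w) w := by
      obtain ⟨j, hj, hjv⟩ := exists_isCompatible_apply hσ hnd (v := v) (w := t • w)
        (by simpa using mul_pos ht hw)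
      have := apply_commutator_eq hj (h j hj v) v v
      simp only [hjv, map_smul, _root_.smul_apply, smul_eq_mul] at this
      rw [hsymm w v, hs w w v, hsymm w v] at this
      linear_combination this
    linarith [key 1 one_pos, key 2 two_pos]
  -- polarization of the cubic form
  ext a b
  refine hnd _ fun c ↦ ?_
  have e := h0 (a + b + c)
  have e1 := h0 (a + b)
  have e2 := h0 (a + c)
  have e3 := h0 (b + c)
  simp only [map_add, _root_.add_apply, h0] at e e1 e2 e3
  rw [hsymm b a, hsymm c a, hsymm c b] at e
  rw [hsymm b a] at e1
  rw [hsymm c a] at e2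
  rw [hsymm c b] at e3
  linarith [hs a b c, hs b a c, hs c a b, hs a a b, hs a a c, hs b b a, hs b b c, hs c c a,
    hs c c b, hs a b b, congrArg (fun x ↦ σ x b) (hsymm a c), congrArg (fun x ↦ σ x c) (hsymm a b),
    congrArg (fun x ↦ σ x a) (hsymm b c)]

/-- A torsion tensor, annihilated by the Nijenhuis condition for all compatible complex
structures, is determined by a single vector. -/
theorem exists_torsion_eq (hσ : ∀ u, σ u u = 0) (hnd : ∀ u, (∀ v, σ u v = 0) → u = 0)
    {T : E →L[ℝ] E →L[ℝ] E} (halt : ∀ u v, T u v = -T v u)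
    (hcyc : ∀ u v w, σ (T u v) w + σ (T v w) u + σ (T w u) v = 0)
    (h : ∀ j, IsCompatible σ j → ∀ a b, T (j a) (j b) - j (T (j a) b) - j (T a (j b)) - T a b = 0) :
    ∃ s, ∀ u v, T u v = σ s v • u - σ s u • v + (2 * σ u v) • s := by
  have hself (u) : T u u = 0 := by
    have h2 : (2 : ℝ) • T u u = 0 := by rw [two_smul]; exact add_eq_zero_iff_eq_neg.2 (halt u u)
    exact (smul_eq_zero_iff_right two_ne_zero).1 h2
  have h0 (x y : E) (hxy : σ x y = 0) : σ (T x y) x = 0 := by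
    by_cases hind : LinearIndependent ℝ ![x, y]
    · obtain ⟨z, w, hzw⟩ := exists_isCompatible_smul hσ hnd hxy hind
      have key (t : ℝ) (ht : 0 < t) : t ^ 2 * (σ (T z w) x + σ (T z y) z + σ (T x w) z)
          = σ (T x y) x := by
        obtain ⟨j, hj, hjx, hjy⟩ := hzw t ht
        have e := congrArg (fun a ↦ σ a x) (h j hj x y)
        have e1 := hj.skew (T (j x) y) x
        have e2 := hj.skew (T x (j y)) x
        simp only [hjx, hjy, map_smul, map_sub, _root_.smul_apply, _root_.sub_apply, map_zero,
          _root_.zero_apply, smul_eq_mul] at e e1 e2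
        linear_combination e + e1 + e2
      linarith [key 1 one_pos, key 2 two_pos]
    · obtain rfl | ⟨c, rfl⟩ := eq_zero_or_eq_smul_of_not_linearIndependent hind <;> simp [hself]
  by_cases hE : ∀ u : E, u = 0
  · exact ⟨0, fun u v ↦ by rw [hE (T u v), hE u, hE v]; simp⟩
  obtain ⟨z₀, y₀, hzy⟩ := exists_apply_eq_one hnd (not_forall.1 hE)
  -- The quadratic form `σ (T u y₀) u` vanishes on the hyperplane `σ u y₀ = 0`, and `F` is the
  -- linear form of the quotient.
  let F : E →L[ℝ] ℝ := σ (T z₀ y₀) + (σ.flip z₀).comp (T.flip y₀)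
    - (σ (T z₀ y₀) z₀) • σ.flip y₀
  have hF u : F u = σ (T z₀ y₀) u + σ (T u y₀) z₀ - σ (T z₀ y₀) z₀ * σ u y₀ := rfl
  have hF1 (u) : σ (T u y₀) u = σ u y₀ * F u := by
    have e := h0 (u - σ u y₀ • z₀) y₀ (by simp [hzy])
    simp only [map_sub, map_smul, _root_.sub_apply, _root_.smul_apply, smul_eq_mul] at e
    rw [hF]
    linear_combination e
  -- a combination of `v` and `y₀` is orthogonal to `u`
  have hF2 (u v) (hu : σ u y₀ ≠ 0) : σ (T u v) u = σ u v * F u := by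
    have e := h0 u (σ u y₀ • v - σ u v • y₀) (by simp; ring)
    simp only [map_sub, map_smul, _root_.sub_apply, _root_.smul_apply, smul_eq_mul, hF1] at e
    have : σ u y₀ * (σ (T u v) u - σ u v * F u) = 0 := by linear_combination e
    linarith [(mul_eq_zero.1 this).resolve_left hu]
  have hF3 (u v) : σ (T u v) u = σ u v * F u := by
    by_cases hu : σ u y₀ = 0
    · -- both sides are quadratic polynomials along the line `u + t z₀`
      have e (t : ℝ) (ht : 0 < t) := hF2 (u + t • z₀) v (by simp [hu, hzy, ht.ne'])
      have e1 := e 1 one_pos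
      have e2 := e 2 two_pos
      have e3 := e 3 three_pos
      simp only [map_add, map_smul, _root_.add_apply, _root_.smul_apply, smul_eq_mul] at e1 e2 e3
      linarith
    · exact hF2 u v hu
  obtain ⟨s, hs⟩ := exists_contraction_eq hnd ((3 : ℝ)⁻¹ • F)
  have hs' u : F u = 3 * σ s u := by simp [hs]
  refine ⟨s, fun u v ↦ ?_⟩
  let δ (u v w : E) : ℝ := σ (T u v) w -
    (σ s v * σ u w - σ s u * σ v w + 2 * σ u v * σ s w)
  have hδ1 u v w : δ u v w = -δ v u w := by
    simp only [δ, halt u v, map_neg, _root_.neg_apply, apply_swap hσ u v]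
    ring
  have hδ2 u v w : δ u v w + δ v w u + δ w u v = 0 := by
    have := hcyc u v w
    simp only [δ]
    rw [apply_swap hσ v u, apply_swap hσ w u, apply_swap hσ w v]
    linear_combination this
  have hδ3 u v : δ u v u = 0 := by
    simp only [δ, hF3, hs', hσ, apply_swap hσ v u]
    ring
  have hδ4 u v w : δ u v w = -δ w v u := by
    have e := hδ3 (u + w) v
    have e1 := hδ3 u v
    have e2 := hδ3 w v
    simp only [δ, map_add, _root_.add_apply] at e e1 e2 ⊢
    linear_combination e - e1 - e2
  rw [← sub_eq_zero]
  refine hnd _ fun w ↦ ?_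
  have : δ u v w = 0 := by
    linarith [hδ2 u v w, hδ1 u v w, hδ4 u v w, hδ4 v w u, hδ1 v w u, hδ4 w u v, hδ1 w u v,
      hδ1 w v u, hδ4 v u w, hδ1 u w v]
  simp only [map_sub, map_add, map_smul, _root_.sub_apply, _root_.add_apply, _root_.smul_apply,
    smul_eq_mul]
  exact this

/-- A bilinear form is the contraction of `σ` with an operator. -/
theorem exists_operator_eq (hnd : ∀ u, (∀ v, σ u v = 0) → u = 0) (b : E →ₗ[ℝ] E →ₗ[ℝ] ℝ) :
    ∃ B : E →ₗ[ℝ] E, ∀ u v, σ (B u) v = b u v := by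
  choose B hB using fun u ↦ exists_contraction_eq hnd (LinearMap.toContinuousLinearMap (b u))
  have hB' u v : σ (B u) v = b u v := by rw [hB]; rfl
  refine ⟨⟨⟨B, fun u u' ↦ ?_⟩, fun c u ↦ ?_⟩, hB'⟩
  · exact sub_eq_zero.1 (hnd _ fun v ↦ by simp [hB'])
  · exact sub_eq_zero.1 (hnd _ fun v ↦ by simp [hB'])

/-- The operators of the symplectic Lie algebra have trace zero. -/
theorem trace_eq_zero_of_skew (hnd : ∀ u, (∀ v, σ u v = 0) → u = 0)
    {B : E →ₗ[ℝ] E} (hB : ∀ u v, σ (B u) v + σ u (B v) = 0) : LinearMap.trace ℝ E B = 0 := by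
  -- `σ` intertwines `-B` with the transpose of `B`
  let s : E →ₗ[ℝ] Module.Dual ℝ E := (LinearMap.toContinuousLinearMap.symm.toLinearMap :
      (E →L[ℝ] ℝ) →ₗ[ℝ] (E →ₗ[ℝ] ℝ)) ∘ₗ (σ : E →ₗ[ℝ] E →L[ℝ] ℝ)
  have hs u v : s u v = σ u v := rfl
  have hbij : Function.Bijective s := by
    refine ⟨(injective_iff_map_eq_zero _).2 fun u hu ↦ hnd u fun v ↦ by rw [← hs, hu]; rfl,
      fun f ↦ ?_⟩
    obtain ⟨u, hu⟩ := exists_contraction_eq hnd (LinearMap.toContinuousLinearMap f)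
    exact ⟨u, LinearMap.ext fun v ↦ by rw [hs, hu]; rfl⟩
  let e := LinearEquiv.ofBijective s hbij
  have h : Module.Dual.transpose (R := ℝ) B = e.conj (-B) := by
    refine LinearMap.ext fun f ↦ LinearMap.ext fun v ↦ ?_
    obtain ⟨u, rfl⟩ := e.surjective f
    simp only [LinearEquiv.conj_apply, LinearMap.comp_apply, LinearEquiv.coe_coe,
      LinearEquiv.symm_apply_apply, LinearMap.neg_apply, map_neg]
    have := hB u v
    change σ u (B v) = - σ (B u) v
    linarith
  have h2 := congrArg (LinearMap.trace ℝ (Module.Dual ℝ E)) h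
  rw [LinearMap.trace_transpose', LinearMap.trace_conj', map_neg] at h2
  linarith

/-- A symplectic curvature tensor, annihilated by the Nijenhuis condition for all compatible complex
structures, is determined by its Ricci tensor. -/
theorem curvature_eq_of_nijenhuis (hσ : ∀ u, σ u u = 0) (hnd : ∀ u, (∀ v, σ u v = 0) → u = 0)
    {R : E →ₗ[ℝ] E →ₗ[ℝ] E →L[ℝ] E} (halt : ∀ u v, R u v = -R v u)
    (hsp : ∀ a b u v, σ (R a b u) v + σ u (R a b v) = 0)
    (hB : ∀ a b c, R a b c + R b c a + R c a b = 0)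
    (h : ∀ j, IsCompatible σ j → ∀ a b, (R (j a) (j b) * j - j * R (j a) (j b))
      - j * (R (j a) b * j - j * R (j a) b) - j * (R a (j b) * j - j * R a (j b))
      - (R a b * j - j * R a b) = 0)
    {r : E → E → ℝ}
    (hr : ∀ u v (f : E →ₗ[ℝ] E), (∀ w, f w = R u w v) → r u v = LinearMap.trace ℝ E f)
    (x y z t : E) :
    σ (R x y z) t = -(1 / ((Module.finrank ℝ E : ℝ) + 2)) *
      (2 * σ x y * r z t + σ x z * r y t + σ x t * r y z - σ y z * r x t - σ y t * r x z) := by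
  have hs a b u v : σ (R a b u) v = σ (R a b v) u := by
    linarith [hsp a b u v, apply_swap hσ u (R a b v)]
  have hself (u) : R u u = 0 := by
    have h2 : (2 : ℝ) • R u u = 0 := by rw [two_smul]; exact add_eq_zero_iff_eq_neg.2 (halt u u)
    exact (smul_eq_zero_iff_right two_ne_zero).1 h2
  have h0 (x y : E) (hxy : σ x y = 0) : σ (R x y x) x = 0 := by
    by_cases hind : LinearIndependent ℝ ![x, y]
    · obtain ⟨z, w, hzw⟩ := exists_isCompatible_smul hσ hnd hxy hind
      have key (t : ℝ) (ht : 0 < t) : t ^ 4 * σ (R z w z) z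
          - t ^ 2 * (σ (R z w x) x + σ (R z y z) x + σ (R z y x) z + σ (R x w z) x
            + σ (R x w x) z + σ (R x y z) z) + σ (R x y x) x = 0 := by
        obtain ⟨j, hj, hjx, hjy⟩ := hzw t ht
        have e := apply_nijenhuis_commutator hj (R (j x) (j y)) (R (j x) y) (R x (j y)) (R x y)
          x (j x)
        rw [h j hj x y, hj.sq] at e
        simp only [hjx, hjy, map_smul, map_neg, _root_.smul_apply, LinearMap.smul_apply, map_zero,
          _root_.zero_apply, smul_eq_mul] at e
        linear_combination -e
      linarith [key 1 one_pos, key 2 two_pos, key 3 three_pos]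
    · obtain rfl | ⟨c, rfl⟩ := eq_zero_or_eq_smul_of_not_linearIndependent hind <;> simp [hself]
  by_cases hE : ∀ u : E, u = 0
  · rw [hE x, hE y]; simp
  obtain ⟨z₀, y₀, hzy⟩ := exists_apply_eq_one hnd (not_forall.1 hE)
  let P : E →ₗ[ℝ] E := LinearMap.id - (σ.flip y₀ : E →ₗ[ℝ] ℝ).smulRight z₀
  have hP u : P u = u - σ u y₀ • z₀ := rfl
  -- The cubic form `σ (R u y₀ u) u` vanishes on the hyperplane `σ u y₀ = 0`, and `b` is the
  -- symmetric bilinear form of the quotient.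
  let b : E →ₗ[ℝ] E →ₗ[ℝ] ℝ := LinearMap.mk₂ ℝ (fun u v ↦
      σ (R z₀ y₀ (P u)) (P v) + σ (R (P u) y₀ (P v)) z₀ + σ (R (P v) y₀ (P u)) z₀
      + σ u y₀ * (σ (R z₀ y₀ (P v)) z₀ + σ (R (P v) y₀ z₀) z₀ / 2)
      + σ v y₀ * (σ (R z₀ y₀ (P u)) z₀ + σ (R (P u) y₀ z₀) z₀ / 2)
      + σ u y₀ * σ v y₀ * σ (R z₀ y₀ z₀) z₀)
    (fun u u' v ↦ by simp only [map_add, _root_.add_apply, LinearMap.add_apply]; ring)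
    (fun c u v ↦ by
      simp only [map_smul, _root_.smul_apply, LinearMap.smul_apply, smul_eq_mul]; ring)
    (fun u v v' ↦ by simp only [map_add, _root_.add_apply, LinearMap.add_apply]; ring)
    (fun c u v ↦ by
      simp only [map_smul, _root_.smul_apply, LinearMap.smul_apply, smul_eq_mul]; ring)
  have hb u v : b u v = σ (R z₀ y₀ (P u)) (P v) + σ (R (P u) y₀ (P v)) z₀
      + σ (R (P v) y₀ (P u)) z₀
      + σ u y₀ * (σ (R z₀ y₀ (P v)) z₀ + σ (R (P v) y₀ z₀) z₀ / 2)
      + σ v y₀ * (σ (R z₀ y₀ (P u)) z₀ + σ (R (P u) y₀ z₀) z₀ / 2)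
      + σ u y₀ * σ v y₀ * σ (R z₀ y₀ z₀) z₀ := rfl
  have hbs u v : b u v = b v u := by
    rw [hb, hb, hs z₀ y₀ (P u) (P v)]
    ring
  have hF1 (u) : σ (R u y₀ u) u = σ u y₀ * b u u := by
    have e := h0 (P u) y₀ (by simp [hP, hzy])
    have s1 := hs u y₀ z₀ u
    have s2 := hs z₀ y₀ z₀ u
    simp only [hb, hP, map_sub, map_smul, _root_.sub_apply, _root_.smul_apply, LinearMap.sub_apply,
      LinearMap.smul_apply, smul_eq_mul] at e ⊢
    rw [s1, s2] at e
    rw [s2]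
    linear_combination e
  have hF2 (u v) (hu : σ u y₀ ≠ 0) : σ (R u v u) u = σ u v * b u u := by
    have e := h0 u (σ u y₀ • v - σ u v • y₀) (by simp; ring)
    simp only [map_sub, map_smul, _root_.sub_apply, _root_.smul_apply, smul_eq_mul, hF1] at e
    have : σ u y₀ * (σ (R u v u) u - σ u v * b u u) = 0 := by linear_combination e
    linarith [(mul_eq_zero.1 this).resolve_left hu]
  have hF3 (u v) : σ (R u v u) u = σ u v * b u u := by
    by_cases hu : σ u y₀ = 0
    · -- both sides are cubic polynomials along the line `u + t z₀`
      have e (t : ℝ) (ht : 0 < t) := hF2 (u + t • z₀) v (by simp [hu, hzy, ht.ne'])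
      have e1 := e 1 one_pos
      have e2 := e 2 two_pos
      have e3 := e 3 three_pos
      have e4 := e 4 four_pos
      clear e
      clear_value b P
      simp only [map_add, map_smul, _root_.add_apply, _root_.smul_apply, smul_eq_mul,
        LinearMap.add_apply, LinearMap.smul_apply] at e1 e2 e3 e4
      linear_combination 4 * e1 - 6 * e2 + 4 * e3 - e4
    · exact hF2 u v hu
  clear_value b
  -- The right-hand side has the symmetries of `R` and the same components `(x, y, x, x)`.
  have hQ (x y z t : E) : σ (R x y z) t = (2 * σ x y * b z t + σ x z * b y t + σ x t * b y z
      - σ y z * b x t - σ y t * b x z) / 4 := by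
    rw [← sub_eq_zero]
    refine curvatureLike_eq_zero (D := fun x y z t ↦ σ (R x y z) t - (2 * σ x y * b z t
      + σ x z * b y t + σ x t * b y z - σ y z * b x t - σ y t * b x z) / 4)
      (fun a a' b c d ↦ ?_) (fun a b c c' d ↦ ?_) (fun a b c d ↦ ?_) (fun a b c d ↦ ?_)
      (fun a b c d ↦ ?_) (fun a b ↦ ?_) x y z t
    · simp only [map_add, _root_.add_apply, LinearMap.add_apply]
      ring
    · simp only [map_add, _root_.add_apply, LinearMap.add_apply]
      ring
    · simp only [halt a b, map_neg, _root_.neg_apply, apply_swap hσ a b]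
      ring
    · simp only [hs a b c d, hbs c d]
      ring
    · have e := congrArg (fun f ↦ σ f d) (hB a b c)
      simp only [map_add, _root_.add_apply, map_zero, _root_.zero_apply] at e
      simp only [apply_swap hσ b a, apply_swap hσ c b, apply_swap hσ c a, hbs b a, hbs c a, hbs c b]
      linear_combination e
    · simp only [hF3, hσ, apply_swap hσ b a]
      ring
  -- In the Ricci contraction, the operator `B` with `σ (B u) v = b u v` is trace-free.
  obtain ⟨B, hB'⟩ := exists_operator_eq hnd b
  have htr : LinearMap.trace ℝ E B = 0 := trace_eq_zero_of_skew hnd fun u v ↦ by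
    rw [apply_swap hσ u, hB', hB', hbs u v]; ring
  have hrb (u v : E) : r u v = -((Module.finrank ℝ E : ℝ) + 2) / 4 * b u v := by
    rw [hr u v ((4 : ℝ)⁻¹ • ((2 : ℝ) • (σ u : E →ₗ[ℝ] ℝ).smulRight (B v)
        + σ u v • B + (b v).smulRight u - (σ.flip v : E →ₗ[ℝ] ℝ).smulRight (B u)
        - b u v • LinearMap.id)) fun w ↦ sub_eq_zero.1 (hnd _ fun t ↦ ?_)]
    swap
    · change σ ((4 : ℝ)⁻¹ • ((2 : ℝ) • σ u w • B v + σ u v • B w + b v w • u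
        - σ w v • B u - b u v • w) - R u w v) t = 0
      simp only [map_add, map_sub, map_smul, _root_.add_apply, _root_.sub_apply,
        _root_.smul_apply, smul_eq_mul, hB', hQ]
      rw [hbs v w]
      ring
    simp only [map_smul, map_add, map_sub, htr, LinearMap.trace_smulRight, LinearMap.trace_id,
      smul_eq_mul, ContinuousLinearMap.coe_coe, ContinuousLinearMap.flip_apply, hB']
    rw [apply_swap hσ u (B v), hB', hbs v u]
    ring
  have hdim : (Module.finrank ℝ E : ℝ) + 2 ≠ 0 := by positivity
  rw [hQ]
  simp only [hrb]
  field_simp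
  ring

end Tensors

/-! ### Parallel transport in coordinates -/

section Transport

variable {E : Type*} [NormedAddCommGroup E] [NormedSpace ℝ E]

set_option synthInstance.maxHeartbeats 200000 in
/-- Parallel transport preserves the parallel form. -/
theorem transport_preserves {Γ : E → E →L[ℝ] E →L[ℝ] E} {σ : E → E →L[ℝ] E →L[ℝ] ℝ} {z v : E}
    {g : ℝ → E →L[ℝ] E} (hg0 : g 0 = 1)
    (hg : ∀ᶠ t in 𝓝 (0 : ℝ), HasDerivAt g (-(Γ (z + t • v) v * g t)) t)
    (hσ : ∀ᶠ y in 𝓝 z, DifferentiableAt ℝ σ y ∧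
      ∀ v b c, fderiv ℝ σ y v b c = σ y (Γ y v b) c + σ y b (Γ y v c)) :
    ∀ᶠ t in 𝓝 (0 : ℝ), ∀ a b, σ (z + t • v) (g t a) (g t b) = σ z a b := by
  have hc : Tendsto (fun t : ℝ ↦ z + t • v) (𝓝 0) (𝓝 z) := by
    have : Continuous fun t : ℝ ↦ z + t • v := by fun_prop
    simpa using this.tendsto 0
  obtain ⟨ε, hε, h⟩ := Metric.eventually_nhds_iff_ball.1 (hg.and (hc.eventually hσ))
  have hp : IsPreconnected (Metric.ball (0 : ℝ) ε) := (convex_ball 0 ε).isPreconnected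
  have h0 : (0 : ℝ) ∈ Metric.ball 0 ε := Metric.mem_ball_self hε
  filter_upwards [Metric.ball_mem_nhds 0 hε] with t ht a b
  have hd (s : ℝ) (hs : s ∈ Metric.ball 0 ε) :
      HasDerivAt (fun s ↦ σ (z + s • v) (g s a) (g s b)) 0 s := by
    obtain ⟨h1, h2, h3⟩ := h s hs
    have hl : HasDerivAt (fun s : ℝ ↦ z + s • v) v s := by
      simpa using ((hasDerivAt_id s).smul_const v).const_add z
    have hσ' : HasDerivAt (fun s ↦ σ (z + s • v)) (fderiv ℝ σ (z + s • v) v) s := by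
      have h4 : HasFDerivAt (fun s ↦ σ (z + s • v)) _ s :=
        HasFDerivAt.comp (f := fun s ↦ z + s • v) (g := σ) s h2.hasFDerivAt hl.hasFDerivAt
      simpa using h4.hasDerivAt
    have ha : HasDerivAt (fun s ↦ g s a) _ s := h1.clm_apply (hasDerivAt_const s a)
    have hb : HasDerivAt (fun s ↦ g s b) _ s := h1.clm_apply (hasDerivAt_const s b)
    refine ((hσ'.clm_apply ha).clm_apply hb).congr_deriv ?_
    simp [h3]
  have := Metric.isOpen_ball.is_const_of_deriv_eq_zero hp
    (fun s hs ↦ (hd s hs).differentiableAt.differentiableWithinAt)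
    (fun s hs ↦ (hd s hs).deriv) ht h0
  simpa [hg0] using this

variable [CompleteSpace E]

set_option synthInstance.maxHeartbeats 200000 in
/-- Parallel transport along the segments through `z`: the solutions of `g' = -Γ g`. -/
theorem exists_transport {Γ : E → E →L[ℝ] E →L[ℝ] E} {z : E} (hΓ : ContDiffAt ℝ 1 Γ z) (v : E) :
    ∃ g : ℝ → E →L[ℝ] E, g 0 = 1 ∧
      ∀ᶠ t in 𝓝 (0 : ℝ), HasDerivAt g (-(Γ (z + t • v) v * g t)) t := by
  -- the time is a component of the state, so that the equation becomes autonomous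
  let F : ℝ × (E →L[ℝ] E) → ℝ × (E →L[ℝ] E) := fun p ↦ (1, -(Γ (z + p.1 • v) v * p.2))
  have hF : ContDiffAt ℝ 1 F (0, 1) := by
    have h1 : ContDiffAt ℝ 1 (fun p : ℝ × (E →L[ℝ] E) ↦ z + p.1 • v) (0, 1) := by fun_prop
    have h2 : ContDiffAt ℝ 1 (fun p : ℝ × (E →L[ℝ] E) ↦ Γ (z + p.1 • v)) (0, 1) :=
      ContDiffAt.comp (g := Γ) (0, 1) (by simpa using hΓ) h1
    exact contDiffAt_const.prodMk ((h2.clm_apply contDiffAt_const).mul contDiffAt_snd).neg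
  obtain ⟨γ, hγ0, ε, hε, hγ⟩ :=
    hF.exists_forall_mem_closedBall_exists_eq_forall_mem_Ioo_hasDerivAt₀ 0
  have hγ (t : ℝ) (ht : t ∈ Set.Ioo (-ε) ε) : HasDerivAt γ (F (γ t)) t := hγ t (by simpa using ht)
  have hmem : Set.Ioo (-ε) ε ∈ 𝓝 (0 : ℝ) := Ioo_mem_nhds (by simpa using hε) hε
  have h1 (t : ℝ) (ht : t ∈ Set.Ioo (-ε) ε) : HasDerivAt (fun s ↦ (γ s).1) 1 t := by
    have : HasDerivAt (fun s ↦ (γ s).1) _ t := hasFDerivAt_fst.comp_hasDerivAt t (hγ t ht)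
    exact this
  have h2 (t : ℝ) (ht : t ∈ Set.Ioo (-ε) ε) :
      HasDerivAt (fun s ↦ (γ s).2) (-(Γ (z + (γ t).1 • v) v * (γ t).2)) t := by
    have : HasDerivAt (fun s ↦ (γ s).2) _ t := hasFDerivAt_snd.comp_hasDerivAt t (hγ t ht)
    exact this
  have h3 (t : ℝ) (ht : t ∈ Set.Ioo (-ε) ε) : (γ t).1 = t := by
    have hs (s : ℝ) (hs : s ∈ Set.Ioo (-ε) ε) : HasDerivAt (fun s ↦ (γ s).1 - s) 0 s := by
      have := (h1 s hs).sub (hasDerivAt_id s)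
      rw [sub_self] at this
      exact this
    have := isOpen_Ioo.is_const_of_deriv_eq_zero isPreconnected_Ioo (f := fun s ↦ (γ s).1 - s)
      (fun s h ↦ (hs s h).differentiableAt.differentiableWithinAt)
      (fun s h ↦ (hs s h).deriv) ht (mem_of_mem_nhds hmem)
    simpa [hγ0, sub_eq_zero] using this
  refine ⟨fun t ↦ (γ t).2, by simp [hγ0], ?_⟩
  filter_upwards [hmem] with t ht
  simpa [h3 t ht] using h2 t ht

set_option synthInstance.maxHeartbeats 200000 in
/-- The horizontal curves of the twistor bundle, in coordinates: parallel transport conjugates `j`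
to compatible complex structures along a segment. -/
theorem exists_horizontal_curve {Γ : E → E →L[ℝ] E →L[ℝ] E} {σ : E → E →L[ℝ] E →L[ℝ] ℝ} {z : E}
    (hΓ : ContDiffAt ℝ 1 Γ z) (hσ : ∀ᶠ y in 𝓝 z, DifferentiableAt ℝ σ y ∧
      ∀ v b c, fderiv ℝ σ y v b c = σ y (Γ y v b) c + σ y b (Γ y v c))
    {j : E →L[ℝ] E} (hj : IsCompatible (σ z) j) (v : E) :
    ∃ c : ℝ → E × (E →L[ℝ] E), HasDerivAt c (v, -(Γ z v * j - j * Γ z v)) 0 ∧ c 0 = (z, j) ∧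
      ∀ᶠ t in 𝓝 (0 : ℝ), IsCompatible (σ (c t).1) (c t).2 := by
  obtain ⟨g, hg0, hg⟩ := exists_transport hΓ v
  have hpres := transport_preserves hg0 hg hσ
  have hd := hg.self_of_nhds
  simp only [hg0, zero_smul, add_zero, mul_one] at hd
  have hinv : HasDerivAt (fun t ↦ Ring.inverse (g t)) (Γ z v) 0 := by
    have h1 := hasFDerivAt_ringInverse (𝕜 := ℝ) (1 : (E →L[ℝ] E)ˣ)
    rw [Units.val_one, ← hg0] at h1
    refine (h1.comp_hasDerivAt 0 hd).congr_deriv ?_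
    rw [inv_one, Units.val_one]
    change -(1 * -(Γ z v) * 1) = Γ z v
    rw [one_mul, mul_one, neg_neg]
  have hunit : ∀ᶠ t in 𝓝 (0 : ℝ), IsUnit (g t) :=
    hd.continuousAt.eventually (by rw [hg0]; exact Units.isOpen.mem_nhds isUnit_one)
  refine ⟨fun t ↦ (z + t • v, g t * j * Ring.inverse (g t)), ?_, by simp [hg0], ?_⟩
  · have hl : HasDerivAt (fun s : ℝ ↦ z + s • v) v 0 := by
      simpa using ((hasDerivAt_id (0 : ℝ)).smul_const v).const_add z
    refine (hl.prodMk ((hd.mul_const j).mul hinv)).congr_deriv ?_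
    rw [hg0, Ring.inverse_one]
    refine congrArg (Prod.mk v) ?_
    noncomm_ring
  · filter_upwards [hpres, hunit] with t ht hu
    have hr : Ring.inverse (g t) * g t = 1 := Ring.inverse_mul_cancel _ hu
    have hl : g t * Ring.inverse (g t) = 1 := Ring.mul_inverse_cancel _ hu
    have hr' (u : E) : Ring.inverse (g t) (g t u) = u := congrArg (fun f : E →L[ℝ] E ↦ f u) hr
    have hl' (u : E) : g t (Ring.inverse (g t) u) = u := congrArg (fun f : E →L[ℝ] E ↦ f u) hl
    have hs (u w : E) : ∃ a b, u = g t a ∧ w = g t b := ⟨_, _, (hl' u).symm, (hl' w).symm⟩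
    constructor
    · intro u
      simp [hr', hj.sq, hl']
    · intro u w
      obtain ⟨a, b, rfl, rfl⟩ := hs u w
      simp only [mul_apply_eq_comp, hr', ht, hj.skew]
    · intro u hu
      obtain ⟨a, -, rfl, -⟩ := hs u u
      simp only [mul_apply_eq_comp, hr', ht]
      refine hj.pos a fun ha ↦ hu (by simp [ha])

end Transport

/-! ### Functions in the charts of the base -/

section ChartCalculus

variable {E : Type*} [NormedAddCommGroup E] [NormedSpace ℝ E]
  {M : Type*} [TopologicalSpace M] [ChartedSpace E M]
  {F : Type*}

/-- A function on the manifold, as a function of the coordinates in the preferred chart at `x₀`. -/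
def inChart (x₀ : M) (f : M → F) (z : E) : F := f ((extChartAt 𝓘(ℝ, E) x₀).symm z)

theorem inChart_apply {x₀ y : M} (hy : y ∈ (chartAt E x₀).source) (f : M → F) :
    inChart x₀ f (extChartAt 𝓘(ℝ, E) x₀ y) = f y := by
  rw [inChart, (extChartAt 𝓘(ℝ, E) x₀).left_inv (by rwa [extChartAt_source])]

theorem eventually_chart {x₀ y : M} (hy : y ∈ (chartAt E x₀).source) :
    ∀ᶠ z in 𝓝 (extChartAt 𝓘(ℝ, E) x₀ y), ∃ y' ∈ (chartAt E x₀).source,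
      extChartAt 𝓘(ℝ, E) x₀ y' = z := by
  filter_upwards [(isOpen_extChartAt_target x₀).mem_nhds
    ((extChartAt 𝓘(ℝ, E) x₀).map_source (by rwa [extChartAt_source]))] with z hz
  exact ⟨_, by simpa using (extChartAt 𝓘(ℝ, E) x₀).map_target hz,
    (extChartAt 𝓘(ℝ, E) x₀).right_inv hz⟩

variable [IsManifold 𝓘(ℝ, E) ∞ M] [NormedAddCommGroup F] [NormedSpace ℝ F]

theorem contDiffAt_inChart {x₀ y : M} (hy : y ∈ (chartAt E x₀).source) {f : M → F}
    (hf : ContMDiffAt 𝓘(ℝ, E) 𝓘(ℝ, F) ∞ f y) :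
    ContDiffAt ℝ ∞ (inChart x₀ f) (extChartAt 𝓘(ℝ, E) x₀ y) := by
  rw [← contMDiffAt_iff_contDiffAt]
  have hs : y ∈ (extChartAt 𝓘(ℝ, E) x₀).source := by rwa [extChartAt_source]
  have h1 : ContMDiffAt 𝓘(ℝ, E) 𝓘(ℝ, E) ∞ (extChartAt 𝓘(ℝ, E) x₀).symm
      (extChartAt 𝓘(ℝ, E) x₀ y) :=
    (contMDiffOn_extChartAt_symm x₀).contMDiffAt
      ((isOpen_extChartAt_target x₀).mem_nhds ((extChartAt 𝓘(ℝ, E) x₀).map_source hs))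
  refine ContMDiffAt.comp (g := f) _ ?_ h1
  rwa [(extChartAt 𝓘(ℝ, E) x₀).left_inv hs]

theorem mvfderiv_eq_fderiv_inChart {x₀ y : M} (hy : y ∈ (chartAt E x₀).source) {f : M → F}
    (hf : ContMDiffAt 𝓘(ℝ, E) 𝓘(ℝ, F) ∞ f y) (v : TangentSpace 𝓘(ℝ, E) y) :
    mvfderiv 𝓘(ℝ, E) f y v =
      fderiv ℝ (inChart x₀ f) (extChartAt 𝓘(ℝ, E) x₀ y) (toCoord x₀ y v) := by
  have h1 : f =ᶠ[𝓝 y] inChart x₀ f ∘ extChartAt 𝓘(ℝ, E) x₀ := by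
    filter_upwards [(chartAt E x₀).open_source.mem_nhds hy] with y' hy'
    exact (inChart_apply hy' f).symm
  rw [mvfderiv_congr h1, mvfderiv_comp_mfderiv_apply (I' := 𝓘(ℝ, E)), ← toCoord_eq_mfderiv hy]
  · simp only [mvfderiv, mfderiv_eq_fderiv]
    rfl
  · exact ((contDiffAt_inChart hy hf).differentiableAt (by simp)).mdifferentiableAt
  · exact mdifferentiableAt_extChartAt hy

end ChartCalculus

/-! ### The symplectic form in coordinates -/

section FormCoordinates

variable {E : Type*} [NormedAddCommGroup E] [NormedSpace ℝ E]
  {M : Type*} [TopologicalSpace M] [ChartedSpace E M] [IsManifold 𝓘(ℝ, E) ∞ M]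
  (Ω : SymplecticForm E M)

/-- The symplectic form at `y` in the coordinates of the preferred chart at `x₀`. -/
def formCoeff (x₀ y : M) : E →L[ℝ] E →L[ℝ] ℝ :=
  ((ContinuousLinearMap.precomp ℝ (ofCoord x₀ y)).comp (Ω.toFun y)).comp (ofCoord x₀ y)

theorem formCoeff_apply (x₀ y : M) (u v : E) :
    formCoeff Ω x₀ y u v = Ω.toFun y (ofCoord x₀ y u) (ofCoord x₀ y v) := rfl

theorem formCoeff_toCoord {x₀ y : M} (hy : y ∈ (chartAt E x₀).source)
    (u v : TangentSpace 𝓘(ℝ, E) y) :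
    formCoeff Ω x₀ y (toCoord x₀ y u) (toCoord x₀ y v) = Ω.toFun y u v := by
  rw [formCoeff_apply, ofCoord_toCoord hy, ofCoord_toCoord hy]

theorem formCoeff_self_apply (x₀ y : M) (u : E) : formCoeff Ω x₀ y u u = 0 := Ω.alt _ _

theorem formCoeff_nondegenerate {x₀ y : M} (hy : y ∈ (chartAt E x₀).source) (u : E)
    (h : ∀ v, formCoeff Ω x₀ y u v = 0) : u = 0 := by
  have : ofCoord x₀ y u = 0 := Ω.nondegenerate _ _ fun v ↦ by
    rw [← formCoeff_toCoord Ω hy, toCoord_ofCoord hy, h]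
  rw [← toCoord_ofCoord hy u, this, map_zero]

/-- The twistor bundle in coordinates. -/
theorem mem_twistorBundle_iff {x₀ : M} {q : EndTM E M} (hq : q.1 ∈ (chartAt E x₀).source) :
    q ∈ twistorBundle Ω ↔ IsCompatible (formCoeff Ω x₀ q.1) (endCoord x₀ q) := by
  constructor
  · rintro ⟨h1, h2, h3⟩
    refine ⟨fun u ↦ ?_, fun u v ↦ ?_, fun u hu ↦ ?_⟩
    · rw [endCoord_apply, endCoord_apply, ofCoord_toCoord hq, h1, map_neg, toCoord_ofCoord hq]
    · rw [formCoeff_apply, formCoeff_apply, endCoord_apply, endCoord_apply, ofCoord_toCoord hq,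
        ofCoord_toCoord hq, h2]
    · rw [formCoeff_apply, endCoord_apply, ofCoord_toCoord hq]
      refine h3 _ fun h0 ↦ hu ?_
      rw [← toCoord_ofCoord hq u, h0, map_zero]
  · rintro ⟨h1, h2, h3⟩
    refine ⟨fun u ↦ ?_, fun u v ↦ ?_, fun u hu ↦ ?_⟩
    · have := congrArg (ofCoord x₀ q.1) (h1 (toCoord x₀ q.1 u))
      rwa [endCoord_toCoord hq, endCoord_toCoord hq, map_neg, ofCoord_toCoord hq,
        ofCoord_toCoord hq] at this
    · have := h2 (toCoord x₀ q.1 u) (toCoord x₀ q.1 v)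
      rwa [endCoord_toCoord hq, endCoord_toCoord hq, formCoeff_toCoord Ω hq,
        formCoeff_toCoord Ω hq] at this
    · have := h3 (toCoord x₀ q.1 u) fun h0 ↦ hu (by rw [← ofCoord_toCoord hq u, h0, map_zero])
      rwa [endCoord_toCoord hq, formCoeff_toCoord Ω hq] at this

theorem contMDiffAt_formCoeff_apply {x₀ y : M} (hy : y ∈ (chartAt E x₀).source) (u v : E) :
    ContMDiffAt 𝓘(ℝ, E) 𝓘(ℝ) ∞ (fun y' ↦ formCoeff Ω x₀ y' u v) y := by
  have h := ContMDiffAt.clm_bundle_apply₂ (F₁ := E) (F₂ := E) (F₃ := ℝ) (n := ∞)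
    (E₃ := Bundle.Trivial M ℝ) (Ω.smooth.contMDiffAt (x := y))
    (contMDiffAt_ofCoord hy (contMDiffAt_const (c := u)))
    (contMDiffAt_ofCoord hy (contMDiffAt_const (c := v)))
  rw [contMDiffAt_totalSpace] at h
  exact h.2

variable [FiniteDimensional ℝ E]

theorem contMDiffAt_formCoeff {x₀ y : M} (hy : y ∈ (chartAt E x₀).source) :
    ContMDiffAt 𝓘(ℝ, E) 𝓘(ℝ, E →L[ℝ] E →L[ℝ] ℝ) ∞ (formCoeff Ω x₀) y := by
  set b := Module.finBasis ℝ E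
  let bc (i) : E →L[ℝ] ℝ := LinearMap.toContinuousLinearMap (b.coord i)
  have h : formCoeff Ω x₀ = fun y' ↦ ∑ i, ∑ k, formCoeff Ω x₀ y' (b i) (b k) •
      ContinuousLinearMap.smulRightL ℝ E (E →L[ℝ] ℝ) (bc i) (bc k) := by
    funext y'
    ext u v
    have hu (f : E →L[ℝ] ℝ) (w : E) : f w = ∑ k, b.repr w k * f (b k) := by
      conv_lhs => rw [← b.sum_repr w]
      simp only [_root_.map_sum, map_smul, smul_eq_mul]
    have hv : formCoeff Ω x₀ y' u v = ∑ i, b.repr u i * formCoeff Ω x₀ y' (b i) v :=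
      hu ((formCoeff Ω x₀ y').flip v) u
    rw [hv]
    simp only [_root_.sum_apply, _root_.smul_apply, smul_eq_mul,
      ContinuousLinearMap.smulRightL_apply_apply, ContinuousLinearMap.smulRight_apply]
    refine Finset.sum_congr rfl fun i _ ↦ ?_
    rw [hu (formCoeff Ω x₀ y' (b i)), Finset.mul_sum]
    refine Finset.sum_congr rfl fun k _ ↦ ?_
    change b.repr u i * (b.repr v k * _) = _ * (b.repr u i * b.repr v k)
    ring
  rw [h]
  exact ContMDiffAt.sum fun i _ ↦ ContMDiffAt.sum fun k _ ↦
    (contMDiffAt_formCoeff_apply Ω hy _ _).smul contMDiffAt_const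

end FormCoordinates

/-! ### Torsion and curvature in coordinates -/

section ConnectionCoordinates

variable {E : Type*} [NormedAddCommGroup E] [NormedSpace ℝ E]
  {M : Type*} [TopologicalSpace M] [ChartedSpace E M] [IsManifold 𝓘(ℝ, E) ∞ M]

theorem LinearConnection.congr_field (D : LinearConnection E M) {y : M}
    {s s' : Π x : M, TangentSpace 𝓘(ℝ, E) x} (h : s =ᶠ[𝓝 y] s') (hs' : MDiffAt (T% s') y) :
    D s y = D s' y := by
  refine D.isCovariantDerivativeOnUniv.congr_of_eventuallyEq (hs'.congr_of_eventuallyEq ?_) hs'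
    univ_mem h
  filter_upwards [h] with y' hy'
  rw [hy']

variable [FiniteDimensional ℝ E]

/-- Coordinate fields commute. -/
theorem mlieBracket_ofCoord {x₀ y : M} (hy : y ∈ (chartAt E x₀).source) (a b : E) :
    mlieBracket 𝓘(ℝ, E) (fun y' ↦ ofCoord x₀ y' a) (fun y' ↦ ofCoord x₀ y' b) y = 0 := by
  have : IsManifold 𝓘(ℝ, E) (minSmoothness ℝ 2) M :=
    IsManifold.of_le (n := ∞)
      (by rw [minSmoothness_of_isRCLikeNormedField]; exact WithTop.coe_le_coe.2 le_top)
  let V (c : E) : Π z : E, TangentSpace 𝓘(ℝ, E) z := fun _ ↦ c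
  have hV (c : E) (z : E) : MDiffAt (T% (V c)) z :=
    (contMDiffAt_vectorSpace_iff_contDiffAt (n := 1).2
      (contDiffAt_const (c := c))).mdifferentiableAt one_ne_zero
  have h (c : E) : (fun y' ↦ ofCoord x₀ y' c) =ᶠ[𝓝 y]
      mpullback 𝓘(ℝ, E) 𝓘(ℝ, E) (extChartAt 𝓘(ℝ, E) x₀) (V c) := by
    filter_upwards [(chartAt E x₀).open_source.mem_nhds hy] with y' hy'
    rw [mpullback_apply, ← toCoord_eq_mfderiv hy']
    let e : TangentSpace 𝓘(ℝ, E) y' ≃L[ℝ] E := ContinuousLinearEquiv.equivOfInverse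
      (toCoord x₀ y') (ofCoord x₀ y') (ofCoord_toCoord hy') (toCoord_ofCoord hy')
    exact (congrArg (fun f : E →L[ℝ] TangentSpace 𝓘(ℝ, E) y' ↦ f c)
      (ContinuousLinearMap.inverse_equiv e)).symm
  rw [(h a).mlieBracket_vectorField_eq (h b), ← mpullback_mlieBracket (n := ∞) (hV a _) (hV b _)
    (contMDiffAt_extChartAt' hy)
    (by rw [minSmoothness_of_isRCLikeNormedField]; exact WithTop.coe_le_coe.2 le_top)]
  have h0 : mlieBracket 𝓘(ℝ, E) (V a) (V b) = 0 := by
    rw [← mlieBracketWithin_univ, mlieBracketWithin_eq_lieBracketWithin, lieBracketWithin_univ]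
    funext z
    simp [lieBracket]
    rfl
  rw [h0, mpullback_zero]
  rfl

theorem LinearConnection.torsion_coord (D : LinearConnection E M) {x₀ y : M}
    (hy : y ∈ (chartAt E x₀).source) (a b : E) :
    D.torsion y (ofCoord x₀ y a) (ofCoord x₀ y b) =
      ofCoord x₀ y (coordTorsion (connCoeff D x₀ y) a b) := by
  rw [D.torsion_apply (mdiffAt_ofCoord_const hy a) (mdiffAt_ofCoord_const hy b),
    D.apply_ofCoord_const hy, D.apply_ofCoord_const hy, mlieBracket_ofCoord hy, sub_zero,
    toCoord_ofCoord hy, toCoord_ofCoord hy, ← map_sub]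
  rfl

variable {Ω : SymplecticForm E M} {D : LinearConnection E M}

theorem mvfderiv_formCoeff_apply (hD : IsAlmostSymplectic Ω D) {x₀ y : M}
    (hy : y ∈ (chartAt E x₀).source) (v b c : E) :
    mvfderiv 𝓘(ℝ, E) (fun y' ↦ formCoeff Ω x₀ y' b c) y (ofCoord x₀ y v) =
      formCoeff Ω x₀ y (connCoeff D x₀ y v b) c + formCoeff Ω x₀ y b (connCoeff D x₀ y v c) := by
  have h := hD.parallel y (ofCoord x₀ y v) _ _ (mdiffAt_ofCoord_const hy b)
    (mdiffAt_ofCoord_const hy c)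
  rw [D.apply_ofCoord_const hy, D.apply_ofCoord_const hy, toCoord_ofCoord hy] at h
  exact h

/-- The form is parallel, in coordinates. -/
theorem fderiv_formCoeff (hD : IsAlmostSymplectic Ω D) {x₀ y : M}
    (hy : y ∈ (chartAt E x₀).source) (v b c : E) :
    fderiv ℝ (inChart x₀ (formCoeff Ω x₀)) (extChartAt 𝓘(ℝ, E) x₀ y) v b c =
      formCoeff Ω x₀ y (connCoeff D x₀ y v b) c + formCoeff Ω x₀ y b (connCoeff D x₀ y v c) := by
  rw [← mvfderiv_formCoeff_apply hD hy, mvfderiv_eq_fderiv_inChart hy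
    (contMDiffAt_formCoeff_apply Ω hy b c), toCoord_ofCoord hy]
  have h1 := ((contDiffAt_inChart hy (contMDiffAt_formCoeff Ω hy)).differentiableAt
    (by simp)).hasFDerivAt
  have h2 := (h1.clm_apply (hasFDerivAt_const b _)).clm_apply (hasFDerivAt_const c _)
  refine Eq.trans ?_ (congrArg (fun l ↦ l v) h2.fderiv).symm
  simp

/-- The form is parallel near `y`, in coordinates. -/
theorem eventually_fderiv_formCoeff (hD : IsAlmostSymplectic Ω D) {x₀ y : M}
    (hy : y ∈ (chartAt E x₀).source) :
    ∀ᶠ z in 𝓝 (extChartAt 𝓘(ℝ, E) x₀ y), DifferentiableAt ℝ (inChart x₀ (formCoeff Ω x₀)) z ∧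
      ∀ v b c, fderiv ℝ (inChart x₀ (formCoeff Ω x₀)) z v b c =
        inChart x₀ (formCoeff Ω x₀) z (inChart x₀ (connCoeff D x₀) z v b) c +
        inChart x₀ (formCoeff Ω x₀) z b (inChart x₀ (connCoeff D x₀) z v c) := by
  filter_upwards [eventually_chart hy] with z hz
  obtain ⟨y', hy', rfl⟩ := hz
  refine ⟨(contDiffAt_inChart hy' (contMDiffAt_formCoeff Ω hy')).differentiableAt (by simp),
    fun v b c ↦ ?_⟩
  rw [fderiv_formCoeff hD hy', inChart_apply hy', inChart_apply hy']

/-- The closedness of the form restricts the torsion of an almost symplectic connection. -/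
theorem formCoeff_torsion_cyclic (hD : IsAlmostSymplectic Ω D) {x₀ y : M}
    (hy : y ∈ (chartAt E x₀).source) (a b c : E) :
    formCoeff Ω x₀ y (coordTorsion (connCoeff D x₀ y) a b) c +
      formCoeff Ω x₀ y (coordTorsion (connCoeff D x₀ y) b c) a +
      formCoeff Ω x₀ y (coordTorsion (connCoeff D x₀ y) c a) b = 0 := by
  have hs (w : E) := contMDiffAt_ofCoord (n := ∞) hy (contMDiffAt_const (c := w))
  have h := Ω.closed y _ _ _ (hs a) (hs b) (hs c)
  rw [mlieBracket_ofCoord hy, mlieBracket_ofCoord hy, mlieBracket_ofCoord hy] at h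
  have e1 := mvfderiv_formCoeff_apply hD hy a b c
  have e2 := mvfderiv_formCoeff_apply hD hy b c a
  have e3 := mvfderiv_formCoeff_apply hD hy c a b
  simp only [formCoeff_apply] at e1 e2 e3
  simp only [map_zero, _root_.zero_apply, sub_zero] at h
  rw [e1, e2, e3] at h
  simp only [← formCoeff_apply] at h
  have hσ := fun u ↦ formCoeff_self_apply Ω x₀ y u
  simp only [coordTorsion, map_sub, _root_.sub_apply]
  linarith [apply_swap hσ b (connCoeff D x₀ y a c), apply_swap hσ c (connCoeff D x₀ y b a),
    apply_swap hσ a (connCoeff D x₀ y c b)]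

set_option synthInstance.maxHeartbeats 200000 in
/-- The curvature tensor in terms of the connection coefficients. -/
theorem curvatureTensor_eq [T2Space M] (hD : D.ContMDiffCovariantDerivative ∞) (x : M)
    (u v w : TangentSpace 𝓘(ℝ, E) x) :
    curvatureTensor D x u v w = ofCoord x x (coordCurvature (connCoeff D x x)
        (fderiv ℝ (inChart x (connCoeff D x)) (extChartAt 𝓘(ℝ, E) x x)) (toCoord x x u)
        (toCoord x x v) (toCoord x x w)) := by
  have hx := mem_chart_source E x
  have hext (u : TangentSpace 𝓘(ℝ, E) x) :
      (FiberBundle.extend E u : Π y : M, TangentSpace 𝓘(ℝ, E) y) =ᶠ[𝓝 x]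
        fun y ↦ ofCoord x y (toCoord x x u) :=
    extend_eventuallyEq_ofCoord u
  have key (u v w : TangentSpace 𝓘(ℝ, E) x) :
      D (fun y ↦ D (FiberBundle.extend E w) y (FiberBundle.extend E v y)) x
        (FiberBundle.extend E u x) = ofCoord x x
        (fderiv ℝ (inChart x (connCoeff D x)) (extChartAt 𝓘(ℝ, E) x x) (toCoord x x u)
          (toCoord x x v) (toCoord x x w) +
          connCoeff D x x (toCoord x x u) (connCoeff D x x (toCoord x x v) (toCoord x x w))) := by
    have h1 : (fun y ↦ D (FiberBundle.extend E w) y (FiberBundle.extend E v y)) =ᶠ[𝓝 x]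
        fun y ↦ ofCoord x y (connCoeff D x y (toCoord x x v) (toCoord x x w)) := by
      filter_upwards [(hext w).eventually_nhds, hext v,
        (chartAt E x).open_source.mem_nhds hx] with y h1 h2 hy
      rw [D.congr_field h1 (mdiffAt_ofCoord_const hy _), h2, D.apply_ofCoord_const hy,
        toCoord_ofCoord hy]
    have hc := contMDiffAt_connCoeff hD hx
    have hf : ContMDiffAt 𝓘(ℝ, E) 𝓘(ℝ, E) ∞
        (fun y ↦ connCoeff D x y (toCoord x x v) (toCoord x x w)) x :=
      (hc.clm_apply contMDiffAt_const).clm_apply contMDiffAt_const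
    rw [D.congr_field h1 (mdiffAt_ofCoord hx (hf.mdifferentiableAt (by simp))),
      D.apply_ofCoord hx (hf.mdifferentiableAt (by simp)), (hext u).self_of_nhds,
      toCoord_ofCoord hx, mvfderiv_eq_fderiv_inChart hx hf, toCoord_ofCoord hx]
    congr 2
    have h2 := ((contDiffAt_inChart hx hc).differentiableAt (by simp)).hasFDerivAt
    have h3 := (h2.clm_apply (hasFDerivAt_const (toCoord x x v) _)).clm_apply
      (hasFDerivAt_const (toCoord x x w) _)
    refine (congrArg (fun l ↦ l (toCoord x x u)) h3.fderiv).trans ?_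
    simp
  rw [curvatureTensor, curvatureField, key u v w, key v u w,
    (hext u).mlieBracket_vectorField_eq (hext v), mlieBracket_ofCoord hx, map_zero, sub_zero,
    ← map_sub]
  congr 1
  simp only [coordCurvature, _root_.add_apply, _root_.sub_apply, mul_apply_eq_comp]
  abel

set_option synthInstance.maxHeartbeats 200000 in
/-- The curvature operators of an almost symplectic connection belong to the symplectic Lie
algebra. -/
theorem formCoeff_curvature_skew [T2Space M] (hD : IsAlmostSymplectic Ω D) (x : M) (a b u v : E) :
    formCoeff Ω x x (coordCurvature (connCoeff D x x)
      (fderiv ℝ (inChart x (connCoeff D x)) (extChartAt 𝓘(ℝ, E) x x)) a b u) v +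
    formCoeff Ω x x u (coordCurvature (connCoeff D x x)
      (fderiv ℝ (inChart x (connCoeff D x)) (extChartAt 𝓘(ℝ, E) x x)) a b v) = 0 := by
  have hx := mem_chart_source E x
  set z : E := extChartAt 𝓘(ℝ, E) x x
  set Γ : E → E →L[ℝ] E →L[ℝ] E := inChart x (connCoeff D x)
  set σ : E → E →L[ℝ] E →L[ℝ] ℝ := inChart x (formCoeff Ω x)
  have hσx : formCoeff Ω x x = σ z := (inChart_apply hx _).symm
  have hΓx : connCoeff D x x = Γ z := (inChart_apply hx _).symm
  have hdΓ : HasFDerivAt Γ (fderiv ℝ Γ z) z :=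
    ((contDiffAt_inChart hx (contMDiffAt_connCoeff hD.smooth hx)).differentiableAt
      (by simp)).hasFDerivAt
  have hcσ : ContDiffAt ℝ ∞ σ z := contDiffAt_inChart hx (contMDiffAt_formCoeff Ω hx)
  have hdσ : HasFDerivAt σ (fderiv ℝ σ z) z := (hcσ.differentiableAt (by simp)).hasFDerivAt
  have hpar : ∀ᶠ y in 𝓝 z, DifferentiableAt ℝ σ y ∧
      ∀ v b c, fderiv ℝ σ y v b c = σ y (Γ y v b) c + σ y b (Γ y v c) :=
    eventually_fderiv_formCoeff hD hx
  -- the second derivative of the coefficients of the parallel form is symmetric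
  let h : E → ℝ := fun y ↦ σ y u v
  have hh : ContDiffAt ℝ ∞ h z := (hcσ.clm_apply contDiffAt_const).clm_apply contDiffAt_const
  have hsymm : IsSymmSndFDerivAt ℝ h z := hh.isSymmSndFDerivAt
    (by rw [minSmoothness_of_isRCLikeNormedField]; exact WithTop.coe_le_coe.2 le_top)
  have hd2 : DifferentiableAt ℝ (fderiv ℝ h) z :=
    (hh.fderiv_right (m := 1) (by norm_cast)).differentiableAt one_ne_zero
  have key (a b : E) : fderiv ℝ (fderiv ℝ h) z a b =
      σ z (Γ z a (Γ z b u)) v + σ z (Γ z b u) (Γ z a v) + σ z (fderiv ℝ Γ z a b u) v +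
      (σ z (Γ z a u) (Γ z b v) + σ z u (Γ z a (Γ z b v)) + σ z u (fderiv ℝ Γ z a b v)) := by
    have e1 : (fun y ↦ fderiv ℝ h y b) =ᶠ[𝓝 z] fun y ↦ σ y (Γ y b u) v + σ y u (Γ y b v) := by
      filter_upwards [hpar] with y hy
      rw [← hy.2]
      have h2 := (hy.1.hasFDerivAt.clm_apply (hasFDerivAt_const u _)).clm_apply
        (hasFDerivAt_const v _)
      refine (congrArg (fun l ↦ l b) h2.fderiv).trans ?_
      simp
    have e2 : HasFDerivAt (fun y ↦ fderiv ℝ h y b) _ z :=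
      hd2.hasFDerivAt.clm_apply (hasFDerivAt_const b z)
    have hu := (hdΓ.clm_apply (hasFDerivAt_const b z)).clm_apply (hasFDerivAt_const u z)
    have hv := (hdΓ.clm_apply (hasFDerivAt_const b z)).clm_apply (hasFDerivAt_const v z)
    have e3 := (((hdσ.clm_apply hu).clm_apply (hasFDerivAt_const v z)).add
      ((hdσ.clm_apply (hasFDerivAt_const u z)).clm_apply hv)).congr_of_eventuallyEq e1
    have e4 := congrArg (fun l ↦ l a) (e2.unique e3)
    have hp := hpar.self_of_nhds.2
    simp at e4
    rw [hp, hp] at e4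
    linarith
  have := hsymm a b
  rw [key a b, key b a] at this
  rw [hσx, hΓx]
  simp only [coordCurvature, _root_.add_apply, _root_.sub_apply, mul_apply_eq_comp, map_add,
    map_sub]
  linarith

set_option synthInstance.maxHeartbeats 200000 in
/-- The first Bianchi identity. -/
theorem coordCurvature_bianchi [T2Space M] (hD : D.ContMDiffCovariantDerivative ∞)
    (htor : D.torsion = 0) (x : M) {R : E → E → E →L[ℝ] E}
    (hR : R = coordCurvature (connCoeff D x x)
      (fderiv ℝ (inChart x (connCoeff D x)) (extChartAt 𝓘(ℝ, E) x x))) (a b c : E) :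
    R a b c + R b c a + R c a b = 0 := by
  have hx := mem_chart_source E x
  have hsymm {y : M} (hy : y ∈ (chartAt E x).source) (a b : E) :
      connCoeff D x y a b = connCoeff D x y b a := by
    have h := D.torsion_coord hy a b
    rw [htor] at h
    have h2 := congrArg (toCoord x y) h
    rw [toCoord_ofCoord hy] at h2
    exact sub_eq_zero.1 (h2.symm.trans (map_zero _))
  have hd := ((contDiffAt_inChart hx (contMDiffAt_connCoeff hD hx)).differentiableAt
      (by simp)).hasFDerivAt
  have hs2 (a b c : E) : fderiv ℝ (inChart x (connCoeff D x)) (extChartAt 𝓘(ℝ, E) x x) a b c =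
      fderiv ℝ (inChart x (connCoeff D x)) (extChartAt 𝓘(ℝ, E) x x) a c b := by
    have h1 (b c : E) := (hd.clm_apply (hasFDerivAt_const b _)).clm_apply (hasFDerivAt_const c _)
    have h2 : (fun z ↦ inChart x (connCoeff D x) z b c) =ᶠ[𝓝 (extChartAt 𝓘(ℝ, E) x x)]
        fun z ↦ inChart x (connCoeff D x) z c b := by
      filter_upwards [eventually_chart hx] with z hz
      obtain ⟨y, hy, rfl⟩ := hz
      rw [inChart_apply hy, hsymm hy]
    have h3 := congrArg (fun l ↦ l a) ((h1 b c).unique ((h1 c b).congr_of_eventuallyEq h2))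
    simpa using h3
  subst hR
  simp only [coordCurvature, _root_.add_apply, _root_.sub_apply, mul_apply_eq_comp]
  rw [hs2 a b c, hs2 b c a, hs2 c a b, hsymm hx b c, hsymm hx c a, hsymm hx a b]
  abel

end ConnectionCoordinates

/-! ### Vector fields in charts -/

section FieldsInCharts

variable {V : Type*} [NormedAddCommGroup V] [NormedSpace ℝ V] {H : Type*} [TopologicalSpace H]
  {I : ModelWithCorners ℝ V H} {N : Type*} [TopologicalSpace N] [ChartedSpace H N]

/-- A vector field in the preferred chart at `p`, as a function of the coordinates. -/
def fieldInChart (p : N) (X : Π q : N, TangentSpace I q) (r : V) : V :=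
  mfderiv I 𝓘(ℝ, V) (extChartAt I p) ((extChartAt I p).symm r) (X ((extChartAt I p).symm r))

theorem fieldInChart_apply {p q : N} (hq : q ∈ (chartAt H p).source)
    (X : Π q : N, TangentSpace I q) :
    fieldInChart p X (extChartAt I p q) = mfderiv I 𝓘(ℝ, V) (extChartAt I p) q (X q) := by
  have h := (extChartAt I p).left_inv (by rwa [extChartAt_source])
  rw [fieldInChart]
  have key (q' : N) (h : q' = q) : (mfderiv I 𝓘(ℝ, V) (extChartAt I p) q' (X q') : V) =
      mfderiv I 𝓘(ℝ, V) (extChartAt I p) q (X q) := by rw [h]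
  exact key _ h

theorem eventually_extChartAt_symm {p : N} {P : N → Prop} (h : ∀ᶠ q in 𝓝 p, P q) :
    ∀ᶠ r in 𝓝 (extChartAt I p p), P ((extChartAt I p).symm r) := by
  refine (continuousAt_extChartAt_symm p).eventually ?_
  rwa [extChartAt_to_inv]

variable [IsManifold I ∞ N]

/-- The vector field with given coordinates in the preferred chart at `p`. -/
def coordField (p : N) (f : N → V) (q : N) : TangentSpace I q :=
  (trivializationAt V (TangentSpace I : N → Type _) p).symmL ℝ q (f q)

theorem mfderiv_extChartAt_coordField {p q : N} (hq : q ∈ (chartAt H p).source) (f : N → V) :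
    mfderiv I 𝓘(ℝ, V) (extChartAt I p) q (coordField (I := I) p f q) = f q := by
  rw [← TangentBundle.continuousLinearMapAt_trivializationAt hq]
  exact (trivializationAt V (TangentSpace I : N → Type _) p).continuousLinearMapAt_symmL hq _

theorem trivializationAt_snd_eq_continuousLinearMapAt {p q : N}
    (hq : q ∈ (chartAt H p).source) (w : TangentSpace I q) :
    (trivializationAt V (TangentSpace I : N → Type _) p ⟨q, w⟩).2 =
      (trivializationAt V (TangentSpace I : N → Type _) p).continuousLinearMapAt ℝ q w := by
  rw [Trivialization.continuousLinearMapAt_apply, Trivialization.coe_linearMapAt_of_mem _ hq]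

theorem contMDiffAt_field_iff {p q : N} (hq : q ∈ (chartAt H p).source)
    {X : Π q : N, TangentSpace I q} :
    ContMDiffAt I I.tangent ∞ (fun q ↦ (⟨q, X q⟩ : TangentBundle I N)) q ↔
      ContMDiffAt I 𝓘(ℝ, V) ∞
        (fun q ↦ (mfderiv I 𝓘(ℝ, V) (extChartAt I p) q (X q) : V)) q := by
  refine ((trivializationAt V (TangentSpace I : N → Type _) p).contMDiffAt_section_iff hq).trans ?_
  refine Filter.EventuallyEq.contMDiffAt_iff ?_
  filter_upwards [(chartAt H p).open_source.mem_nhds hq] with q' hq'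
  exact (trivializationAt_snd_eq_continuousLinearMapAt hq' _).trans
    (congrArg (fun f ↦ f (X q')) (TangentBundle.continuousLinearMapAt_trivializationAt hq'))

theorem contMDiffAt_coordField {p : N} {f : N → V} (hf : ContMDiffAt I 𝓘(ℝ, V) ∞ f p) :
    ContMDiffAt I I.tangent ∞ (fun q ↦ (⟨q, coordField p f q⟩ : TangentBundle I N)) p := by
  rw [contMDiffAt_field_iff (mem_chart_source H p)]
  refine hf.congr_of_eventuallyEq ?_
  filter_upwards [(chartAt H p).open_source.mem_nhds (mem_chart_source H p)] with q hq
  exact mfderiv_extChartAt_coordField hq f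

theorem hasDerivAt_extChartAt_comp {p : N} {γ : ℝ → N} {t : ℝ}
    (hγ : MDifferentiableAt 𝓘(ℝ, ℝ) I γ t) (ht : γ t ∈ (chartAt H p).source) :
    HasDerivAt (fun t ↦ extChartAt I p (γ t))
      (mfderiv I 𝓘(ℝ, V) (extChartAt I p) (γ t) (mfderiv 𝓘(ℝ, ℝ) I γ t (1 : ℝ))) t := by
  let L : ℝ →L[ℝ] V :=
    (mfderiv I 𝓘(ℝ, V) (extChartAt I p) (γ t)).comp (mfderiv 𝓘(ℝ, ℝ) I γ t)
  have h : HasFDerivAt (fun t ↦ extChartAt I p (γ t)) L t := hasMFDerivAt_iff_hasFDerivAt.1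
    ((mdifferentiableAt_extChartAt ht).hasMFDerivAt.comp t hγ.hasMFDerivAt)
  exact h.hasDerivAt

variable [I.Boundaryless]

theorem differentiableAt_fieldInChart {p : N} {X : Π q : N, TangentSpace I q}
    (hX : ContMDiffAt I I.tangent ∞ (fun q ↦ (⟨q, X q⟩ : TangentBundle I N)) p) :
    DifferentiableAt ℝ (fieldInChart p X) (extChartAt I p p) := by
  rw [contMDiffAt_field_iff (mem_chart_source H p)] at hX
  have h1 : ContMDiffAt 𝓘(ℝ, V) I ∞ (extChartAt I p).symm (extChartAt I p p) :=
    (contMDiffOn_extChartAt_symm p).contMDiffAt (extChartAt_target_mem_nhds p)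
  have h2 : ContMDiffAt 𝓘(ℝ, V) 𝓘(ℝ, V) ∞ (fieldInChart p X) (extChartAt I p p) :=
    ContMDiffAt.comp _ (by rwa [extChartAt_to_inv]) h1
  exact (contMDiffAt_iff_contDiffAt.1 h2).differentiableAt (by simp)

/-- The Lie bracket at `p` is computed in the preferred chart at `p`. -/
theorem mlieBracket_eq_lieBracket_fieldInChart (p : N) (X Y : Π q : N, TangentSpace I q) :
    mfderiv I 𝓘(ℝ, V) (extChartAt I p) p (mlieBracket I X Y p) =
      lieBracket ℝ (fieldInChart p X) (fieldInChart p Y) (extChartAt I p p) := by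
  have h (X : Π q : N, TangentSpace I q) :
      mpullbackWithin 𝓘(ℝ, V) I (extChartAt I p).symm X (Set.range I) =ᶠ[𝓝 (extChartAt I p p)]
        fieldInChart p X := by
    filter_upwards [extChartAt_target_mem_nhds p] with r hr
    rw [mpullbackWithin_apply, ContinuousLinearMap.inverse_eq
      (mfderivWithin_extChartAt_symm_comp_mfderiv_extChartAt hr)
      (mfderiv_extChartAt_comp_mfderivWithin_extChartAt_symm hr)]
    rfl
  obtain ⟨e, he⟩ := isInvertible_mfderiv_extChartAt (I := I) (mem_extChartAt_source p)
  rw [← mlieBracketWithin_univ, mlieBracketWithin_apply, ← he, ContinuousLinearMap.inverse_equiv]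
  refine (e.apply_symm_apply _).trans ?_
  rw [Set.preimage_univ, I.range_eq_univ, Set.inter_univ]
  have hX := h X
  have hY := h Y
  rw [I.range_eq_univ] at hX hY
  exact (congrFun (lieBracketWithin_univ (𝕜 := ℝ) (E := V)) _).trans
    (hX.lieBracket_vectorField_eq hY)

/-- Tangency to a submanifold, by means of curves in the preferred chart at `p`. -/
theorem mem_tangentTo_iff_hasDerivAt {S : Set N} {p q : N} (hq : q ∈ (chartAt H p).source)
    (X : TangentSpace I q) :
    X ∈ tangentTo I S q ↔ ∃ c : ℝ → V,
      HasDerivAt c (mfderiv I 𝓘(ℝ, V) (extChartAt I p) q X) 0 ∧ c 0 = extChartAt I p q ∧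
        ∀ᶠ t in 𝓝 (0 : ℝ), c t ∈ (extChartAt I p).target ∧ (extChartAt I p).symm (c t) ∈ S := by
  have hs : q ∈ (extChartAt I p).source := by rwa [extChartAt_source]
  constructor
  · rintro ⟨γ, hγS, hγ, hX⟩
    obtain rfl : γ 0 = q := congrArg TotalSpace.proj hX
    obtain rfl : mfderiv 𝓘(ℝ, ℝ) I γ 0 (1 : ℝ) = X := TotalSpace.mk_inj.1 hX
    refine ⟨_, hasDerivAt_extChartAt_comp hγ hq, rfl, ?_⟩
    filter_upwards [hγS, hγ.continuousAt.eventually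
      ((isOpen_extChartAt_source p).mem_nhds hs)] with t h1 h2
    exact ⟨(extChartAt I p).map_source h2, by rwa [(extChartAt I p).left_inv h2]⟩
  · rintro ⟨c, hc, hc0, hcS⟩
    have htgt : (extChartAt I p).target ∈ 𝓝 (c 0) := by
      rw [hc0]
      exact (isOpen_extChartAt_target p).mem_nhds ((extChartAt I p).map_source hs)
    have hinv : (extChartAt I p).symm (c 0) = q := by
      rw [hc0, (extChartAt I p).left_inv hs]
    have hd : MDifferentiableAt 𝓘(ℝ, V) I (extChartAt I p).symm (c 0) :=
      ((contMDiffOn_extChartAt_symm (n := ∞) p).contMDiffAt htgt).mdifferentiableAt (by simp)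
    have hγ : MDifferentiableAt 𝓘(ℝ, ℝ) I (fun t ↦ (extChartAt I p).symm (c t)) 0 :=
      hd.comp (0 : ℝ) hc.differentiableAt.mdifferentiableAt
    subst hinv
    refine ⟨_, hcS.mono fun _ h ↦ h.2, hγ, congrArg (TotalSpace.mk _) ?_⟩
    have h1 := hasDerivAt_extChartAt_comp hγ hq
    have h2 : (fun t ↦ extChartAt I p ((extChartAt I p).symm (c t))) =ᶠ[𝓝 0] c :=
      hcS.mono fun t h ↦ (extChartAt I p).right_inv h.1
    have h3 := h2.hasDerivAt_iff.1 h1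
    obtain ⟨e, he⟩ := isInvertible_mfderiv_extChartAt (I := I) hs
    have h4 := h3.unique hc
    rw [← he] at h4
    exact e.injective h4

end FieldsInCharts

/-! ### The twistor bundle in coordinates -/

section TwistorCoordinates

variable {E : Type*} [NormedAddCommGroup E] [NormedSpace ℝ E]
  {M : Type*} [TopologicalSpace M] [ChartedSpace E M] [IsManifold 𝓘(ℝ, E) ∞ M]

theorem mem_twistorBundle_iff_inChart {Ω : SymplecticForm E M} {p q : EndTM E M}
    (hq : q.1 ∈ (chartAt E p.1).source) : q ∈ twistorBundle Ω ↔
      IsCompatible (inChart p.1 (formCoeff Ω p.1) (extChartAt (endModel E) p q).1)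
        (extChartAt (endModel E) p q).2 := by
  rw [mem_twistorBundle_iff Ω hq, extChartAt_endTM, inChart_apply hq]

/-- The vectors tangent to the twistor bundle are the velocities of curves of compatible complex
structures, in coordinates. -/
theorem mem_tangentTo_twistorBundle_iff [FiniteDimensional ℝ E] {Ω : SymplecticForm E M}
    {p q : EndTM E M} (hq : q.1 ∈ (chartAt E p.1).source) (X : TangentSpace (endModel E) q) :
    X ∈ tangentTo (endModel E) (twistorBundle Ω) q ↔
      ∃ c : ℝ → E × (E →L[ℝ] E), HasDerivAt c
        (mfderiv (endModel E) 𝓘(ℝ, E × (E →L[ℝ] E)) (extChartAt (endModel E) p) q X) 0 ∧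
        c 0 = extChartAt (endModel E) p q ∧
        ∀ᶠ t in 𝓝 (0 : ℝ), IsCompatible (inChart p.1 (formCoeff Ω p.1) (c t).1) (c t).2 := by
  have hsrc : q ∈ (chartAt (ModelProd E (E →L[ℝ] E)) p).source := mem_chartAt_endTM_source.2 hq
  rw [mem_tangentTo_iff_hasDerivAt hsrc]
  have htgt : (extChartAt (endModel E) p).target ∈ 𝓝 (extChartAt (endModel E) p q) :=
    (isOpen_extChartAt_target p).mem_nhds ((extChartAt (endModel E) p).map_source
      (by rwa [extChartAt_source]))
  refine exists_congr fun c ↦ and_congr_right fun hc ↦ and_congr_right fun hc0 ↦ ?_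
  have hct : ∀ᶠ t in 𝓝 (0 : ℝ), c t ∈ (extChartAt (endModel E) p).target :=
    hc.continuousAt.eventually (by rwa [hc0])
  refine eventually_congr ?_
  filter_upwards [hct] with t ht
  have h3 := (extChartAt (endModel E) p).map_target ht
  rw [extChartAt_source, mem_chartAt_endTM_source] at h3
  rw [mem_twistorBundle_iff_inChart h3, (extChartAt (endModel E) p).right_inv ht]
  exact and_iff_right ht

/-- The twistor structure in the preferred chart at `p`. -/
theorem mfderiv_twistorStructure [FiniteDimensional ℝ E] (D : LinearConnection E M)
    {p q : EndTM E M} (hq : q.1 ∈ (chartAt E p.1).source) (X : TangentSpace (endModel E) q) :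
    mfderiv (endModel E) 𝓘(ℝ, E × (E →L[ℝ] E)) (extChartAt (endModel E) p) q
        (twistorStructure D q X) =
      modelStructure (connCoeff D p.1 q.1) (endCoord p.1 q)
        (mfderiv (endModel E) 𝓘(ℝ, E × (E →L[ℝ] E)) (extChartAt (endModel E) p) q X) := by
  have h3 : baseVec (twistorStructure D q X) = q.2 (baseVec X) := rfl
  rw [mfderiv_extChartAt_endTM hq, mfderiv_extChartAt_endTM hq, mfderiv_endTM_proj,
    mfderiv_endTM_proj, h3, ← endCoord_toCoord hq]
  exact Prod.ext rfl (eq_sub_of_add_eq (twistorStructure_coord D hq X))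

/-- The vectors which are horizontal for an almost symplectic connection are tangent to the twistor
bundle. -/
theorem mem_tangentTo_of_horizontal [T2Space M] [FiniteDimensional ℝ E] {Ω : SymplecticForm E M}
    {D : LinearConnection E M} (hD : IsAlmostSymplectic Ω D) {p q : EndTM E M}
    (hq : q.1 ∈ (chartAt E p.1).source) (hqS : q ∈ twistorBundle Ω)
    {X : TangentSpace (endModel E) q} {v : E}
    (hX : mfderiv (endModel E) 𝓘(ℝ, E × (E →L[ℝ] E)) (extChartAt (endModel E) p) q X =
      (v, -(connCoeff D p.1 q.1 v * endCoord p.1 q - endCoord p.1 q * connCoeff D p.1 q.1 v))) :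
    X ∈ tangentTo (endModel E) (twistorBundle Ω) q := by
  have : CompleteSpace E := FiniteDimensional.complete ℝ E
  rw [mem_tangentTo_twistorBundle_iff hq, hX, extChartAt_endTM]
  have hΓ : ContDiffAt ℝ 1 (inChart p.1 (connCoeff D p.1)) (extChartAt 𝓘(ℝ, E) p.1 q.1) :=
    (contDiffAt_inChart hq (contMDiffAt_connCoeff hD.smooth hq)).of_le (by simp)
  have h := exists_horizontal_curve hΓ (eventually_fderiv_formCoeff hD hq)
    ((mem_twistorBundle_iff_inChart hq).1 hqS) v
  rwa [inChart_apply hq] at h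

end TwistorCoordinates

/-! ### The Nijenhuis tensor of the twistor bundle -/

section TwistorNijenhuis

variable {E : Type*} [NormedAddCommGroup E] [NormedSpace ℝ E]
  {M : Type*} [TopologicalSpace M] [ChartedSpace E M] [IsManifold 𝓘(ℝ, E) ∞ M]
  {Ω : SymplecticForm E M} {D : LinearConnection E M}

theorem mlieBracket_endTM (p : EndTM E M) (X Y : Π q : EndTM E M, TangentSpace (endModel E) q) :
    mlieBracket (endModel E) X Y p = lieBracket ℝ (fieldInChart p X) (fieldInChart p Y)
      (extChartAt (endModel E) p p) :=
  (mfderiv_extChartAt_endTM_self p _).symm.trans (mlieBracket_eq_lieBracket_fieldInChart p X Y)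

theorem fieldInChart_self (p : EndTM E M) (X : Π q : EndTM E M, TangentSpace (endModel E) q) :
    fieldInChart p X (extChartAt (endModel E) p p) = X p :=
  (fieldInChart_apply (mem_chart_source _ p) X).trans (mfderiv_extChartAt_endTM_self p _)

theorem endCoord_mk_self (x : M) (j : E →L[ℝ] E) :
    endCoord x (⟨x, j⟩ : EndTM E M) = j := by
  ext w
  rw [endCoord_apply, toCoord_self, ofCoord_self]
  rfl

theorem modelStructure_horizontal (G : E →L[ℝ] E →L[ℝ] E) (j : E →L[ℝ] E) (v : E) :
    modelStructure G j (v, -(G v * j - j * G v)) = (j v, -(G (j v) * j - j * G (j v))) := by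
  simp [modelStructure]

theorem eventually_mem_source_endTM (p : EndTM E M) :
    ∀ᶠ q : EndTM E M in 𝓝 p, q.1 ∈ (chartAt E p.1).source :=
  (FiberBundle.continuous_proj (E →L[ℝ] E) (fun x : M ↦ TangentSpace 𝓘(ℝ, E) x →L[ℝ]
    TangentSpace 𝓘(ℝ, E) x)).continuousAt.preimage_mem_nhds
    ((chartAt E p.1).open_source.mem_nhds (mem_chart_source E p.1))

variable [FiniteDimensional ℝ E]

theorem twistorStructure_self (D : LinearConnection E M) (p : EndTM E M)
    (X : TangentSpace (endModel E) p) :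
    twistorStructure D p X = modelStructure (connCoeff D p.1 p.1) (endCoord p.1 p) X := by
  have h := mfderiv_twistorStructure D (mem_chart_source E p.1) X
  rwa [mfderiv_extChartAt_endTM_self, mfderiv_extChartAt_endTM_self] at h

/-- The relation between the extensions of `X` and of `J^∇ X`, in coordinates. -/
theorem eventually_fieldInChart_eq {p : EndTM E M}
    {X X' : Π q : EndTM E M, TangentSpace (endModel E) q}
    (h : ∀ᶠ q in 𝓝 p, q ∈ twistorBundle Ω → X' q = twistorStructure D q (X q)) :
    ∀ᶠ r in 𝓝 (extChartAt (endModel E) p p),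
      r ∈ {r : E × (E →L[ℝ] E) | IsCompatible (inChart p.1 (formCoeff Ω p.1) r.1) r.2} →
        fieldInChart p X' r =
          modelStructure (inChart p.1 (connCoeff D p.1) r.1) r.2 (fieldInChart p X r) := by
  filter_upwards [eventually_extChartAt_symm (I := endModel E) h,
    extChartAt_target_mem_nhds (I := endModel E) p] with r hr hrt hrS
  obtain ⟨q, hq, rfl⟩ : ∃ q ∈ (extChartAt (endModel E) p).source,
      extChartAt (endModel E) p q = r :=
    ⟨_, (extChartAt (endModel E) p).map_target hrt, (extChartAt (endModel E) p).right_inv hrt⟩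
  rw [(extChartAt (endModel E) p).left_inv hq] at hr
  rw [extChartAt_source] at hq
  have hq' := mem_chartAt_endTM_source.1 hq
  rw [fieldInChart_apply hq, fieldInChart_apply hq,
    hr ((mem_twistorBundle_iff_inChart hq').2 hrS), mfderiv_twistorStructure D hq',
    extChartAt_endTM, inChart_apply hq']

/-- The value at `p` of the Nijenhuis tensor of the twistor structure, in terms of the torsion and
the curvature. -/
theorem nijenhuis_twistorStructure [T2Space M] (hD : IsAlmostSymplectic Ω D) {p : EndTM E M}
    (hp : p ∈ twistorBundle Ω) {X Y X' Y' : Π q : EndTM E M, TangentSpace (endModel E) q}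
    (hX : IsTangentFieldAt (endModel E) (twistorBundle Ω) p X)
    (hY : IsTangentFieldAt (endModel E) (twistorBundle Ω) p Y)
    (hX' : IsTangentFieldAt (endModel E) (twistorBundle Ω) p X')
    (hY' : IsTangentFieldAt (endModel E) (twistorBundle Ω) p Y')
    (hXX' : ∀ᶠ q in 𝓝 p, q ∈ twistorBundle Ω → X' q = twistorStructure D q (X q))
    (hYY' : ∀ᶠ q in 𝓝 p, q ∈ twistorBundle Ω → Y' q = twistorStructure D q (Y q))
    {N : E × (E →L[ℝ] E)}
    (hN : N = mlieBracket (endModel E) X' Y' p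
      - twistorStructure D p (mlieBracket (endModel E) X' Y p)
      - twistorStructure D p (mlieBracket (endModel E) X Y' p) - mlieBracket (endModel E) X Y p)
    {G : E →L[ℝ] E →L[ℝ] E} (hG : G = connCoeff D p.1 p.1)
    {j : E →L[ℝ] E} (hj : j = endCoord p.1 p)
    {T : E → E → E} (hT : T = coordTorsion G)
    {R : E → E → E →L[ℝ] E} (hR : R = coordCurvature G
      (fderiv ℝ (inChart p.1 (connCoeff D p.1)) (extChartAt 𝓘(ℝ, E) p.1 p.1)))
    {a b : E} (ha : a = (X p).1) (hb : b = (Y p).1) :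
    N.1 = -(T (j a) (j b) - j (T (j a) b) - j (T a (j b)) - T a b) ∧
    N.2 + (G N.1 * j - j * G N.1) =
      -((R (j a) (j b) * j - j * R (j a) (j b)) - j * (R (j a) b * j - j * R (j a) b)
        - j * (R a (j b) * j - j * R a (j b)) - (R a b * j - j * R a b)) := by
  have hsrc := mem_chart_source E p.1
  have hΓ : HasFDerivAt (inChart p.1 (connCoeff D p.1)) _ (extChartAt 𝓘(ℝ, E) p.1 p.1) :=
    ((contDiffAt_inChart hsrc (contMDiffAt_connCoeff hD.smooth hsrc)).differentiableAt
      (by simp)).hasFDerivAt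
  have hc := (mem_twistorBundle_iff Ω hsrc).1 hp
  have hG' : inChart p.1 (connCoeff D p.1) (extChartAt 𝓘(ℝ, E) p.1 p.1) = G :=
    (inChart_apply hsrc _).trans hG.symm
  have hcurve {W : Π q : EndTM E M, TangentSpace (endModel E) q}
      (hW : IsTangentFieldAt (endModel E) (twistorBundle Ω) p W) :
      ∃ c : ℝ → E × (E →L[ℝ] E),
        HasDerivAt c (fieldInChart p W (extChartAt (endModel E) p p)) 0 ∧
        c 0 = extChartAt (endModel E) p p ∧
        ∀ᶠ t in 𝓝 (0 : ℝ), IsCompatible (inChart p.1 (formCoeff Ω p.1) (c t).1) (c t).2 := by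
    have h := (mem_tangentTo_twistorBundle_iff hsrc _).1 (hW.2.self_of_nhds hp)
    rw [mfderiv_extChartAt_endTM_self] at h
    have h1 := fieldInChart_self p W
    exact h1 ▸ h
  have h := nijenhuis_coord (p := extChartAt (endModel E) p p) (N := N) (T := T) (R := R) (a := a)
    (b := b) hΓ
    (ContinuousLinearMap.ext hc.sq)
    (differentiableAt_fieldInChart hX.1) (differentiableAt_fieldInChart hY.1)
    (differentiableAt_fieldInChart hX'.1) (differentiableAt_fieldInChart hY'.1)
    {r : E × (E →L[ℝ] E) | IsCompatible (inChart p.1 (formCoeff Ω p.1) r.1) r.2} ?_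
    (eventually_fieldInChart_eq hXX') (eventually_fieldInChart_eq hYY') ?_ ?_ ?_ ?_ ?_
  · rw [extChartAt_endTM, hG', ← hj] at h
    exact h
  · rintro W (rfl | rfl | rfl | rfl)
    · exact hcurve hX
    · exact hcurve hY
    · exact hcurve hX'
    · exact hcurve hY'
  · rw [hN, twistorStructure_self, twistorStructure_self, mlieBracket_endTM, mlieBracket_endTM,
      mlieBracket_endTM, mlieBracket_endTM, extChartAt_endTM, hG', hG]
    rfl
  · rw [hT, extChartAt_endTM, hG']
  · rw [hR, extChartAt_endTM, hG']
  · rw [ha, fieldInChart_self]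
  · rw [hb, fieldInChart_self]

/-- The horizontal field on `End(TM)`, near `p`, which projects to the vectors with the coordinates
`f` on `M`. -/
def horizontalField (D : LinearConnection E M) (p : EndTM E M) (f : EndTM E M → E) :
    Π q : EndTM E M, TangentSpace (endModel E) q :=
  coordField p fun q ↦ (f q,
    -(connCoeff D p.1 q.1 (f q) * endCoord p.1 q - endCoord p.1 q * connCoeff D p.1 q.1 (f q)))

theorem mfderiv_horizontalField {p q : EndTM E M} (hq : q.1 ∈ (chartAt E p.1).source)
    (f : EndTM E M → E) :
    mfderiv (endModel E) 𝓘(ℝ, E × (E →L[ℝ] E)) (extChartAt (endModel E) p) q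
        (horizontalField D p f q) = (f q, -(connCoeff D p.1 q.1 (f q) * endCoord p.1 q -
          endCoord p.1 q * connCoeff D p.1 q.1 (f q))) :=
  mfderiv_extChartAt_coordField (mem_chartAt_endTM_source.2 hq) _

theorem horizontalField_self (p : EndTM E M) (f : EndTM E M → E) :
    horizontalField D p f p = (f p, -(connCoeff D p.1 p.1 (f p) * endCoord p.1 p -
      endCoord p.1 p * connCoeff D p.1 p.1 (f p))) :=
  (mfderiv_extChartAt_endTM_self p _).symm.trans
    (mfderiv_horizontalField (mem_chart_source E p.1) f)

theorem isTangentFieldAt_horizontalField [T2Space M] (hD : IsAlmostSymplectic Ω D) {p : EndTM E M}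
    {f : EndTM E M → E} (hf : ContMDiffAt (endModel E) 𝓘(ℝ, E) ∞ f p) :
    IsTangentFieldAt (endModel E) (twistorBundle Ω) p (horizontalField D p f) := by
  constructor
  · refine contMDiffAt_coordField (hf.prodMk_space ?_)
    have h1 : ContMDiffAt (endModel E) 𝓘(ℝ, E →L[ℝ] E →L[ℝ] E) ∞
        (fun q : EndTM E M ↦ connCoeff D p.1 q.1) p :=
      (contMDiffAt_connCoeff hD.smooth (mem_chart_source E p.1)).comp p (contMDiffAt_proj _)
    have h2 := h1.clm_apply hf
    have h3 := contMDiffAt_endCoord (mem_chart_source E p.1)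
    exact ((h2.clm_comp h3).sub (h3.clm_comp h2)).neg
  · filter_upwards [eventually_mem_source_endTM p] with q hq hqS
    exact mem_tangentTo_of_horizontal hD hq hqS (mfderiv_horizontalField hq f)

/-- The twistor structure maps horizontal fields to horizontal fields. -/
theorem twistorStructure_horizontalField {p q : EndTM E M} (hq : q.1 ∈ (chartAt E p.1).source)
    (f : EndTM E M → E) : horizontalField D p (fun q ↦ endCoord p.1 q (f q)) q =
      twistorStructure D q (horizontalField D p f q) := by
  have hs : q ∈ (extChartAt (endModel E) p).source := by
    rw [extChartAt_source]
    exact mem_chartAt_endTM_source.2 hq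
  obtain ⟨e, he⟩ := isInvertible_mfderiv_extChartAt (I := endModel E) hs
  refine e.injective ?_
  have h := (mfderiv_horizontalField (D := D) hq (fun q ↦ endCoord p.1 q (f q))).trans
    (((mfderiv_twistorStructure D hq _).trans ((congrArg _ (mfderiv_horizontalField hq f)).trans
      (modelStructure_horizontal _ _ _))).symm)
  rw [← he] at h
  exact h

/-- The twistor structure of an almost symplectic connection is integrable if and only if the
torsion and the curvature have vanishing Nijenhuis components for all compatible complex structures
of the tangent spaces. -/
theorem isIntegrable_twistorStructure_iff [T2Space M] (hD : IsAlmostSymplectic Ω D) :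
    IsIntegrableAlmostComplex (endModel E) (twistorBundle Ω) (twistorStructure D) ↔
      ∀ (x : M) (T : E → E → E) (R : E → E → E →L[ℝ] E), T = coordTorsion (connCoeff D x x) →
        R = coordCurvature (connCoeff D x x)
          (fderiv ℝ (inChart x (connCoeff D x)) (extChartAt 𝓘(ℝ, E) x x)) →
        ∀ j, IsCompatible (formCoeff Ω x x) j → ∀ a b,
          T (j a) (j b) - j (T (j a) b) - j (T a (j b)) - T a b = 0 ∧
          (R (j a) (j b) * j - j * R (j a) (j b)) - j * (R (j a) b * j - j * R (j a) b)
            - j * (R a (j b) * j - j * R a (j b)) - (R a b * j - j * R a b) = 0 := by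
  constructor
  · -- the fields with horizontal lifts of constant coordinates `a` and `b`
    intro h x T R hT hR j hj a b
    set p : EndTM E M := ⟨x, j⟩
    have hp : p ∈ twistorBundle Ω := by
      rw [mem_twistorBundle_iff Ω (mem_chart_source E x), endCoord_mk_self]
      exact hj
    have hc (a : E) : ContMDiffAt (endModel E) 𝓘(ℝ, E) ∞ (fun _ : EndTM E M ↦ a) p :=
      contMDiffAt_const
    have hjc (a : E) : ContMDiffAt (endModel E) 𝓘(ℝ, E) ∞ (fun q ↦ endCoord p.1 q a) p :=
      (contMDiffAt_endCoord (mem_chart_source E p.1)).clm_apply (hc a)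
    have ht (a : E) : ∀ᶠ q in 𝓝 p, q ∈ twistorBundle Ω →
        horizontalField D p (fun q ↦ endCoord p.1 q a) q =
          twistorStructure D q (horizontalField D p (fun _ ↦ a) q) := by
      filter_upwards [eventually_mem_source_endTM p] with q hq _
      exact twistorStructure_horizontalField hq _
    have hs (a : E) : a = (horizontalField D p (fun _ ↦ a) p).1 :=
      (congrArg Prod.fst (horizontalField_self (D := D) p (fun _ ↦ a))).symm
    have h1 := h p hp _ _ _ _ (isTangentFieldAt_horizontalField hD (hc a))
      (isTangentFieldAt_horizontalField hD (hc b))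
      (isTangentFieldAt_horizontalField hD (hjc a))
      (isTangentFieldAt_horizontalField hD (hjc b)) (ht a) (ht b)
    have h2 := nijenhuis_twistorStructure (N := 0) hD hp
      (isTangentFieldAt_horizontalField hD (hc a))
      (isTangentFieldAt_horizontalField hD (hc b))
      (isTangentFieldAt_horizontalField hD (hjc a))
      (isTangentFieldAt_horizontalField hD (hjc b)) (ht a) (ht b) h1.symm rfl
      (endCoord_mk_self x j).symm hT hR (hs a) (hs b)
    refine ⟨neg_eq_zero.1 h2.1.symm, neg_eq_zero.1 (h2.2.symm.trans ?_)⟩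
    simp
  · intro h p hp X Y X' Y' hX hY hX' hY' hXX' hYY'
    obtain ⟨h1, h2⟩ := nijenhuis_twistorStructure hD hp hX hY hX' hY' hXX' hYY' rfl rfl rfl rfl rfl
      rfl rfl
    obtain ⟨h3, h4⟩ := h p.1 _ _ rfl rfl _ ((mem_twistorBundle_iff Ω (mem_chart_source E p.1)).1 hp)
      (X p).1 (Y p).1
    rw [h3, neg_zero] at h1
    rw [h4, neg_zero, h1] at h2
    exact Prod.ext h1 (by simpa using h2 : _ = (0 : E →L[ℝ] E))

end TwistorNijenhuis

/-! ### Torsion-free connections with an integrable twistor structure -/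

section RicciType

variable {E : Type*} [NormedAddCommGroup E] [NormedSpace ℝ E]
  {M : Type*} [TopologicalSpace M] [ChartedSpace E M] [IsManifold 𝓘(ℝ, E) ∞ M]
  {Ω : SymplecticForm E M} {D D' : LinearConnection E M}

theorem coordCurvature_swap (G : E →L[ℝ] E →L[ℝ] E) (G' : E →L[ℝ] E →L[ℝ] E →L[ℝ] E) (a b : E) :
    coordCurvature G G' a b = -coordCurvature G G' b a := by
  unfold coordCurvature
  noncomm_ring

theorem coordCurvature_add_left (G : E →L[ℝ] E →L[ℝ] E) (G' : E →L[ℝ] E →L[ℝ] E →L[ℝ] E)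
    (a b c : E) :
    coordCurvature G G' (a + b) c = coordCurvature G G' a c + coordCurvature G G' b c := by
  have h1 : G' (a + b) c = G' a c + G' b c := by rw [G'.map_add a b]; rfl
  have h2 : G' c (a + b) = G' c a + G' c b := (G' c).map_add a b
  have h3 : G (a + b) = G a + G b := G.map_add a b
  unfold coordCurvature
  rw [h1, h2, h3]
  noncomm_ring

theorem coordCurvature_smul_left (G : E →L[ℝ] E →L[ℝ] E) (G' : E →L[ℝ] E →L[ℝ] E →L[ℝ] E)
    (r : ℝ) (a b : E) : coordCurvature G G' (r • a) b = r • coordCurvature G G' a b := by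
  have h1 : G' (r • a) b = r • G' a b := by rw [G'.map_smul r a]; rfl
  have h2 : G' b (r • a) = r • G' b a := (G' b).map_smul r a
  have h3 : G (r • a) = r • G a := G.map_smul r a
  unfold coordCurvature
  rw [h1, h2, h3, smul_mul_assoc, mul_smul_comm, smul_add, smul_sub, smul_sub]

/-- The curvature in coordinates, as a bilinear map. -/
def coordCurvatureₗ (G : E →L[ℝ] E →L[ℝ] E) (G' : E →L[ℝ] E →L[ℝ] E →L[ℝ] E) :
    E →ₗ[ℝ] E →ₗ[ℝ] E →L[ℝ] E :=
  LinearMap.mk₂ ℝ (coordCurvature G G') (coordCurvature_add_left G G')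
    (coordCurvature_smul_left G G')
    (fun a b c ↦ by
      rw [coordCurvature_swap, coordCurvature_add_left, coordCurvature_swap G G' a b,
        coordCurvature_swap G G' a c]
      exact neg_add _ _)
    (fun r a b ↦ by
      rw [coordCurvature_swap, coordCurvature_smul_left, coordCurvature_swap G G' a b]
      exact (smul_neg _ _).symm)

theorem formCoeff_self (x : M) (u v : TangentSpace 𝓘(ℝ, E) x) :
    formCoeff Ω x x u v = Ω.toFun x u v := by
  have h := formCoeff_toCoord Ω (mem_chart_source E x) u v
  rwa [toCoord_self, toCoord_self] at h

variable [FiniteDimensional ℝ E]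

theorem LinearConnection.torsion_self (D : LinearConnection E M) (x : M)
    (u v : TangentSpace 𝓘(ℝ, E) x) : D.torsion x u v = coordTorsion (connCoeff D x x) u v := by
  have h := D.torsion_coord (mem_chart_source E x) u v
  have hu : ofCoord (E := E) x x u = u := ofCoord_self (E := E) x u
  have hv : ofCoord (E := E) x x v = v := ofCoord_self (E := E) x v
  exact (congrArg₂ (fun a b ↦ CovariantDerivative.torsion D x a b) hu hv).symm.trans
    (h.trans (ofCoord_self x _))

theorem LinearConnection.torsion_eq_zero_iff (D : LinearConnection E M) :
    D.torsion = 0 ↔ ∀ x, coordTorsion (connCoeff D x x) = 0 := by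
  constructor
  · intro h x
    funext u v
    rw [← D.torsion_self x u v, h]
    rfl
  · intro h
    funext x
    refine ContinuousLinearMap.ext fun u ↦ ContinuousLinearMap.ext fun v ↦ ?_
    rw [D.torsion_self, h]
    rfl

theorem curvatureTensor_self [T2Space M] (hD : D.ContMDiffCovariantDerivative ∞) (x : M)
    {R : E → E → E →L[ℝ] E} (hR : R = coordCurvature (connCoeff D x x)
      (fderiv ℝ (inChart x (connCoeff D x)) (extChartAt 𝓘(ℝ, E) x x)))
    (u v w : TangentSpace 𝓘(ℝ, E) x) : curvatureTensor D x u v w = R u v w := by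
  rw [hR, curvatureTensor_eq hD, ofCoord_self, toCoord_self, toCoord_self, toCoord_self]

theorem weylPart_eq [T2Space M] (hD : D.ContMDiffCovariantDerivative ∞) (x : M)
    {R : E → E → E →L[ℝ] E} (hR : R = coordCurvature (connCoeff D x x)
      (fderiv ℝ (inChart x (connCoeff D x)) (extChartAt 𝓘(ℝ, E) x x)))
    (X Y Z T : TangentSpace 𝓘(ℝ, E) x) :
    weylPart Ω D x X Y Z T = formCoeff Ω x x (R X Y Z) T -
      -(1 / ((Module.finrank ℝ E : ℝ) + 2)) *
        (2 * formCoeff Ω x x X Y * ricciTensor D x Z T + formCoeff Ω x x X Z * ricciTensor D x Y T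
        + formCoeff Ω x x X T * ricciTensor D x Y Z - formCoeff Ω x x Y Z * ricciTensor D x X T
        - formCoeff Ω x x Y T * ricciTensor D x X Z) := by
  have h := formCoeff_self (Ω := Ω) x
  unfold weylPart ricciPart
  rw [curvatureTensor_self hD x hR, ← h X Y, ← h X Z, ← h X T, ← h Y Z, ← h Y T]
  exact congrArg (fun c ↦ c - _) (h (R X Y Z) T).symm

/-- The twistor structure of a symplectic connection is integrable if and only if the connection is
of Ricci-type. -/
theorem isIntegrable_twistorStructure_iff_isRicciType [T2Space M]
    (hD : IsSymplecticConnection Ω D) :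
    IsIntegrableAlmostComplex (endModel E) (twistorBundle Ω) (twistorStructure D) ↔
      IsRicciType Ω D := by
  rw [isIntegrable_twistorStructure_iff hD.toIsAlmostSymplectic]
  have htor := D.torsion_eq_zero_iff.1 hD.torsion_eq_zero
  constructor
  · refine fun h ↦ ⟨hD, fun x X Y Z T ↦ ?_⟩
    set R := coordCurvature (connCoeff D x x)
      (fderiv ℝ (inChart x (connCoeff D x)) (extChartAt 𝓘(ℝ, E) x x)) with hR
    have key := curvature_eq_of_nijenhuis (σ := formCoeff Ω x x) (R := coordCurvatureₗ _ _)
      (r := ricciTensor D x) (formCoeff_self_apply Ω x x)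
      (formCoeff_nondegenerate Ω (mem_chart_source E x))
      (coordCurvature_swap _ _)
      (formCoeff_curvature_skew hD.toIsAlmostSymplectic x)
      (coordCurvature_bianchi hD.smooth hD.torsion_eq_zero x hR)
      (fun j hj a b ↦ (h x _ R rfl hR j hj a b).2)
      (fun u v f hf ↦ by
        refine Eq.trans ?_ (LinearMap.trace_eq_matrix_trace ℝ (Module.finBasis ℝ E) f).symm
        refine Finset.sum_congr rfl fun i _ ↦ ?_
        rw [Matrix.diag_apply, LinearMap.toMatrix_apply, hf]
        exact congrArg ((Module.finBasis ℝ E).coord i)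
          (curvatureTensor_self hD.smooth x hR _ _ _)) X Y Z T
    rw [weylPart_eq hD.smooth x hR]
    exact sub_eq_zero.2 key
  · rintro hRic x T R rfl hR j hj a b
    constructor
    · rw [htor]
      simp
    · refine nijenhuis_commutator_eq_zero (formCoeff_nondegenerate Ω (mem_chart_source E x)) hj
        (r := ricciTensor D x) (k := -(1 / ((Module.finrank ℝ E : ℝ) + 2))) (fun X Y Z T ↦ ?_) a b
      have h := hRic.weylPart_eq_zero x X Y Z T
      exact sub_eq_zero.1 ((weylPart_eq hD.smooth x hR X Y Z T).symm.trans h)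

/-! ### Connections with the same twistor structure -/

/-- Two connections have the same twistor structure if and only if the commutators of their
difference tensor with the compatible complex structures `j` are complex linear in the direction. -/
theorem sameTwistorStructure_iff [T2Space M] (hD : IsAlmostSymplectic Ω D) :
    SameTwistorStructure Ω D' D ↔ ∀ x, ∀ j, IsCompatible (formCoeff Ω x x) j →
      ∀ B : E →L[ℝ] E →L[ℝ] E, B = connCoeff D' x x - connCoeff D x x →
        ∀ a, j * (B a * j - j * B a) = B (j a) * j - j * B (j a) := by
  have key (G G' : E →L[ℝ] E →L[ℝ] E) (j : E →L[ℝ] E) (Z : E × (E →L[ℝ] E)) :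
      modelStructure G' j Z = modelStructure G j Z ↔
        j * ((G' - G) Z.1 * j - j * (G' - G) Z.1) =
          (G' - G) (j Z.1) * j - j * (G' - G) (j Z.1) := by
    simp only [modelStructure, Prod.mk.injEq, true_and, _root_.sub_apply]
    rw [← sub_eq_zero, ← sub_eq_zero (a := j * _)]
    refine Eq.congr ?_ rfl
    noncomm_ring
  constructor
  · rintro h x j hj B rfl a
    have hp : (⟨x, j⟩ : EndTM E M) ∈ twistorBundle Ω := by
      rw [mem_twistorBundle_iff Ω (mem_chart_source E x), endCoord_mk_self]
      exact hj
    have ht := (isTangentFieldAt_horizontalField hD (p := (⟨x, j⟩ : EndTM E M))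
      (f := fun _ ↦ a) contMDiffAt_const).2.self_of_nhds hp
    have h1 := h _ hp _ ht
    rw [twistorStructure_self, twistorStructure_self, endCoord_mk_self] at h1
    have h2 := (key _ _ _ _).1 h1
    rwa [horizontalField_self] at h2
  · intro h p hp X _
    rw [twistorStructure_self, twistorStructure_self]
    refine (key _ _ _ _).2 ?_
    exact h p.1 _ ((mem_twistorBundle_iff Ω (mem_chart_source E p.1)).1 hp) _ rfl X.1

theorem sameConnection_of_connCoeff_eq (h : ∀ x, connCoeff D x x = connCoeff D' x x) :
    SameConnection D D' := by
  intro x Y hY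
  refine ContinuousLinearMap.ext fun v ↦ ?_
  rw [D.apply_eq (mem_chart_source E x) hY, D'.apply_eq (mem_chart_source E x) hY, h]

/-- A symplectic connection is determined by its twistor structure. -/
theorem sameConnection_of_sameTwistorStructure [T2Space M] (hD : IsSymplecticConnection Ω D)
    (hD' : IsSymplecticConnection Ω D') (h : SameTwistorStructure Ω D' D) :
    SameConnection D D' := by
  refine sameConnection_of_connCoeff_eq fun x ↦ ?_
  have hx := mem_chart_source E x
  rw [sameTwistorStructure_iff hD.toIsAlmostSymplectic] at h
  have hs (D : LinearConnection E M) (hD : IsSymplecticConnection Ω D) (u v : E) :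
      connCoeff D x x u v = connCoeff D x x v u :=
    sub_eq_zero.1 (congrFun (congrFun (D.torsion_eq_zero_iff.1 hD.torsion_eq_zero x) u) v)
  refine (sub_eq_zero.1 (eq_zero_of_commutator_eq (formCoeff_self_apply Ω x x)
    (formCoeff_nondegenerate Ω hx) (fun u v ↦ ?_) (fun a u v ↦ ?_)
    fun j hj ↦ h x j hj _ rfl)).symm
  · simp only [_root_.sub_apply, hs D hD u v, hs D' hD' u v]
  · have h1 := fderiv_formCoeff hD.toIsAlmostSymplectic hx a u v
    have h2 := fderiv_formCoeff hD'.toIsAlmostSymplectic hx a u v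
    simp only [_root_.sub_apply, map_sub]
    linarith

end RicciType

/-! ### Elimination of the torsion -/

section Torsion

variable {E : Type*} [NormedAddCommGroup E] [NormedSpace ℝ E]

/-- The bilinear map `(w, u) ↦ -(σ(s, w) u + σ(u, w) s)`, with values in the symplectic Lie algebra
as an operator on `w`. -/
def torsionCorrection (σ : E →L[ℝ] E →L[ℝ] ℝ) (s : E) : E →L[ℝ] E →L[ℝ] E :=
  -((ContinuousLinearMap.smulRightL ℝ E E).flip s ∘L σ.flip +
    (σ s).smulRight (ContinuousLinearMap.id ℝ E))

theorem torsionCorrection_apply (σ : E →L[ℝ] E →L[ℝ] ℝ) (s w u : E) :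
    torsionCorrection σ s w u = -(σ s w • u + σ u w • s) := by
  simp [torsionCorrection, add_comm]

/-- The correction term does not change the twistor structure. -/
theorem commutator_torsionCorrection {σ : E →L[ℝ] E →L[ℝ] ℝ} {j : E →L[ℝ] E} (hj : IsCompatible σ j)
    (s : E) {B : E →L[ℝ] E →L[ℝ] E} (hB : ∀ u w, B u w = torsionCorrection σ s w u) (a : E) :
    j * (B a * j - j * B a) = B (j a) * j - j * B (j a) := by
  ext w
  have h (u v) : σ (j u) v = -σ u (j v) := eq_neg_of_add_eq_zero_left (hj.skew u v)
  simp only [mul_apply_eq_comp, _root_.sub_apply, hB, torsionCorrection_apply,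
    map_neg, map_sub, map_add, map_smul, hj.sq, h]
  module

variable {M : Type*} [TopologicalSpace M] [ChartedSpace E M]

set_option synthInstance.maxHeartbeats 200000 in
theorem contMDiffAt_clm_flip {Γ : M → E →L[ℝ] E →L[ℝ] E} {y : M}
    (hΓ : ContMDiffAt 𝓘(ℝ, E) 𝓘(ℝ, E →L[ℝ] E →L[ℝ] E) ∞ Γ y) :
    ContMDiffAt 𝓘(ℝ, E) 𝓘(ℝ, E →L[ℝ] E →L[ℝ] E) ∞ (fun y ↦ (Γ y).flip) y := by
  have h : ContDiff ℝ ∞ (ContinuousLinearMap.flipₗᵢ ℝ E E E) :=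
    (ContinuousLinearMap.flipₗᵢ ℝ E E E).contDiff
  exact h.contMDiff.contMDiffAt.comp y hΓ

theorem contMDiffAt_smulRight {l : M → E →L[ℝ] ℝ} {f : M → E} {y : M}
    (hl : ContMDiffAt 𝓘(ℝ, E) 𝓘(ℝ, E →L[ℝ] ℝ) ∞ l y) (hf : ContMDiffAt 𝓘(ℝ, E) 𝓘(ℝ, E) ∞ f y) :
    ContMDiffAt 𝓘(ℝ, E) 𝓘(ℝ, E →L[ℝ] E) ∞ (fun y ↦ (l y).smulRight (f y)) y :=
  (isBoundedBilinearMap_smulRight (𝕜 := ℝ) (E := E) (F := E)).contDiff.contMDiff.contMDiffAt.comp y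
    (hl.prodMk_space hf)

/-- The trace `u ↦ Tr (v ↦ T(u, v))` of the torsion of the connection with coefficients `G`. -/
def torsionTrace [FiniteDimensional ℝ E] (G : E →L[ℝ] E →L[ℝ] E) : E →L[ℝ] ℝ :=
  ∑ i, (LinearMap.toContinuousLinearMap ((Module.finBasis ℝ E).coord i)).comp
    (G.flip (Module.finBasis ℝ E i) - G (Module.finBasis ℝ E i))

theorem torsionTrace_eq [FiniteDimensional ℝ E] {σ : E →L[ℝ] E →L[ℝ] ℝ} (hσ : ∀ u, σ u u = 0)
    {G : E →L[ℝ] E →L[ℝ] E} {s : E}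
    (h : ∀ u v, coordTorsion G u v = σ s v • u - σ s u • v + (2 * σ u v) • s) (u : E) :
    torsionTrace G u = -((Module.finrank ℝ E + 1) * σ s u) := by
  set b := Module.finBasis ℝ E
  have h1 (f : E →L[ℝ] ℝ) (w : E) : ∑ i, f (b i) * b.repr w i = f w := by
    conv_rhs => rw [← b.sum_repr w, map_sum]
    simp [mul_comm]
  have h2 : torsionTrace G u = ∑ i, b.repr (coordTorsion G u (b i)) i := by
    simp [torsionTrace, coordTorsion, b]
  have h3 (i) : b.repr (coordTorsion G u (b i)) i =
      σ s (b i) * b.repr u i - σ s u + 2 * (σ u (b i) * b.repr s i) := by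
    rw [h]
    simp [mul_assoc]
  rw [h2, Finset.sum_congr rfl fun i _ ↦ h3 i, Finset.sum_add_distrib, Finset.sum_sub_distrib, h1,
    ← Finset.mul_sum, h1, apply_swap hσ u s]
  simp
  ring

set_option synthInstance.maxHeartbeats 200000 in
theorem contMDiffAt_torsionTrace [FiniteDimensional ℝ E] {Γ : M → E →L[ℝ] E →L[ℝ] E} {y : M}
    (hΓ : ContMDiffAt 𝓘(ℝ, E) 𝓘(ℝ, E →L[ℝ] E →L[ℝ] E) ∞ Γ y) :
    ContMDiffAt 𝓘(ℝ, E) 𝓘(ℝ, E →L[ℝ] ℝ) ∞ (fun y ↦ torsionTrace (Γ y)) y := by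
  unfold torsionTrace
  exact ContMDiffAt.sum fun i _ ↦ contMDiffAt_const.clm_comp
    (((contMDiffAt_clm_flip hΓ).clm_apply contMDiffAt_const).sub (hΓ.clm_apply contMDiffAt_const))

variable [IsManifold 𝓘(ℝ, E) ∞ M] {Ω : SymplecticForm E M} {D : LinearConnection E M}

/-- The connection `∇_u W - (Ω(s, W) u + Ω(u, W) s)`, which is torsion-free if the torsion of `∇` is
determined by `s`. -/
def torsionFreeConnection (Ω : SymplecticForm E M) (D : LinearConnection E M)
    (s : Π x : M, TangentSpace 𝓘(ℝ, E) x) : LinearConnection E M :=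
  CovariantDerivative.addOneForm D fun x ↦
    (torsionCorrection (formCoeff Ω x x) (s x) : E →L[ℝ] E →L[ℝ] E)

theorem torsionFreeConnection_apply (s W : Π x : M, TangentSpace 𝓘(ℝ, E) x) (x : M)
    (u : TangentSpace 𝓘(ℝ, E) x) : torsionFreeConnection Ω D s W x u =
      D W x u - (Ω.toFun x (s x) (W x) • u + Ω.toFun x u (W x) • s x) := by
  have h := torsionCorrection_apply (formCoeff Ω x x) (s x) (W x) u
  have h1 := formCoeff_self (Ω := Ω) x (s x) (W x)
  have h2 := formCoeff_self (Ω := Ω) x u (W x)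
  rw [h1, h2] at h
  exact (congrArg (D W x u + ·) h).trans (sub_eq_add_neg _ _).symm

variable [FiniteDimensional ℝ E]

/-- If the twistor structure is integrable, then the torsion is determined by a vector field. -/
theorem exists_torsion_eq_of_isIntegrable [T2Space M] (hD : IsAlmostSymplectic Ω D)
    (h : IsIntegrableAlmostComplex (endModel E) (twistorBundle Ω) (twistorStructure D)) :
    ∃ s : Π x : M, TangentSpace 𝓘(ℝ, E) x, ∀ x u v,
      D.torsion x u v = Ω.toFun x (s x) v • u - Ω.toFun x (s x) u • v +
        (2 * Ω.toFun x u v) • s x := by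
  rw [isIntegrable_twistorStructure_iff hD] at h
  suffices h : ∀ x, ∃ s : TangentSpace 𝓘(ℝ, E) x, ∀ u v, D.torsion x u v =
      Ω.toFun x s v • u - Ω.toFun x s u • v + (2 * Ω.toFun x u v) • s by
    choose s hs using h
    exact ⟨s, hs⟩
  intro x
  obtain ⟨s, hs⟩ := exists_torsion_eq (σ := formCoeff Ω x x)
    (T := connCoeff D x x - (connCoeff D x x).flip) (formCoeff_self_apply Ω x x)
    (formCoeff_nondegenerate Ω (mem_chart_source E x))
    (fun u v ↦ (neg_sub _ _).symm) (formCoeff_torsion_cyclic hD (mem_chart_source E x))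
    (fun j hj a b ↦ (h x _ _ rfl rfl j hj a b).1)
  refine ⟨s, fun u v ↦ (D.torsion_self x u v).trans ((hs u v).trans ?_)⟩
  have key {c₁ c₂ c₃ d₁ d₂ d₃ : ℝ} (h₁ : c₁ = d₁) (h₂ : c₂ = d₂) (h₃ : c₃ = d₃) (u v s : E) :
      c₁ • u - c₂ • v + (2 * c₃) • s = d₁ • u - d₂ • v + (2 * d₃) • s := by
    rw [h₁, h₂, h₃]
  exact key (formCoeff_self x s v) (formCoeff_self x s u) (formCoeff_self x u v) u v s

theorem coordTorsion_eq_of_torsion_eq {s : Π x : M, TangentSpace 𝓘(ℝ, E) x}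
    (hs : ∀ x u v, D.torsion x u v = Ω.toFun x (s x) v • u - Ω.toFun x (s x) u • v +
        (2 * Ω.toFun x u v) • s x) {x₀ y : M} (hy : y ∈ (chartAt E x₀).source) (a b : E) :
    coordTorsion (connCoeff D x₀ y) a b = formCoeff Ω x₀ y (toCoord x₀ y (s y)) b • a -
      formCoeff Ω x₀ y (toCoord x₀ y (s y)) a • b +
      (2 * formCoeff Ω x₀ y a b) • toCoord x₀ y (s y) := by
  have h := congrArg (toCoord x₀ y) (D.torsion_coord hy a b)
  rw [toCoord_ofCoord hy, hs] at h
  rw [← h]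
  simp only [map_add, map_sub, map_smul, toCoord_ofCoord hy, formCoeff_apply, ofCoord_toCoord hy]

theorem connCoeff_torsionFreeConnection (s : Π x : M, TangentSpace 𝓘(ℝ, E) x) {x₀ y : M}
    (hy : y ∈ (chartAt E x₀).source) (u w : E) :
    connCoeff (torsionFreeConnection Ω D s) x₀ y u w = connCoeff D x₀ y u w +
      torsionCorrection (formCoeff Ω x₀ y) (toCoord x₀ y (s y)) w u := by
  have h := congrArg (toCoord x₀ y)
    ((torsionFreeConnection Ω D s).apply_ofCoord_const hy w (ofCoord x₀ y u))
  rw [toCoord_ofCoord hy, toCoord_ofCoord hy, torsionFreeConnection_apply,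
    D.apply_ofCoord_const hy, toCoord_ofCoord hy] at h
  rw [← h, torsionCorrection_apply, ← sub_eq_add_neg]
  simp only [map_add, map_sub, map_smul, toCoord_ofCoord hy, formCoeff_apply, ofCoord_toCoord hy]

theorem torsion_torsionFreeConnection {s : Π x : M, TangentSpace 𝓘(ℝ, E) x}
    (hs : ∀ x u v, D.torsion x u v = Ω.toFun x (s x) v • u - Ω.toFun x (s x) u • v +
        (2 * Ω.toFun x u v) • s x) : (torsionFreeConnection Ω D s).torsion = 0 := by
  rw [LinearConnection.torsion_eq_zero_iff]
  intro x
  funext u v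
  have hx := mem_chart_source E x
  have h := coordTorsion_eq_of_torsion_eq hs hx u v
  rw [coordTorsion, sub_eq_iff_eq_add] at h
  rw [coordTorsion, connCoeff_torsionFreeConnection s hx, connCoeff_torsionFreeConnection s hx, h,
    torsionCorrection_apply, torsionCorrection_apply, apply_swap (formCoeff_self_apply Ω x x) v u]
  simp only [Pi.zero_apply]
  module

theorem sameTwistorStructure_torsionFreeConnection [T2Space M] (hD : IsAlmostSymplectic Ω D)
    (s : Π x : M, TangentSpace 𝓘(ℝ, E) x) :
    SameTwistorStructure Ω (torsionFreeConnection Ω D s) D := by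
  rw [sameTwistorStructure_iff hD]
  rintro x j hj B rfl a
  refine commutator_torsionCorrection hj (toCoord x x (s x)) (fun u w ↦ ?_) a
  rw [_root_.sub_apply, _root_.sub_apply,
    connCoeff_torsionFreeConnection s (mem_chart_source E x), add_sub_cancel_left]

/-- The connection is smooth, since the vector field `s` enters its coefficients only through the
torsion and the trace of the torsion. -/
theorem contMDiff_torsionFreeConnection [T2Space M] (hD : D.ContMDiffCovariantDerivative ∞)
    {s : Π x : M, TangentSpace 𝓘(ℝ, E) x}
    (hs : ∀ x u v, D.torsion x u v = Ω.toFun x (s x) v • u - Ω.toFun x (s x) u • v +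
        (2 * Ω.toFun x u v) • s x) :
    (torsionFreeConnection Ω D s).ContMDiffCovariantDerivative ∞ := by
  refine ⟨⟨fun {W} hW ↦ contMDiffOn_univ.2 fun x₀ ↦ ?_⟩⟩
  have hx := mem_chart_source E x₀
  have h1 := (contMDiffOn_univ.1 (hD.contMDiff.contMDiff (σ := W) hW)).contMDiffAt (x := x₀)
  rw [(trivializationAt (E →L[ℝ] E) (fun x : M ↦ TangentSpace 𝓘(ℝ, E) x →L[ℝ]
    TangentSpace 𝓘(ℝ, E) x) x₀).contMDiffAt_section_iff ⟨hx, hx⟩] at h1 ⊢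
  have hw : ContMDiffAt 𝓘(ℝ, E) 𝓘(ℝ, E) ∞ (fun y ↦ toCoord x₀ y (W y)) x₀ :=
    (contMDiffAt_section_iff_toCoord hx).1 ((contMDiffOn_univ.1 hW).contMDiffAt.of_le (by simp))
  have hΓ := contMDiffAt_connCoeff hD hx
  set n : ℝ := Module.finrank ℝ E + 1 with hn
  have hn0 : n ≠ 0 := by positivity
  have hc (c : ℝ) : ContMDiffAt 𝓘(ℝ, E) 𝓘(ℝ) ∞ (fun _ : M ↦ c) x₀ := contMDiffAt_const
  have hl : ContMDiffAt 𝓘(ℝ, E) 𝓘(ℝ, E →L[ℝ] ℝ) ∞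
      (fun y ↦ (-n⁻¹) • torsionTrace (connCoeff D x₀ y)) x₀ :=
    (hc (-n⁻¹)).smul (contMDiffAt_torsionTrace hΓ)
  have hid : ContMDiffAt 𝓘(ℝ, E) 𝓘(ℝ, E →L[ℝ] E) ∞
      (fun _ : M ↦ ContinuousLinearMap.id ℝ E) x₀ := contMDiffAt_const
  have h2 := h1.sub ((hc (1 / 2)).smul
    (((((contMDiffAt_clm_flip hΓ).clm_apply hw).sub (hΓ.clm_apply hw)).add
      ((hl.clm_apply hw).smul hid)).add (contMDiffAt_smulRight hl hw)))
  refine h2.congr_of_eventuallyEq ?_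
  filter_upwards [(chartAt E x₀).open_source.mem_nhds hx] with y hy
  refine ContinuousLinearMap.ext fun u ↦ ?_
  change toCoord x₀ y (torsionFreeConnection Ω D s W y (ofCoord x₀ y u)) =
    toCoord x₀ y (D W y (ofCoord x₀ y u)) - (1 / 2 : ℝ) •
      (connCoeff D x₀ y u (toCoord x₀ y (W y)) - connCoeff D x₀ y (toCoord x₀ y (W y)) u +
        (-n⁻¹ * torsionTrace (connCoeff D x₀ y) (toCoord x₀ y (W y))) • u +
        (-n⁻¹ * torsionTrace (connCoeff D x₀ y) u) • toCoord x₀ y (W y))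
  -- `2 (σ(s, w) u + σ(u, w) s) = T(u, w) + σ(s, w) u + σ(s, u) w`
  have hT := coordTorsion_eq_of_torsion_eq hs hy
  have hT2 := hT u (toCoord x₀ y (W y))
  rw [coordTorsion] at hT2
  have hl (v) : -n⁻¹ * torsionTrace (connCoeff D x₀ y) v =
      formCoeff Ω x₀ y (toCoord x₀ y (s y)) v := by
    rw [torsionTrace_eq (formCoeff_self_apply Ω x₀ y) hT, ← hn]
    field_simp
  rw [hT2, hl, hl, torsionFreeConnection_apply, map_sub, map_add, map_smul, map_smul,
    toCoord_ofCoord hy, ← formCoeff_toCoord Ω hy, ← formCoeff_toCoord Ω hy, toCoord_ofCoord hy]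
  module

theorem isSymplecticConnection_torsionFreeConnection [T2Space M] (hD : IsAlmostSymplectic Ω D)
    {s : Π x : M, TangentSpace 𝓘(ℝ, E) x}
    (hs : ∀ x u v, D.torsion x u v = Ω.toFun x (s x) v • u - Ω.toFun x (s x) u • v +
        (2 * Ω.toFun x u v) • s x) :
    IsSymplecticConnection Ω (torsionFreeConnection Ω D s) where
  smooth := contMDiff_torsionFreeConnection hD.smooth hs
  parallel x v Y Z hY hZ := by
    have hswap (u w : TangentSpace 𝓘(ℝ, E) x) : Ω.toFun x u w = -Ω.toFun x w u := by
      rw [← formCoeff_self, ← formCoeff_self]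
      exact apply_swap (formCoeff_self_apply Ω x x) u w
    rw [hD.parallel x v Y Z hY hZ, torsionFreeConnection_apply, torsionFreeConnection_apply]
    simp only [map_sub, map_add, map_smul, _root_.sub_apply, _root_.add_apply, _root_.smul_apply,
      smul_eq_mul]
    rw [hswap (Y x) v, hswap (Y x) (s x)]
    ring
  torsion_eq_zero := torsion_torsionFreeConnection hs

end Torsion

end

theorem theorem6p5 {E : Type*} [NormedAddCommGroup E] [NormedSpace ℝ E] [FiniteDimensional ℝ E]
    {M : Type*} [TopologicalSpace M] [T2Space M] [SecondCountableTopology M] [ChartedSpace E M]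
    [IsManifold 𝓘(ℝ, E) ∞ M] (Ω : SymplecticForm E M) :
    (∀ D : LinearConnection E M, IsAlmostSymplectic Ω D →
      IsIntegrableAlmostComplex (endModel E) (twistorBundle Ω) (twistorStructure D) →
        ∃ D' : LinearConnection E M,
          IsSymplecticConnection Ω D' ∧ SameTwistorStructure Ω D' D) ∧
    (∀ D D' : LinearConnection E M, IsSymplecticConnection Ω D → IsSymplecticConnection Ω D' →
      SameTwistorStructure Ω D' D → SameConnection D D') ∧
    (∀ D : LinearConnection E M, IsSymplecticConnection Ω D →
      (IsIntegrableAlmostComplex (endModel E) (twistorBundle Ω) (twistorStructure D) ↔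
        IsRicciType Ω D)) := by
  refine ⟨fun D hD h ↦ ?_, fun D D' hD hD' h ↦ sameConnection_of_sameTwistorStructure hD hD' h,
    fun D hD ↦ isIntegrable_twistorStructure_iff_isRicciType hD⟩
  obtain ⟨s, hs⟩ := exists_torsion_eq_of_isIntegrable hD h
  exact ⟨torsionFreeConnection Ω D s, isSymplecticConnection_torsionFreeConnection hD hs,
    sameTwistorStructure_torsionFreeConnection hD s⟩
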